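/- Let $K$ be a simply connected Hilbert--Lie group, i.e. a Lie group whose Lie algebra $\mathfrak k$ is a real Hilbert space with $\langle [x,y],z\rangle=\langle x,[y,z]\rangle$ for all $x,y,z\in\mathfrak k$, and suppose that $\mathfrak k$ is simple, i.e. $\{0\}$ and $\mathfrak k$ are its only closed ideals. Let $\varphi$ be an automorphism of the Lie group $K$ of finite order $N$ for which $\mathbf L(\varphi)$ acts isometrically on $\mathfrak k$, and suppose that the fixed point algebra $\mathfrak k^\varphi=\{x\in\mathfrak k:\mathbf L(\varphi)x=x\}$ has trivial center. Let $$\mathcal L_\varphi(K)=\{f\in C^\infty(\mathbb R,K): f(t+\tfrac{2\pi}{N})=\varphi^{-1}(f(t))\ \text{for all } t\in\mathbb R\}$$ be the twisted loop group, a Fréchet--Lie group modeled on $\mathcal L_\varphi(\mathfrak k)=\{\xi\in C^\infty(\mathbb R,\mathfrak k): \xi(t+\tfrac{2\pi}{N})=\mathbf L(\varphi)^{-1}\xi(t)\ \text{for all } t\in\mathbb R\}$ with charts given by $\xi\mapsto\exp_K\circ\,\xi$, and let $\mathbb R$ act on it by $(\alpha_Tf)(t)=f(t+T)$. Let $(\pi,\mathcal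 H)$ be a smooth unitary representation of the Fréchet--Lie group $\mathcal L_\varphi(K)\rtimes_\alpha\mathbb R$ on a complex Hilbert space, i.e. the space $\mathcal H^\infty$ of vectors with smooth orbit map is dense in $\mathcal H$. Let $\mathrm d\pi(0,1)v=\frac{d}{dt}\big|_{t=0}\pi(\mathbf 1,t)v$ for $v\in\mathcal H^\infty$. If the operator $-i\,\mathrm d\pi(0,1)$ is bounded from below, i.e. there is $c\in\mathbb R$ with $\langle -i\,\mathrm d\pi(0,1)v,v\rangle\ge c\|v\|^2$ for all $v\in\mathcal H^\infty$, then $\pi(f,0)=\mathbf 1$ for every $f\in\mathcal L_\varphi(K)$. -/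

import Mathlib

open scoped Manifold ContDiff

noncomputable section

namespace HilbertLoop

/-! ### Smooth maps on topological vector spaces -/

/-- A map `f` from a real topological vector space to a real normed space is smooth on the open
set `U` in the sense of Michal and Bastiani: all iterated directional derivatives
`D k x (h_k, …, h_1)` exist for `x ∈ U`, and each of them is continuous on `U × X^k`. -/
def BastianiSmoothOn {X F : Type*} [AddCommGroup X] [Module ℝ X] [TopologicalSpace X]
    [NormedAddCommGroup F] [NormedSpace ℝ F] (f : X → F) (U : Set X) : Prop :=
  IsOpen U ∧ ∃ D : (k : ℕ) → X → (Fin k → X) → F,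
    (∀ x ∈ U, ∀ h, D 0 x h = f x) ∧
    (∀ k, ContinuousOn (fun p : X × (Fin k → X) => D k p.1 p.2) (U ×ˢ Set.univ)) ∧
    (∀ k, ∀ x ∈ U, ∀ (h : Fin k → X) (y : X),
      HasDerivAt (fun t : ℝ => D k (x + t • y) h) (D (k + 1) x (Fin.cons y h)) 0)

section Group

variable (E : Type*) [NormedAddCommGroup E] [InnerProductSpace ℝ E]
  {K : Type*} [TopologicalSpace K] [ChartedSpace E K] [Group K]

/-! ### Hilbert–Lie groups

The Lie algebra of `K` is the tangent space at `1`, whose underlying Hilbert space is the model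
space `E`; its bracket is the one of left invariant vector fields. -/

variable (K) in
/-- The Lie bracket of the Lie algebra of `K`, on the underlying Hilbert space `E`. -/
def bracket (x y : E) : E :=
  Bracket.bracket (L := GroupLieAlgebra 𝓘(ℝ, E) K) (M := GroupLieAlgebra 𝓘(ℝ, E) K) x y

variable (K) in
/-- The scalar product of the Lie algebra is invariant: the Lie algebra of `K` is a
Hilbert–Lie algebra. -/
def IsHilbertLie : Prop :=
  ∀ x y z : E, inner ℝ (bracket E K x y) z = inner ℝ x (bracket E K y z)

variable (K) in
/-- The only closed ideals of the Lie algebra of `K` are `0` and the whole algebra. -/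
def IsSimpleHilbertLie : Prop :=
  ∀ J : Submodule ℝ E, IsClosed (J : Set E) → (∀ x, ∀ y ∈ J, bracket E K x y ∈ J) →
    J = ⊥ ∨ J = ⊤

/-- The automorphism `L(φ)` of the Lie algebra induced by `φ`: the derivative of `φ` at `1`
(note that `φ 1 = 1`). -/
def lieMap (φ : MulAut K) : E →L[ℝ] E :=
  mfderiv 𝓘(ℝ, E) 𝓘(ℝ, E) (fun k : K => φ k) 1

/-- `φ` belongs to `Aut(K)`: it is an automorphism of the Lie group `K` whose derivative acts
by isometries with respect to the scalar product of the Lie algebra. -/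
structure IsLieAut (φ : MulAut K) : Prop where
  smooth : ContMDiff 𝓘(ℝ, E) 𝓘(ℝ, E) ∞ (fun k : K => φ k)
  smooth_inv : ContMDiff 𝓘(ℝ, E) 𝓘(ℝ, E) ∞ (fun k : K => φ⁻¹ k)
  isometry : ∀ x y : E, inner ℝ (lieMap E φ x) (lieMap E φ y) = inner ℝ x y

/-- The fixed point algebra of `L(φ)` has trivial center. -/
def FixedCenterTrivial (φ : MulAut K) : Prop :=
  ∀ x : E, lieMap E φ x = x → (∀ y : E, lieMap E φ y = y → bracket E K x y = 0) → x = 0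

/-- `γ` is a one-parameter group of `K` with `γ'(0) = x`. -/
def IsOneParam (x : E) (γ : ℝ → K) : Prop :=
  (∀ s t, γ (s + t) = γ s * γ t) ∧
    HasMFDerivAt 𝓘(ℝ, ℝ) 𝓘(ℝ, E) γ 0 (ContinuousLinearMap.toSpanSingleton ℝ x)

open Classical in
variable (K) in
/-- The exponential function of `K`: `groupExp x = γ 1` for the one-parameter group `γ` with
`γ'(0) = x`. -/
def groupExp (x : E) : K :=
  if h : ∃ γ : ℝ → K, IsOneParam E x γ then h.choose 1 else 1

/-! ### Twisted loops -/

/-- The twisted loop algebra, as a space of functions: smooth `ξ : ℝ → 𝔨` with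
`ξ(t + 2π/N) = L(φ)⁻¹ ξ(t)`, where `N` is the order of `φ`. -/
def twistedLoopSubmodule (φ : MulAut K) : Submodule ℝ (ℝ → E) where
  carrier := {ξ | ContDiff ℝ ∞ ξ ∧
    ∀ t, ξ (t + 2 * Real.pi / orderOf φ) = lieMap E φ⁻¹ (ξ t)}
  add_mem' := by
    rintro a b ⟨ha, ha'⟩ ⟨hb, hb'⟩
    exact ⟨ha.add hb, fun t => by simp [ha', hb']⟩
  zero_mem' := ⟨contDiff_const, fun t => by simp⟩
  smul_mem' := by
    rintro c a ⟨ha, ha'⟩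
    exact ⟨contDiff_const.smul ha, fun t => by simp [ha']⟩

/-- The twisted loop algebra `𝓛_φ(𝔨)`; it carries the `C^∞`-topology defined below and not the
topology of pointwise convergence. -/
def TwistedLoopAlgebra (φ : MulAut K) : Type _ := ↥(twistedLoopSubmodule E φ)

instance (φ : MulAut K) : AddCommGroup (TwistedLoopAlgebra E φ) :=
  inferInstanceAs (AddCommGroup ↥(twistedLoopSubmodule E φ))

instance (φ : MulAut K) : Module ℝ (TwistedLoopAlgebra E φ) :=
  inferInstanceAs (Module ℝ ↥(twistedLoopSubmodule E φ))

/-- The `n`-th derivative of a twisted loop, as a continuous map. -/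
def TwistedLoopAlgebra.deriv {φ : MulAut K} (n : ℕ) (ξ : TwistedLoopAlgebra E φ) : C(ℝ, E) :=
  ⟨iteratedDeriv n ξ.1, ξ.2.1.continuous_iteratedDeriv n (by exact_mod_cast le_top)⟩

/-- The `C^∞`-topology: locally uniform convergence of all derivatives. -/
instance (φ : MulAut K) : TopologicalSpace (TwistedLoopAlgebra E φ) :=
  ⨅ n : ℕ, TopologicalSpace.induced (TwistedLoopAlgebra.deriv E n) inferInstance

variable [LieGroup 𝓘(ℝ, E) ∞ K]

/-- The twisted loop group `𝓛_φ(K)`: smooth `f : ℝ → K` with `f(t + 2π/N) = φ⁻¹(f(t))`, where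
`N` is the order of `φ`, under pointwise multiplication. -/
def twistedLoopGroup (φ : MulAut K) : Subgroup (ℝ → K) where
  carrier := {f | ContMDiff 𝓘(ℝ, ℝ) 𝓘(ℝ, E) ∞ f ∧
    ∀ t, f (t + 2 * Real.pi / orderOf φ) = φ⁻¹ (f t)}
  mul_mem' := by
    rintro a b ⟨ha, ha'⟩ ⟨hb, hb'⟩
    exact ⟨ha.mul hb, fun t => by simp only [Pi.mul_apply, ha', hb', map_mul]⟩
  one_mem' := ⟨contMDiff_const, fun t => by simp only [Pi.one_apply, map_one]⟩
  inv_mem' := by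
    rintro a ⟨ha, ha'⟩
    exact ⟨ha.inv, fun t => by simp only [Pi.inv_apply, ha', map_inv]⟩

/-- The translation `α_T(f)(t) = f(t + T)` of twisted loops. -/
def translate (φ : MulAut K) (T : ℝ) (f : twistedLoopGroup E φ) : twistedLoopGroup E φ :=
  ⟨fun t => f.1 (t + T), by
    refine ⟨f.2.1.comp ?_, fun t => ?_⟩
    · exact (contDiff_id.add contDiff_const).contMDiff
    · rw [← f.2.2 (t + T)]
      exact congrArg f.1 (by ring)⟩

/-- The action `α` of `ℝ` on the twisted loop group by translations. -/
def translation (φ : MulAut K) : Multiplicative ℝ →* MulAut (twistedLoopGroup E φ) where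
  toFun T :=
    { toFun := translate E φ T.toAdd
      invFun := translate E φ (-T.toAdd)
      left_inv := fun f => Subtype.ext (funext fun t => by simp [translate])
      right_inv := fun f => Subtype.ext (funext fun t => by simp [translate])
      map_mul' := fun f g => rfl }
  map_one' := by
    ext f t
    simp [translate]
  map_mul' S T := by
    ext f t
    exact congrArg f.1 (add_assoc t S.toAdd T.toAdd).symm

/-- The semidirect product `𝓛_φ(K) ⋊_α ℝ`. -/
abbrev LoopSemidirect (φ : MulAut K) : Type _ :=
  twistedLoopGroup E φ ⋊[translation E φ] Multiplicative ℝ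

open Classical in
/-- The exponential function of the twisted loop group, `ξ ↦ exp ∘ ξ`. -/
def loopExp (φ : MulAut K) (ξ : TwistedLoopAlgebra E φ) : twistedLoopGroup E φ :=
  if h : (fun t => groupExp E K (ξ.1 t)) ∈ twistedLoopGroup E φ then ⟨_, h⟩ else 1

/-- Inverses of charts of `𝓛_φ(K) ⋊_α ℝ`: near `(f, s)` the manifold is parametrized by
`(ξ, r) ↦ (f · exp ξ, s + r)`, with `(ξ, r)` in a neighborhood of `0` in `𝓛_φ(𝔨) × ℝ`. -/
def chartInv (φ : MulAut K) (g : LoopSemidirect E φ) (p : TwistedLoopAlgebra E φ × ℝ) :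
    LoopSemidirect E φ :=
  ⟨g.left * loopExp E φ p.1, g.right * Multiplicative.ofAdd p.2⟩

/-- Smooth maps from the Fréchet–Lie group `𝓛_φ(K) ⋊_α ℝ` to a real normed space. -/
def IsSmoothMap (φ : MulAut K) {F : Type*} [NormedAddCommGroup F] [NormedSpace ℝ F]
    (u : LoopSemidirect E φ → F) : Prop :=
  ∀ g, ∃ U : Set (TwistedLoopAlgebra E φ × ℝ), 0 ∈ U ∧
    BastianiSmoothOn (fun p => u (chartInv E φ g p)) U

/-! ### Unitary representations -/

variable {H : Type*} [NormedAddCommGroup H] [InnerProductSpace ℂ H]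

/-- The set of smooth vectors: those with smooth orbit map. -/
def smoothVectors (φ : MulAut K) (π : LoopSemidirect E φ →* (H ≃ₗᵢ[ℂ] H)) : Set H :=
  {v | IsSmoothMap E φ (fun g => π g v)}

/-- The derived representation at `(0, 1)`: the derivative at `0` of
`t ↦ π(exp t(0,1)) v = π(1, t) v`. -/
def derivedD (φ : MulAut K) (π : LoopSemidirect E φ →* (H ≃ₗᵢ[ℂ] H)) (v : H) : H :=
  deriv (fun t : ℝ => π (SemidirectProduct.inr (Multiplicative.ofAdd t)) v) 0

/-- The operator `-i dπ(0,1)` on the space of smooth vectors is bounded from below. -/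
def BoundedBelow (φ : MulAut K) (π : LoopSemidirect E φ →* (H ≃ₗᵢ[ℂ] H)) : Prop :=
  ∃ c : ℝ, ∀ v ∈ smoothVectors E φ π,
    c * ‖v‖ ^ 2 ≤ (inner ℂ v (-Complex.I • derivedD E φ π v)).re

end Group

end HilbertLoop

end

noncomputable section

namespace HilbertLoop

/-! ### Smooth dependence of flows on the initial condition -/

section Flow

open Set Metric

variable {F : Type*} [NormedAddCommGroup F] [NormedSpace ℝ F]

/-! Write `D` for the generator of the translations. If `ξ` is a twisted loop for which `ξ(t)` and
`ξ(t + r)` lie on a common line for all `t` and all small `r`, then the exponentials of these values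
commute, and conjugating `D` by `exp(sξ)` produces `D + sξ'`. The lower bound for `-i dπ(D)` is
invariant under unitary conjugation, so `-i dπ(D + sξ')` has the same lower bound for every real
`s`. An affine function of `s` that is bounded below has slope zero, hence `⟨v, dπ(ξ')v⟩ = 0` on
smooth vectors, and polarization gives `dπ(ξ') = 0` (`dloop_mem_dKer`).

It remains to see that such derivatives generate everything. The kernel `dKer` of the derived
representation on the loop algebra is a closed subspace, and it is stable under those conjugations
in the loop group that are needed. Let `h` be a scalar function supported inside one period. Up to
an error near the ends of the period, `h x` is the derivative of a loop with values on a line.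
Conjugation by a loop that equals `exp y` on the support of `h` and `1` where the error lives shows
that `h (Ad(exp y) x - x)` is in the kernel (`loopOf_adjoint_sub_mem`), and differentiation in `y`
gives `h [y, x]`. By simplicity all `h x` are in the kernel (`loopOf_smul_mem`). Finite sums, limits
and a partition of the period into two overlapping arcs then give every loop
(`mem_dKer_of_nonabelian`). If the bracket vanishes, the algebra is at most a line; on a nonzero one
`L(φ) = -1`, and every twisted loop is itself the derivative of a twisted loop
(`mem_dKer_of_abelian`).

So `π` is trivial on all `exp ∘ ξ` (`map_loopExp`). These generate the twisted loop group because
`K` is simply connected (`subgroup_eq_top`): evaluation at `0` is onto already on the generated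
subgroup, and a loop starting at `1` is contracted through a chain of loops, each uniformly close to
the next.

Two analytic ingredients have to be supplied. One is the exponential function of a Lie group
modelled on a Hilbert space: its smoothness, its local inverse, and the formula for the derivative
of the adjoint action. The other is the passage of a lower bound from an invariant dense domain to
the whole domain of the generator (`semibounded_of_dense_invariant`), since `π(exp(sξ))v` is only
shown to be differentiable under translations. -/

lemma gronwallBound_zero_eq_mul (K ε x : ℝ) :
    gronwallBound 0 K ε x = ε * gronwallBound 0 K 1 x := by
  by_cases hK : K = 0
  · subst hK; simp [gronwallBound_K0]
  · simp only [gronwallBound_of_K_ne_0 hK]; ring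

/-- The mean value inequality is applied to `X` minus its linearization at `a`, on the part of `B`
within distance `‖b - a‖` of `a`. There the derivative of the difference is at most `C * ‖b - a‖`.
-/
lemma norm_sub_sub_fderiv_le {X : F → F} {B : Set F} (hB : Convex ℝ B) {C : ℝ} (hC : 0 ≤ C)
    (hd : ∀ z ∈ B, DifferentiableAt ℝ X z)
    (hl : ∀ y ∈ B, ∀ z ∈ B, ‖fderiv ℝ X y - fderiv ℝ X z‖ ≤ C * ‖y - z‖)
    {a b : F} (ha : a ∈ B) (hb : b ∈ B) :
    ‖X b - X a - fderiv ℝ X a (b - a)‖ ≤ C * ‖b - a‖ ^ 2 := by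
  have h := (hB.inter (convex_closedBall a ‖b - a‖)).norm_image_sub_le_of_norm_hasFDerivWithin_le'
    (f := X) (f' := fderiv ℝ X) (φ := fderiv ℝ X a) (C := C * ‖b - a‖) (x := a) (y := b)
    (fun z hz => (hd z hz.1).hasFDerivAt.hasFDerivWithinAt)
    (fun z hz => (hl z hz.1 a ha).trans (by
      have := mem_closedBall_iff_norm.1 hz.2
      gcongr))
    ⟨ha, by simp⟩ ⟨hb, by rw [mem_closedBall_iff_norm]⟩
  rwa [mul_assoc, ← sq] at h

/-- Differentiability of solutions of `u' = X(u)` in the initial condition, the derivative being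
given by the variational equation `A' = DX(u) A`. -/
lemma hasFDerivAt_of_variational {X : F → F} {B : Set F} (hB : Convex ℝ B) {C : ℝ} (hC : 0 ≤ C)
    (hd : ∀ z ∈ B, DifferentiableAt ℝ X z) (hb : ∀ z ∈ B, ‖fderiv ℝ X z‖ ≤ C)
    (hl : ∀ y ∈ B, ∀ z ∈ B, ‖fderiv ℝ X y - fderiv ℝ X z‖ ≤ C * ‖y - z‖)
    {ε : ℝ} {u : F → ℝ → F} {A : F → ℝ → F →L[ℝ] F} {V : Set F} (hV : IsOpen V)
    (hu0 : ∀ z ∈ V, u z 0 = z) (hA0 : ∀ z ∈ V, A z 0 = ContinuousLinearMap.id ℝ F)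
    (huB : ∀ z ∈ V, ∀ t ∈ Icc 0 ε, u z t ∈ B)
    (hu : ∀ z ∈ V, ∀ t ∈ Icc 0 ε, HasDerivWithinAt (u z) (X (u z t)) (Icc 0 ε) t)
    (hA : ∀ z ∈ V, ∀ t ∈ Icc 0 ε,
      HasDerivWithinAt (A z) ((fderiv ℝ X (u z t)).comp (A z t)) (Icc 0 ε) t)
    {z : F} (hz : z ∈ V) {t : ℝ} (ht : t ∈ Icc 0 ε) :
    HasFDerivAt (fun y => u y t) (A z t) z := by
  have hIci : ∀ {G : Type _} [NormedAddCommGroup G] [NormedSpace ℝ G] {f : ℝ → G} {f' : G} {s : ℝ},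
      s ∈ Ico 0 ε → HasDerivWithinAt f f' (Icc 0 ε) s → HasDerivWithinAt f f' (Ici s) s := by
    intro G _ _ f f' s hs h
    refine (h.mono (Icc_subset_Icc_left hs.1)).mono_of_mem_nhdsWithin ?_
    exact Icc_mem_nhdsGE hs.2
  set M := Real.exp (C * ε) with hM
  have hdist : ∀ y ∈ V, ∀ s ∈ Icc 0 ε, ‖u y s - u z s‖ ≤ ‖y - z‖ * M := by
    intro y hy s hs
    have h := norm_le_gronwallBound_of_norm_deriv_right_le (f := fun s => u y s - u z s)
      (f' := fun s => X (u y s) - X (u z s)) (δ := ‖y - z‖) (K := C) (ε := 0) (a := 0) (b := ε)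
      (fun s hs => ((hu y hy s hs).sub (hu z hz s hs)).continuousWithinAt)
      (fun s hs => hIci hs ((hu y hy s ⟨hs.1, hs.2.le⟩).sub (hu z hz s ⟨hs.1, hs.2.le⟩)))
      (by simp [hu0 y hy, hu0 z hz])
      (fun s hs => by
        rw [add_zero]
        exact hB.norm_image_sub_le_of_norm_fderiv_le (𝕜 := ℝ) hd hb
          (huB z hz s ⟨hs.1, hs.2.le⟩) (huB y hy s ⟨hs.1, hs.2.le⟩)) s hs
    rw [gronwallBound_ε0, sub_zero] at h
    refine h.trans ?_
    rw [hM]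
    gcongr
    exact hs.2
  set c := C * M ^ 2 * gronwallBound 0 C 1 t with hc
  -- The remainder starts at `0` and satisfies the variational equation up to a forcing term that is
  -- quadratic in `‖u y s - u z s‖`, hence in `‖y - z‖`. Gronwall's inequality makes it quadratic in
  -- `‖y - z‖` at time `t`.
  have hrem : ∀ y ∈ V, ‖u y t - u z t - A z t (y - z)‖ ≤ c * ‖y - z‖ ^ 2 := by
    intro y hy
    have h := norm_le_gronwallBound_of_norm_deriv_right_le
      (f := fun s => u y s - u z s - A z s (y - z))
      (f' := fun s => X (u y s) - X (u z s) - ((fderiv ℝ X (u z s)).comp (A z s)) (y - z))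
      (δ := 0) (K := C) (ε := C * (‖y - z‖ * M) ^ 2) (a := 0) (b := ε)
      (fun s hs => (((hu y hy s hs).sub (hu z hz s hs)).sub
        ((hA z hz s hs).clm_apply (hasDerivWithinAt_const _ _ (y - z)))).continuousWithinAt)
      (fun s hs => by
        have hs' : s ∈ Icc 0 ε := ⟨hs.1, hs.2.le⟩
        have := hIci hs (((hu y hy s hs').sub (hu z hz s hs')).sub
          ((hA z hz s hs').clm_apply (hasDerivWithinAt_const _ _ (y - z))))
        exact this.congr_deriv (by simp))
      (by simp [hu0 y hy, hu0 z hz, hA0 z hz])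
      (fun s hs => by
        have hs' : s ∈ Icc 0 ε := ⟨hs.1, hs.2.le⟩
        have h1 := norm_sub_sub_fderiv_le hB hC hd hl (huB z hz s hs') (huB y hy s hs')
        have h2 := hdist y hy s hs'
        have h3 : X (u y s) - X (u z s) - ((fderiv ℝ X (u z s)).comp (A z s)) (y - z) =
            fderiv ℝ X (u z s) (u y s - u z s - A z s (y - z)) +
            (X (u y s) - X (u z s) - fderiv ℝ X (u z s) (u y s - u z s)) := by
          simp only [map_sub, ContinuousLinearMap.comp_apply]; abel
        rw [h3]
        refine (norm_add_le _ _).trans (add_le_add ?_ (h1.trans ?_))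
        · exact (ContinuousLinearMap.le_opNorm _ _).trans
            (mul_le_mul_of_nonneg_right (hb _ (huB z hz s hs')) (norm_nonneg _))
        · gcongr) t ht
    rw [gronwallBound_zero_eq_mul, sub_zero] at h
    refine h.trans (le_of_eq ?_)
    rw [hc]; ring
  rw [hasFDerivAt_iff_isLittleO]
  have hO : (fun y => u y t - u z t - A z t (y - z)) =O[nhds z] fun y => ‖y - z‖ ^ 2 :=
    Asymptotics.IsBigO.of_bound c (by
      filter_upwards [hV.mem_nhds hz] with y hy
      simpa using hrem y hy)
  refine hO.trans_isLittleO ?_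
  have h0 : Filter.Tendsto (fun y : F => y - z) (nhds z) (nhds 0) := by
    have : Continuous fun y : F => y - z := by fun_prop
    simpa using this.tendsto z
  have h1 := (Asymptotics.isLittleO_norm_pow_id (E' := F) (n := 2) one_lt_two).comp_tendsto h0
  simpa [Function.comp_def] using h1

/-- Near a point where the vector field `X` is smooth, there is a local flow, for small times, which
is of class `C^n` in the initial condition. -/
theorem exists_contDiffOn_flow (n : ℕ) {F : Type*} [NormedAddCommGroup F] [NormedSpace ℝ F]
    [CompleteSpace F] {X : F → F} {z₀ : F} (hX : ContDiffAt ℝ ∞ X z₀) {S : Set F}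
    (hS : S ∈ nhds z₀) :
    ∃ ε > 0, ∃ r > 0, ∃ u : F → ℝ → F,
      (∀ z ∈ ball z₀ r, u z 0 = z ∧ ∀ t ∈ Icc (-ε) ε,
        HasDerivWithinAt (u z) (X (u z t)) (Icc (-ε) ε) t ∧ u z t ∈ S) ∧
      ∀ t ∈ Icc 0 ε, ContDiffOn ℝ n (fun z => u z t) (ball z₀ r) := by
  induction n generalizing F with
  | zero =>
    obtain ⟨ε, hε, a, r, L, K, hr, h⟩ :=
      IsPicardLindelof.of_contDiffAt_one (hX.of_le (by exact_mod_cast le_top))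
    obtain ⟨α, h1, h2⟩ := (h 0).exists_forall_mem_closedBall_eq_hasDerivWithinAt_continuousOn
    simp only [zero_sub, zero_add] at h1 h2
    have hz0 : ((z₀, 0) : F × ℝ) ∈ closedBall z₀ r ×ˢ Icc (-ε) ε := by
      simp [hε.le]
    have hnhds : closedBall z₀ (r : ℝ) ×ˢ Icc (-ε) ε ∈ nhds ((z₀, 0) : F × ℝ) :=
      prod_mem_nhds (closedBall_mem_nhds _ (by exact_mod_cast hr)) (Icc_mem_nhds (by linarith) hε)
    have hcont : ContinuousAt α (z₀, 0) := h2.continuousAt hnhds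
    have hα0 : α (z₀, 0) = z₀ := (h1 z₀ (by simp)).1
    have := hcont.preimage_mem_nhds (hα0.symm ▸ hS)
    obtain ⟨δ, hδ, hδS⟩ := Metric.mem_nhds_iff.1 this
    set δ' := min (δ / 2) (min ε r)
    have hδ' : 0 < δ' := lt_min (half_pos hδ) (lt_min hε (by exact_mod_cast hr))
    have e1 : δ' ≤ δ / 2 := min_le_left _ _
    have e2 : δ' ≤ ε := (min_le_right _ _).trans (min_le_left _ _)
    have e3 : δ' ≤ r := (min_le_right _ _).trans (min_le_right _ _)
    have hsub : Icc (-δ') δ' ⊆ Icc (-ε) ε := Icc_subset_Icc (by linarith) e2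
    have hball : ball z₀ δ' ⊆ closedBall z₀ r :=
      ball_subset_closedBall.trans (closedBall_subset_closedBall e3)
    refine ⟨δ', hδ', δ', hδ', fun z t => α (z, t), fun z hz => ⟨(h1 z (hball hz)).1, fun t ht =>
      ⟨((h1 z (hball hz)).2 t (hsub ht)).mono hsub, ?_⟩⟩, fun t ht => ?_⟩
    · refine hδS ?_
      rw [mem_ball, Prod.dist_eq, max_lt_iff]
      refine ⟨(mem_ball.1 hz).trans_le (by linarith), ?_⟩
      rw [Real.dist_eq, sub_zero]
      exact (abs_le.2 ht).trans_lt (by linarith)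
    · simp only [Nat.cast_zero, contDiffOn_zero]
      exact h2.comp (by fun_prop) fun z hz => ⟨hball hz, hsub ⟨by linarith [ht.1], ht.2⟩⟩
  | succ n ih =>
    have hX' : ContDiffAt ℝ ∞ (fderiv ℝ X) z₀ := hX.fderiv_right (by simp)
    obtain ⟨K, s, hs, hl⟩ := (hX'.of_le (m := 1) (by exact_mod_cast le_top)).exists_lipschitzOnWith
    have hbd : ∀ᶠ z in nhds z₀, ‖fderiv ℝ X z‖ < ‖fderiv ℝ X z₀‖ + 1 :=
      hX'.continuousAt.norm.eventually_lt continuousAt_const (by simp)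
    have hdiff : ∀ᶠ z in nhds z₀, ContDiffAt ℝ 1 X z :=
      (hX.of_le (m := 1) (by exact_mod_cast le_top)).eventually (by simp)
    obtain ⟨δ, hδ, hδs⟩ := Metric.mem_nhds_iff.1 (Filter.inter_mem (Filter.inter_mem hS hs)
      (hbd.and hdiff))
    set B := ball z₀ δ
    set C : ℝ := max K (‖fderiv ℝ X z₀‖ + 1)
    have hC : 0 ≤ C := le_max_of_le_left K.2
    -- The field `Y` couples `X` with its variational equation. The second component of its flow is
    -- the derivative of the flow of `X`, so a `C^n` flow for `Y` yields a `C^(n+1)` flow for `X`.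
    -- The set `S` for `Y` confines the first component to `B`, where the derivative of `X` is
    -- bounded and Lipschitz.
    let Y : F × (F →L[ℝ] F) → F × (F →L[ℝ] F) := fun q => (X q.1, (fderiv ℝ X q.1).comp q.2)
    have hY : ContDiffAt ℝ ∞ Y (z₀, ContinuousLinearMap.id ℝ F) := by
      refine ContDiffAt.prodMk (hX.comp (z₀, ContinuousLinearMap.id ℝ F) contDiffAt_fst) ?_
      exact ContDiffAt.clm_comp (hX'.comp (z₀, ContinuousLinearMap.id ℝ F) contDiffAt_fst)
        contDiffAt_snd
    obtain ⟨ε, hε, r, hr, w, hw, hwn⟩ := ih hY (S := Prod.fst ⁻¹' B)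
      (continuousAt_fst.preimage_mem_nhds (ball_mem_nhds _ hδ))
    have hzB : ∀ z ∈ ball z₀ r, (z, ContinuousLinearMap.id ℝ F) ∈
        ball (z₀, ContinuousLinearMap.id ℝ F) r := by
      intro z hz
      simpa [Prod.dist_eq, hr] using hz
    have hinc : ContDiff ℝ n fun z : F => (z, ContinuousLinearMap.id ℝ F) :=
      contDiff_id.prodMk contDiff_const
    have hsub : Icc 0 ε ⊆ Icc (-ε) ε := Icc_subset_Icc_left (by linarith)
    have hderiv : ∀ z ∈ ball z₀ r, ∀ t ∈ Icc 0 ε,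
        HasFDerivAt (fun y => (w (y, ContinuousLinearMap.id ℝ F) t).1)
          (w (z, ContinuousLinearMap.id ℝ F) t).2 z := by
      intro z hz t ht
      refine hasFDerivAt_of_variational (X := X) (convex_ball z₀ δ) hC
        (fun y hy => (hδs hy).2.2.differentiableAt (by simp))
        (fun y hy => (hδs hy).2.1.le.trans (le_max_right _ _))
        (fun x hx y hy => ((hl.norm_sub_le (hδs hx).1.2 (hδs hy).1.2)).trans
          (mul_le_mul_of_nonneg_right (le_max_left _ _) (norm_nonneg _)))
        (ε := ε) (u := fun y t => (w (y, ContinuousLinearMap.id ℝ F) t).1)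
        (A := fun y t => (w (y, ContinuousLinearMap.id ℝ F) t).2) isOpen_ball
        (fun y hy => by simp [(hw _ (hzB y hy)).1]) (fun y hy => by simp [(hw _ (hzB y hy)).1])
        (fun y hy s hs => ((hw _ (hzB y hy)).2 s (hsub hs)).2)
        (fun y hy s hs => ?_) (fun y hy s hs => ?_) hz ht
      · exact (((hw _ (hzB y hy)).2 s (hsub hs)).1.mono hsub).fst
      · exact (((hw _ (hzB y hy)).2 s (hsub hs)).1.mono hsub).snd
    refine ⟨ε, hε, r, hr, fun z t => (w (z, ContinuousLinearMap.id ℝ F) t).1, fun z hz =>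
      ⟨by simp [(hw _ (hzB z hz)).1], fun t ht => ⟨((hw _ (hzB z hz)).2 t ht).1.fst, ?_⟩⟩,
      fun t ht => ?_⟩
    · exact (hδs ((hw _ (hzB z hz)).2 t ht).2).1.1
    · push_cast
      rw [contDiffOn_succ_iff_fderiv_of_isOpen isOpen_ball]
      refine ⟨fun z hz => (hderiv z hz t ht).differentiableAt.differentiableWithinAt, by simp, ?_⟩
      refine ContDiffOn.congr (contDiff_snd.comp_contDiffOn
        ((hwn t ht).comp hinc.contDiffOn hzB)) fun z hz => (hderiv z hz t ht).fderiv

end Flow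

/-! ### Left invariant vector fields and the multiplication in the chart at `1`. -/

section Exponential

open Set Filter Topology

variable {E : Type*} [NormedAddCommGroup E] [InnerProductSpace ℝ E]
  {K : Type*} [TopologicalSpace K] [ChartedSpace E K]

/-- Uniqueness of integral curves needs a Hausdorff manifold. Points are closed because the model
space separates them inside a chart, and for a topological group this already gives the Hausdorff
property. -/
lemma t1Space_of_chartedSpace (E : Type*) [NormedAddCommGroup E] (K : Type*) [TopologicalSpace K]
    [ChartedSpace E K] : T1Space K := by
  refine t1Space_iff_exists_open.2 fun x y hxy => ?_
  by_cases hy : y ∈ (chartAt E x).source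
  · refine ⟨(chartAt E x).source ∩ chartAt E x ⁻¹' {chartAt E x y}ᶜ,
      (chartAt E x).isOpen_inter_preimage isOpen_compl_singleton, ⟨mem_chart_source E x, ?_⟩,
      fun h => h.2 rfl⟩
    exact fun h => hxy ((chartAt E x).injOn (mem_chart_source E x) hy h)
  · exact ⟨(chartAt E x).source, (chartAt E x).open_source, mem_chart_source E x, hy⟩

variable [Group K]

variable (E) in
/-- The left invariant vector field with value `x` at `1`. -/
abbrev leftField (x : E) (g : K) : TangentSpace 𝓘(ℝ, E) g :=
  mulInvariantVectorField (I := 𝓘(ℝ, E)) (G := K) x g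

variable [LieGroup 𝓘(ℝ, E) ∞ K]

lemma lieGroup_of_smooth (E : Type*) [NormedAddCommGroup E] [InnerProductSpace ℝ E]
    (K : Type*) [TopologicalSpace K] [ChartedSpace E K] [Group K] [LieGroup 𝓘(ℝ, E) ∞ K] :
    LieGroup 𝓘(ℝ, E) (minSmoothness ℝ 3) K :=
  LieGroup.of_le (n := ∞) (by simpa using (WithTop.coe_le_coe.2 le_top : ((3 : ℕ∞) : WithTop ℕ∞) ≤ ∞))

lemma isTopologicalGroup_of_smooth (E : Type*) [NormedAddCommGroup E] [InnerProductSpace ℝ E]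
    (K : Type*) [TopologicalSpace K] [ChartedSpace E K] [Group K] [LieGroup 𝓘(ℝ, E) ∞ K] :
    IsTopologicalGroup K :=
  topologicalGroup_of_lieGroup 𝓘(ℝ, E) ∞

lemma t2Space_of_smooth (E : Type*) [NormedAddCommGroup E] [InnerProductSpace ℝ E]
    (K : Type*) [TopologicalSpace K] [ChartedSpace E K] [Group K] [LieGroup 𝓘(ℝ, E) ∞ K] :
    T2Space K := by
  have := isTopologicalGroup_of_smooth E K
  have := t1Space_of_chartedSpace E K
  infer_instance

lemma contMDiff_leftField (x : E) :
    ContMDiff 𝓘(ℝ, E) 𝓘(ℝ, E).tangent 1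
      (fun g : K => (⟨g, leftField E x g⟩ : TangentBundle 𝓘(ℝ, E) K)) := by
  have := lieGroup_of_smooth E K
  exact (contMDiff_mulInvariantVectorField (I := 𝓘(ℝ, E)) (G := K) x).of_le
    (by simp)

lemma mdifferentiableAt_mul_left (g h : K) :
    MDifferentiableAt 𝓘(ℝ, E) 𝓘(ℝ, E) (fun b : K => g * b) h :=
  (contMDiff_mul_left (I := 𝓘(ℝ, E)) (n := ∞) (a := g)).mdifferentiableAt (by simp)

lemma mfderiv_mul_left_leftField (g h : K) (x : E) :
    mfderiv 𝓘(ℝ, E) 𝓘(ℝ, E) (fun b : K => g * b) h (leftField E x h) = leftField E x (g * h) := by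
  have h1 : HasMFDerivAt 𝓘(ℝ, E) 𝓘(ℝ, E) (fun b : K => h * b) 1 
      (mfderiv 𝓘(ℝ, E) 𝓘(ℝ, E) (fun b : K => h * b) 1) := (mdifferentiableAt_mul_left h 1).hasMFDerivAt
  have h2 : HasMFDerivAt 𝓘(ℝ, E) 𝓘(ℝ, E) (fun b : K => g * b) (h * 1)
      (mfderiv 𝓘(ℝ, E) 𝓘(ℝ, E) (fun b : K => g * b) (h * 1)) :=
    (mdifferentiableAt_mul_left g (h * 1)).hasMFDerivAt
  have h3 := h2.comp 1 h1
  have h4 : ((fun b : K => g * b) ∘ fun b : K => h * b) = fun b => g * h * b := by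
    ext b; simp [mul_assoc]
  rw [h4] at h3
  have h5 := h3.mfderiv
  have h6 : leftField E x (g * h) = mfderiv 𝓘(ℝ, E) 𝓘(ℝ, E) (fun b : K => g * b) (h * 1)
      (mfderiv 𝓘(ℝ, E) 𝓘(ℝ, E) (fun b : K => h * b) 1 x) :=
    DFunLike.congr_fun h5 x
  rw [h6, mul_one]
  rfl

lemma hasMFDerivAt_mul_left_curve {γ : ℝ → K} {t : ℝ} {x : E} (g : K)
    (h : HasMFDerivAt 𝓘(ℝ, ℝ) 𝓘(ℝ, E) γ t ((1 : ℝ →L[ℝ] ℝ).smulRight (leftField E x (γ t)))) :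
    HasMFDerivAt 𝓘(ℝ, ℝ) 𝓘(ℝ, E) (fun s => g * γ s) t
      ((1 : ℝ →L[ℝ] ℝ).smulRight (leftField E x (g * γ t))) := by
  have h1 := (mdifferentiableAt_mul_left (E := E) g (γ t)).hasMFDerivAt.comp t h
  rw [← mfderiv_mul_left_leftField]
  have h2 : ((1 : ℝ →L[ℝ] ℝ).smulRight (mfderiv 𝓘(ℝ, E) 𝓘(ℝ, E) (fun b : K => g * b) (γ t)
      (leftField E x (γ t))) : ℝ →L[ℝ] E) =
      (mfderiv 𝓘(ℝ, E) 𝓘(ℝ, E) (fun b : K => g * b) (γ t)).comp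
        ((1 : ℝ →L[ℝ] ℝ).smulRight (leftField E x (γ t)) : ℝ →L[ℝ] E) := by
    refine ContinuousLinearMap.ext_ring ?_
    exact (one_smul ℝ _).trans (congrArg _ (one_smul ℝ _)).symm
  exact h2 ▸ h1

/-- The tangent space at `1` is identified with `E` through this very chart, so the derivative is
the identity and not merely an isomorphism. -/
lemma hasMFDerivAt_chart_symm_one :
    HasMFDerivAt 𝓘(ℝ, E) 𝓘(ℝ, E) (extChartAt 𝓘(ℝ, E) (1 : K)).symm
      (extChartAt 𝓘(ℝ, E) (1 : K) 1) (ContinuousLinearMap.id ℝ E) := by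
  have he : (extChartAt 𝓘(ℝ, E) (1 : K)).symm (extChartAt 𝓘(ℝ, E) (1 : K) 1) = 1 :=
    extChartAt_to_inv (I := 𝓘(ℝ, E)) (1 : K)
  refine ⟨continuousAt_extChartAt_symm (I := 𝓘(ℝ, E)) (1 : K), ?_⟩
  simp only [writtenInExtChartAt, he]
  refine HasFDerivWithinAt.congr_of_eventuallyEq (f := id) (hasFDerivWithinAt_id _ _) ?_ ?_
  · refine mem_nhdsWithin_of_mem_nhds ?_
    filter_upwards [extChartAt_target_mem_nhds (I := 𝓘(ℝ, E)) (1 : K)] with a ha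
    simpa using! (extChartAt 𝓘(ℝ, E) (1 : K)).right_inv ha
  · exact congrArg (extChartAt 𝓘(ℝ, E) (1 : K)) he

variable (K) in
/-- Multiplication in the chart at `1`. -/
def chartMul (a b : E) : E :=
  extChartAt 𝓘(ℝ, E) (1 : K)
    ((extChartAt 𝓘(ℝ, E) (1 : K)).symm a * (extChartAt 𝓘(ℝ, E) (1 : K)).symm b)

variable (K) in
/-- The left invariant vector field with value `x` at `1`, in the chart at `1`. -/
def chartField (a x : E) : E :=
  fderiv ℝ (chartMul K a) (extChartAt 𝓘(ℝ, E) (1 : K) 1) x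

lemma contDiffAt_chartMul {a b : E} (ha : a ∈ (extChartAt 𝓘(ℝ, E) (1 : K)).target)
    (hb : b ∈ (extChartAt 𝓘(ℝ, E) (1 : K)).target)
    (hab : (extChartAt 𝓘(ℝ, E) (1 : K)).symm a * (extChartAt 𝓘(ℝ, E) (1 : K)).symm b ∈
      (chartAt E (1 : K)).source) :
    ContDiffAt ℝ ∞ (fun q : E × E => chartMul K q.1 q.2) (a, b) := by
  rw [← contMDiffAt_iff_contDiffAt]
  have hopen := isOpen_extChartAt_target (I := 𝓘(ℝ, E)) (1 : K)
  have hs := contMDiffOn_extChartAt_symm (I := 𝓘(ℝ, E)) (n := ∞) (1 : K)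
  have h1 : ContMDiffAt 𝓘(ℝ, E × E) 𝓘(ℝ, E) ∞
      (fun q : E × E => (extChartAt 𝓘(ℝ, E) (1 : K)).symm q.1 *
        (extChartAt 𝓘(ℝ, E) (1 : K)).symm q.2) (a, b) :=
    ((hs.contMDiffAt (hopen.mem_nhds ha)).comp (a, b) contDiffAt_fst.contMDiffAt).mul
      ((hs.contMDiffAt (hopen.mem_nhds hb)).comp (a, b) contDiffAt_snd.contMDiffAt)
  exact (contMDiffAt_extChartAt' hab).comp (a, b) h1

/-- The map `b ↦ ψ⁻¹(a) ψ⁻¹(b)` equals `ψ⁻¹` composed with `chartMul K a` near `ψ(1)`.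
Differentiating both expressions there gives the two sides. Integral curves of left invariant fields
thereby become solutions of a differential equation in `E`. -/
lemma leftField_chart {a : E} (ha : a ∈ (extChartAt 𝓘(ℝ, E) (1 : K)).target) (x : E) :
    mfderiv 𝓘(ℝ, E) 𝓘(ℝ, E) (extChartAt 𝓘(ℝ, E) (1 : K)).symm a (chartField (E := E) K a x) =
      leftField E x ((extChartAt 𝓘(ℝ, E) (1 : K)).symm a) := by
  set ψ := extChartAt 𝓘(ℝ, E) (1 : K) with hψ
  have := isTopologicalGroup_of_smooth E K
  have he : ψ.symm (ψ 1) = 1 := extChartAt_to_inv (I := 𝓘(ℝ, E)) (1 : K)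
  have he' : ψ 1 ∈ ψ.target := mem_extChartAt_target (I := 𝓘(ℝ, E)) (1 : K)
  have hsrc : ψ.symm a ∈ ψ.source := ψ.map_target ha
  have hm : chartMul K a (ψ 1) = a := by
    simp only [chartMul, ← hψ, he, mul_one]; exact ψ.right_inv ha
  have hopen := isOpen_extChartAt_target (I := 𝓘(ℝ, E)) (1 : K)
  have hs := contMDiffOn_extChartAt_symm (I := 𝓘(ℝ, E)) (n := ∞) (1 : K)
  have d1 : HasMFDerivAt 𝓘(ℝ, E) 𝓘(ℝ, E) ψ.symm (chartMul K a (ψ 1))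
      (mfderiv 𝓘(ℝ, E) 𝓘(ℝ, E) ψ.symm (chartMul K a (ψ 1))) := by
    rw [hm]
    exact ((hs.contMDiffAt (hopen.mem_nhds ha)).mdifferentiableAt (by simp)).hasMFDerivAt
  have d2 : HasMFDerivAt 𝓘(ℝ, E) 𝓘(ℝ, E) (chartMul K a) (ψ 1)
      (fderiv ℝ (chartMul (E := E) K a) (ψ 1)) := by
    rw [hasMFDerivAt_iff_hasFDerivAt]
    have hd : ContDiffAt ℝ ∞ (fun q : E × E => chartMul K q.1 q.2) (a, ψ 1) :=
      contDiffAt_chartMul ha he' (by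
        rw [← hψ, he, mul_one]; simpa [hψ] using! hsrc)
    have := (hd.differentiableAt (by simp)).comp (ψ 1)
      ((differentiableAt_const a).prodMk differentiableAt_id)
    exact this.hasFDerivAt
  have d3 := d1.comp (ψ 1) d2
  have d4 : HasMFDerivAt 𝓘(ℝ, E) 𝓘(ℝ, E) (fun b => ψ.symm a * b) (ψ.symm (ψ 1))
      (mfderiv 𝓘(ℝ, E) 𝓘(ℝ, E) (fun b => ψ.symm a * b) (ψ.symm (ψ 1))) :=
    (mdifferentiableAt_mul_left (E := E) _ _).hasMFDerivAt
  have d5 := d4.comp (ψ 1) (hasMFDerivAt_chart_symm_one (E := E) (K := K))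
  have heq : (fun b => ψ.symm a * ψ.symm b) =ᶠ[𝓝 (ψ 1)] fun b => ψ.symm (chartMul K a b) := by
    have hc : ContinuousAt (fun b => ψ.symm a * ψ.symm b) (ψ 1) :=
      continuousAt_const.mul (continuousAt_extChartAt_symm (I := 𝓘(ℝ, E)) (1 : K))
    have : ψ.source ∈ 𝓝 (ψ.symm a * ψ.symm (ψ 1)) := by
      rw [he, mul_one]
      exact (isOpen_extChartAt_source (I := 𝓘(ℝ, E)) (1 : K)).mem_nhds hsrc
    filter_upwards [hc.preimage_mem_nhds this] with b hb
    exact (ψ.left_inv hb).symm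
  have h := hasMFDerivAt_unique d5 (d3.congr_of_eventuallyEq heq)
  have h' := DFunLike.congr_fun h x
  rw [he, hm] at h'
  exact h'.symm

lemma contDiffAt_chartField (x : E) :
    ContDiffAt ℝ ∞ (fun q : E × E => chartField K q.1 q.2)
      (extChartAt 𝓘(ℝ, E) (1 : K) 1, x) := by
  have he' := mem_extChartAt_target (I := 𝓘(ℝ, E)) (1 : K)
  have hd := contDiffAt_chartMul (E := E) (K := K) he' he' (by
    rw [extChartAt_to_inv, mul_one]; exact mem_chart_source E 1)
  have h1 : ContDiffAt ℝ ∞ (fun a : E => fderiv ℝ (chartMul K a) (extChartAt 𝓘(ℝ, E) (1 : K) 1))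
      (extChartAt 𝓘(ℝ, E) (1 : K) 1) :=
    ContDiffAt.fderiv (f := chartMul K) (g := fun _ => extChartAt 𝓘(ℝ, E) (1 : K) 1)
      hd contDiffAt_const (by simp)
  exact (h1.comp (_, x) contDiffAt_fst).clm_apply contDiffAt_snd

end Exponential

/-! ### One-parameter groups and smoothness of the exponential function. -/

section OneParam

open Set Filter Topology

variable {E : Type*} [NormedAddCommGroup E] [InnerProductSpace ℝ E]
  {K : Type*} [TopologicalSpace K] [ChartedSpace E K] [Group K]

lemma leftField_one (x : E) : leftField E x (1 : K) = x := by
  have h : (fun b : K => (1 : K) * b) = id := by ext; simp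
  have h2 : HasMFDerivAt 𝓘(ℝ, E) 𝓘(ℝ, E) (fun b : K => (1 : K) * b) 1
      (ContinuousLinearMap.id ℝ E) := h ▸ hasMFDerivAt_id (1 : K)
  exact DFunLike.congr_fun h2.mfderiv x

lemma smulRight_leftField_one (x : E) :
    (1 : ℝ →L[ℝ] ℝ).smulRight (leftField E x (1 : K)) =
      (ContinuousLinearMap.toSpanSingleton ℝ x : ℝ →L[ℝ] E) := by
  rw [leftField_one]
  exact ContinuousLinearMap.ext_ring rfl

lemma IsOneParam.map_zero {x : E} {γ : ℝ → K} (h : IsOneParam E x γ) : γ 0 = 1 := by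
  have := h.1 0 0
  simpa using this

variable [LieGroup 𝓘(ℝ, E) ∞ K]

/-- The curves `t ↦ γ(t + s)` and `t ↦ γ(s) γ(t)` are integral curves of the same left invariant
field and agree at `0`. -/
lemma isOneParam_of_isMIntegralCurve [CompleteSpace E] {x : E} {γ : ℝ → K} (h0 : γ 0 = 1)
    (h : IsMIntegralCurve γ (leftField (K := K) E x)) : IsOneParam E x γ := by
  have := t2Space_of_smooth E K
  have : IsManifold 𝓘(ℝ, E) 1 K := IsManifold.of_le (n := ∞) (by exact_mod_cast le_top)
  refine ⟨fun s t => ?_, ?_⟩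
  · have h1 : IsMIntegralCurve (fun t => γ (t + s)) (leftField (K := K) E x) := h.comp_add s
    have h2 : IsMIntegralCurve (fun t => γ s * γ t) (leftField (K := K) E x) :=
      fun t => hasMFDerivAt_mul_left_curve (γ s) (h t)
    have := isMIntegralCurve_Ioo_eq_of_contMDiff_boundaryless (t₀ := 0) (contMDiff_leftField x)
      h1 h2 (by simp [h0])
    rw [add_comm]
    exact congrFun this t
  · have := h 0
    rw [h0, smulRight_leftField_one] at this
    exact this

lemma IsOneParam.isMIntegralCurve {x : E} {γ : ℝ → K} (h : IsOneParam E x γ) :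
    IsMIntegralCurve γ (leftField (K := K) E x) := by
  intro t
  have h1 : HasMFDerivAt 𝓘(ℝ, ℝ) 𝓘(ℝ, E) γ (t - t)
      ((1 : ℝ →L[ℝ] ℝ).smulRight (leftField E x (γ (t - t)))) := by
    rw [sub_self, h.map_zero, smulRight_leftField_one]
    exact h.2
  have h2 : HasMFDerivAt 𝓘(ℝ, ℝ) 𝓘(ℝ, ℝ) (fun s : ℝ => s - t) t (ContinuousLinearMap.id ℝ ℝ) :=
    ((hasFDerivAt_id t).sub_const t).hasMFDerivAt
  have h3 := HasMFDerivAt.comp (f := fun s : ℝ => s - t) t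
    (hasMFDerivAt_mul_left_curve (γ t) h1) h2
  have h4 : (fun s => γ t * γ s) ∘ (fun s => s - t) = γ := by
    ext s
    simp [← h.1]
  rw [h4, sub_self, h.map_zero, mul_one] at h3
  exact h3

lemma IsOneParam.unique [CompleteSpace E] {x : E} {γ γ' : ℝ → K} (h : IsOneParam E x γ)
    (h' : IsOneParam E x γ') : γ = γ' := by
  have := t2Space_of_smooth E K
  have : IsManifold 𝓘(ℝ, E) 1 K := IsManifold.of_le (n := ∞) (by exact_mod_cast le_top)
  exact isMIntegralCurve_Ioo_eq_of_contMDiff_boundaryless (t₀ := 0) (contMDiff_leftField x)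
    h.isMIntegralCurve h'.isMIntegralCurve (by rw [h.map_zero, h'.map_zero])

variable (K) in
-- Left translates of one local integral curve through `1` give integral curves through every point
-- on the same time interval, and a uniform existence time implies completeness.
lemma exists_isOneParam [CompleteSpace E] (x : E) : ∃ γ : ℝ → K, IsOneParam E x γ := by
  have := t2Space_of_smooth E K
  have : IsManifold 𝓘(ℝ, E) 1 K := IsManifold.of_le (n := ∞) (by exact_mod_cast le_top)
  obtain ⟨γ, h0, hγ⟩ := exists_isMIntegralCurveAt_of_contMDiffAt_boundaryless (t₀ := 0)
    (contMDiff_leftField (E := E) x).contMDiffAt (x₀ := (1 : K))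
  obtain ⟨ε, hε, h⟩ := isMIntegralCurveAt_iff'.1 hγ
  rw [Real.ball_eq_Ioo, zero_sub, zero_add] at h
  obtain ⟨γ', h0', h'⟩ := exists_isMIntegralCurve_of_isMIntegralCurveOn
    (contMDiff_leftField (E := E) x) hε (fun g => ⟨fun t => g * γ t, by simp [h0], fun t ht =>
      (hasMFDerivAt_mul_left_curve g ((h t ht).hasMFDerivAt (Ioo_mem_nhds ht.1 ht.2))
        ).hasMFDerivWithinAt⟩) (1 : K)
  exact ⟨γ', isOneParam_of_isMIntegralCurve h0' h'⟩

lemma IsOneParam.comp_mul {x : E} {γ : ℝ → K} (h : IsOneParam E x γ) (a : ℝ) :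
    IsOneParam E (a • x) (fun t => γ (t * a)) := by
  refine ⟨fun s t => by simp only [add_mul, h.1], ?_⟩
  have h1 : HasMFDerivAt 𝓘(ℝ, ℝ) 𝓘(ℝ, E) γ (0 * a)
      (ContinuousLinearMap.toSpanSingleton ℝ x) := by rw [zero_mul]; exact h.2
  have h2 : HasMFDerivAt 𝓘(ℝ, ℝ) 𝓘(ℝ, ℝ) (fun s : ℝ => s * a) 0
      (ContinuousLinearMap.toSpanSingleton ℝ a) :=
    (by simpa using (hasDerivAt_id (0 : ℝ)).mul_const a :
      HasDerivAt (fun s : ℝ => s * a) a 0).hasFDerivAt.hasMFDerivAt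
  have h3 := h1.comp 0 h2
  have h4 : (ContinuousLinearMap.toSpanSingleton ℝ x).comp
      (ContinuousLinearMap.toSpanSingleton ℝ a) = ContinuousLinearMap.toSpanSingleton ℝ (a • x) := by
    ext; simp
  exact h3.congr_mfderiv h4

variable [CompleteSpace E]

lemma IsOneParam.groupExp_eq {x : E} {γ : ℝ → K} (h : IsOneParam E x γ) : groupExp E K x = γ 1 := by
  have hex : ∃ γ : ℝ → K, IsOneParam E x γ := ⟨γ, h⟩
  rw [groupExp, dif_pos hex, hex.choose_spec.unique h]

lemma IsOneParam.groupExp_smul {x : E} {γ : ℝ → K} (h : IsOneParam E x γ) (t : ℝ) :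
    groupExp E K (t • x) = γ t := by
  rw [(h.comp_mul t).groupExp_eq, one_mul]

lemma isOneParam_groupExp (x : E) : IsOneParam E x (fun t : ℝ => groupExp E K (t • x)) := by
  obtain ⟨γ, h⟩ := exists_isOneParam K x
  have : (fun t : ℝ => groupExp E K (t • x)) = γ := funext fun t => h.groupExp_smul t
  rwa [this]

lemma groupExp_zero : groupExp E K 0 = 1 := by
  have := (isOneParam_groupExp (K := K) (0 : E)).map_zero
  simpa using this

lemma groupExp_add_smul (s t : ℝ) (x : E) :
    groupExp E K ((s + t) • x) = groupExp E K (s • x) * groupExp E K (t • x) :=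
  (isOneParam_groupExp x).1 s t

lemma groupExp_neg (x : E) : groupExp E K (-x) = (groupExp E K x)⁻¹ := by
  have := groupExp_add_smul (K := K) (-1) 1 x
  rw [neg_add_cancel, zero_smul, groupExp_zero, neg_one_smul, one_smul] at this
  exact eq_inv_of_mul_eq_one_left this.symm

lemma groupExp_nsmul (n : ℕ) (x : E) : groupExp E K ((n : ℝ) • x) = groupExp E K x ^ n := by
  induction n with
  | zero => simp [groupExp_zero]
  | succ n ih => rw [Nat.cast_succ, groupExp_add_smul, ih, one_smul, pow_succ]

/-- The local flow of the left invariant vector fields, starting at `1`, is the exponential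
function. -/
lemma contMDiffAt_groupExp_zero (n : ℕ) :
    ContMDiffAt 𝓘(ℝ, E) 𝓘(ℝ, E) n (groupExp E K) 0 := by
  have := t2Space_of_smooth E K
  have : IsManifold 𝓘(ℝ, E) 1 K := IsManifold.of_le (n := ∞) (by exact_mod_cast le_top)
  set ψ := extChartAt 𝓘(ℝ, E) (1 : K) with hψ
  have he : ψ.symm (ψ 1) = 1 := extChartAt_to_inv (I := 𝓘(ℝ, E)) (1 : K)
  have hopen := isOpen_extChartAt_target (I := 𝓘(ℝ, E)) (1 : K)
  have hs := contMDiffOn_extChartAt_symm (I := 𝓘(ℝ, E)) (n := ∞) (1 : K)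
  have htar : ψ.target ∈ 𝓝 (ψ 1) := extChartAt_target_mem_nhds (I := 𝓘(ℝ, E)) (1 : K)
  -- The direction `x` is carried along as a constant component. Regularity in the initial condition
  -- then includes regularity in `x`.
  let Z : E × E → E × E := fun q => (chartField K q.1 q.2, 0)
  have hZ : ContDiffAt ℝ ∞ Z (ψ 1, 0) := (contDiffAt_chartField 0).prodMk contDiffAt_const
  obtain ⟨ε, hε, r, hr, u, hu, hun⟩ := exists_contDiffOn_flow n hZ (S := Prod.fst ⁻¹' ψ.target)
    (continuousAt_fst.preimage_mem_nhds htar)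
  have hmem : ∀ x ∈ Metric.ball (0 : E) r, (ψ 1, x) ∈ Metric.ball (ψ 1, (0 : E)) r := by
    intro x hx
    simpa [Prod.dist_eq, hr] using hx
  have hconst : ∀ x ∈ Metric.ball (0 : E) r, ∀ t ∈ Icc (-ε) ε, (u (ψ 1, x) t).2 = x := by
    intro x hx t ht
    have h0 : (0 : ℝ) ∈ Icc (-ε) ε := ⟨by linarith, hε.le⟩
    have hd : ∀ t ∈ Icc (-ε) ε,
        HasDerivWithinAt (fun t => (u (ψ 1, x) t).2) 0 (Icc (-ε) ε) t := fun t ht =>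
      ((hu _ (hmem x hx)).2 t ht).1.snd
    have h2 := (convex_Icc (-ε) ε).norm_image_sub_le_of_norm_hasDerivWithin_le (C := 0)
      hd (by simp) h0 ht
    have h3 : (u (ψ 1, x) 0).2 = x := by rw [(hu _ (hmem x hx)).1]
    simpa [sub_eq_zero, h3] using h2
  have hexp : ∀ x ∈ Metric.ball (0 : E) r, ∀ t ∈ Ioo (-ε) ε,
      groupExp E K (t • x) = ψ.symm (u (ψ 1, x) t).1 := by
    intro x hx t ht
    have h0 : (0 : ℝ) ∈ Ioo (-ε) ε := ⟨by linarith, hε⟩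
    refine isMIntegralCurveOn_Ioo_eqOn_of_contMDiff_boundaryless h0 (contMDiff_leftField x)
      ((isOneParam_groupExp (K := K) x).isMIntegralCurve.isMIntegralCurveOn _)
      (γ' := fun t => ψ.symm (u (ψ 1, x) t).1) ?_ ?_ ht
    · intro s hs'
      have hsI := Ioo_subset_Icc_self hs'
      obtain ⟨hd, hS⟩ := (hu _ (hmem x hx)).2 s hsI
      have hd0 : HasDerivWithinAt (fun t => (u (ψ 1, x) t).1)
          (chartField K (u (ψ 1, x) s).1 (u (ψ 1, x) s).2) (Icc (-ε) ε) s := hd.fst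
      have hd1 := hd0.hasDerivAt (Icc_mem_nhds hs'.1 hs'.2)
      rw [hconst x hx s hsI] at hd1
      have hd2 := ((hs.contMDiffAt (hopen.mem_nhds hS)).mdifferentiableAt
        (by simp)).hasMFDerivAt.comp s hd1.hasFDerivAt.hasMFDerivAt
      refine HasMFDerivAt.hasMFDerivWithinAt ?_
      rw [← leftField_chart hS]
      refine HasMFDerivAt.congr_mfderiv hd2 ?_
      refine ContinuousLinearMap.ext_ring ?_
      exact (congrArg _ (one_smul ℝ _)).trans (one_smul ℝ _).symm
    · simp only [zero_smul, groupExp_zero, (hu _ (hmem x hx)).1, he]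
  have hε2 : ε / 2 ∈ Icc 0 ε := ⟨by linarith, by linarith⟩
  -- The flow is available only for times up to `ε` and directions of norm less than `r`. The value
  -- `exp y` is read off at time `ε / 2` with direction `(2 / ε) • y`.
  have hsm : ContMDiffAt 𝓘(ℝ, E) 𝓘(ℝ, E) n
      (fun y : E => ψ.symm (u (ψ 1, (2 / ε) • y) (ε / 2)).1) 0 := by
    have hball : Metric.ball (ψ 1, (0 : E)) r ∈ 𝓝 (ψ 1, (2 / ε) • (0 : E)) := by
      rw [smul_zero]; exact Metric.ball_mem_nhds _ hr
    have h1 : ContDiffAt ℝ n (fun y : E => (u (ψ 1, (2 / ε) • y) (ε / 2)).1) 0 :=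
      contDiffAt_fst.comp _ (((hun _ hε2).contDiffAt hball).comp (0 : E)
        (contDiffAt_const.prodMk (contDiffAt_const.smul contDiffAt_id)))
    have hS : (u (ψ 1, (2 / ε) • (0 : E)) (ε / 2)).1 ∈ ψ.target :=
      ((hu _ (mem_of_mem_nhds hball)).2 _ ⟨by linarith, by linarith⟩).2
    exact ContMDiffAt.comp (g := ψ.symm) (f := fun y : E => (u (ψ 1, (2 / ε) • y) (ε / 2)).1) 0
      ((hs.contMDiffAt (hopen.mem_nhds hS)).of_le (n := ∞) (m := n) (by exact_mod_cast le_top))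
      h1.contMDiffAt
  refine hsm.congr_of_eventuallyEq ?_
  have : Metric.ball (0 : E) (r * (ε / 2)) ∈ 𝓝 (0 : E) := Metric.ball_mem_nhds _ (by positivity)
  filter_upwards [this] with y hy
  have hy' : (2 / ε) • y ∈ Metric.ball (0 : E) r := by
    rw [mem_ball_zero_iff] at hy ⊢
    rw [norm_smul, Real.norm_of_nonneg (by positivity)]
    calc 2 / ε * ‖y‖ < 2 / ε * (r * (ε / 2)) := by gcongr
      _ = r := by field_simp
  rw [← hexp _ hy' (ε / 2) ⟨by linarith, by linarith⟩, smul_smul]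
  congr 1
  rw [show ε / 2 * (2 / ε) = 1 by field_simp, one_smul]

variable (E K) in
/-- The exponential function of `K` is smooth. -/
theorem contMDiff_groupExp : ContMDiff 𝓘(ℝ, E) 𝓘(ℝ, E) ∞ (groupExp E K) := by
  rw [contMDiff_infty]
  intro n x₀
  have h0 : ContMDiffAt 𝓘(ℝ, E) 𝓘(ℝ, E) (n + 1 : ℕ) (groupExp E K) 0 :=
    contMDiffAt_groupExp_zero (n + 1)
  have : IsManifold 𝓘(ℝ, E) (n : ℕ) K := IsManifold.of_le (n := ∞) (by exact_mod_cast le_top)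
  have : LieGroup 𝓘(ℝ, E) (n : ℕ) K := LieGroup.of_le (n := ∞) (by exact_mod_cast le_top)
  obtain ⟨U, hU, hexpU⟩ := (contMDiffAt_iff_contMDiffOn_nhds (n := (n : ℕ)) (by simp)).1
    (contMDiffAt_groupExp_zero (E := E) (K := K) n)
  -- Since `exp y = exp(y / (m + 1)) ^ (m + 1)`, regularity near `0` spreads to all of `E`: for
  -- large `m` the point `x₀ / (m + 1)` lies in the neighbourhood of `0` already treated.
  have hlim : Tendsto (fun m : ℕ => ((m : ℝ) + 1)⁻¹ • x₀) atTop (𝓝 0) := by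
    have : Tendsto (fun m : ℕ => ((m : ℝ) + 1)⁻¹) atTop (𝓝 0) := by
      simpa using tendsto_one_div_add_atTop_nhds_zero_nat (𝕜 := ℝ)
    simpa using this.smul_const x₀
  obtain ⟨m, hm⟩ := (hlim.eventually (eventually_mem_nhds_iff.2 hU)).exists
  have h1 : ContMDiffAt 𝓘(ℝ, E) 𝓘(ℝ, E) n (fun y : E => groupExp E K (((m : ℝ) + 1)⁻¹ • y)) x₀ :=
    (hexpU.contMDiffAt hm).comp x₀
      (contDiff_const.smul contDiff_id : ContDiff ℝ n fun y : E => ((m : ℝ) + 1)⁻¹ • y).contMDiff.contMDiffAt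
  have h2 : ∀ k : ℕ, ContMDiffAt 𝓘(ℝ, E) 𝓘(ℝ, E) n
      (fun y : E => groupExp E K (((m : ℝ) + 1)⁻¹ • y) ^ k) x₀ := by
    intro k
    induction k with
    | zero => simpa using contMDiffAt_const
    | succ k ih => simp only [pow_succ]; exact ih.mul h1
  convert h2 (m + 1) using 1
  ext y
  rw [← groupExp_nsmul, smul_smul, Nat.cast_succ, mul_inv_cancel₀ (by positivity), one_smul]

end OneParam

/-! ### The local logarithm, the adjoint action and the bracket. -/

section Logarithm

open Set Filter Topology

variable {E : Type*} [NormedAddCommGroup E] [InnerProductSpace ℝ E] [CompleteSpace E]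
  {K : Type*} [TopologicalSpace K] [ChartedSpace E K] [Group K] [LieGroup 𝓘(ℝ, E) ∞ K]

lemma hasMFDerivAt_groupExp_zero :
    HasMFDerivAt 𝓘(ℝ, E) 𝓘(ℝ, E) (groupExp E K) 0 (ContinuousLinearMap.id ℝ E) := by
  have h := ((contMDiff_groupExp E K).mdifferentiableAt (x := 0) (by simp)).hasMFDerivAt
  set T : E →L[ℝ] E := mfderiv 𝓘(ℝ, E) 𝓘(ℝ, E) (groupExp E K) 0 with hT
  suffices key : ∀ x : E, T x = x from h.congr_mfderiv (ContinuousLinearMap.ext key)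
  intro x
  have h0 : HasMFDerivAt 𝓘(ℝ, E) 𝓘(ℝ, E) (groupExp E K) ((0 : ℝ) • x) T := by
    rw [zero_smul]; exact h
  have h1 : HasMFDerivAt 𝓘(ℝ, ℝ) 𝓘(ℝ, E) (fun t : ℝ => t • x) 0
      (ContinuousLinearMap.toSpanSingleton ℝ x) :=
    (by simpa using (hasDerivAt_id (0 : ℝ)).smul_const x :
      HasDerivAt (fun t : ℝ => t • x) x 0).hasFDerivAt.hasMFDerivAt
  have h2 := HasMFDerivAt.comp (f := fun t : ℝ => t • x) 0 h0 h1
  have h3 := DFunLike.congr_fun (hasMFDerivAt_unique h2 (isOneParam_groupExp (K := K) x).2) (1 : ℝ)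
  refine Eq.trans ?_ (h3.trans (one_smul ℝ x))
  exact (congrArg T (one_smul ℝ x)).symm

/-- `lg` is a smooth inverse on the open set `W` of the exponential function on the ball of
radius `r`. -/
structure IsLocalLog (r : ℝ) (W : Set K) (lg : K → E) : Prop where
  pos : 0 < r
  isOpen : IsOpen W
  exp_mem : ∀ x ∈ Metric.ball (0 : E) r, groupExp E K x ∈ W
  log_exp : ∀ x ∈ Metric.ball (0 : E) r, lg (groupExp E K x) = x
  log_mem : ∀ k ∈ W, lg k ∈ Metric.ball (0 : E) r
  exp_log : ∀ k ∈ W, groupExp E K (lg k) = k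
  smooth : ContMDiffOn 𝓘(ℝ, E) 𝓘(ℝ, E) ∞ lg W

variable (E K) in
theorem exists_isLocalLog : ∃ (r : ℝ) (W : Set K) (lg : K → E), IsLocalLog r W lg := by
  set ψ := extChartAt 𝓘(ℝ, E) (1 : K) with hψ
  have hsrc : IsOpen ψ.source := isOpen_extChartAt_source (I := 𝓘(ℝ, E)) (1 : K)
  have hexp := contMDiff_groupExp E K
  have h1src : (1 : K) ∈ ψ.source := mem_extChartAt_source (I := 𝓘(ℝ, E)) (1 : K)
  let η : E → E := fun x => ψ (groupExp E K x)
  have hη : ∀ x, groupExp E K x ∈ ψ.source → ContDiffAt ℝ ∞ η x := by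
    intro x hx
    rw [← contMDiffAt_iff_contDiffAt]
    exact (contMDiffAt_extChartAt' (by simpa [hψ] using! hx)).comp x (hexp x)
  have hd0 : HasFDerivAt η ((ContinuousLinearEquiv.refl ℝ E : E ≃L[ℝ] E) : E →L[ℝ] E) 0 := by
    have h2 := (hasMFDerivAt_groupExp_zero (E := E) (K := K)).2
    simp only [writtenInExtChartAt, groupExp_zero] at h2
    have h3 := h2.hasFDerivAt (by simp)
    exact h3
  have hη0 : ContDiffAt ℝ ∞ η 0 := hη 0 (by rw [groupExp_zero]; exact h1src)
  let Φ := hη0.toOpenPartialHomeomorph η hd0 (by simp)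
  have hΦ : ∀ x, Φ x = η x := fun x => rfl
  have h0 : (0 : E) ∈ Φ.source := hη0.mem_toOpenPartialHomeomorph_source hd0 (by simp)
  -- Invertibility of the derivative is needed on the whole ball and not only at `0`, since the
  -- logarithm has to be smooth at every point of `W`.
  have hinv : ∀ᶠ x in 𝓝 (0 : E), fderiv ℝ η x ∈ range ((↑) : (E ≃L[ℝ] E) → E →L[ℝ] E) := by
    have hc : ContinuousAt (fderiv ℝ η) 0 := (hη0.fderiv_right (m := 0) (by simp)).continuousAt
    refine hc.preimage_mem_nhds ?_
    rw [hd0.fderiv]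
    exact ContinuousLinearEquiv.nhds _
  have hs : ∀ᶠ x in 𝓝 (0 : E), groupExp E K x ∈ ψ.source :=
    hexp.continuous.continuousAt.preimage_mem_nhds (by
      rw [groupExp_zero]; exact hsrc.mem_nhds h1src)
  obtain ⟨r, hr, hrs⟩ := Metric.mem_nhds_iff.1
    (inter_mem (Φ.open_source.mem_nhds h0) (hinv.and hs))
  have hT : IsOpen (Φ '' Metric.ball 0 r) := Φ.isOpen_image_of_subset_source Metric.isOpen_ball
    fun x hx => (hrs hx).1
  have hψc : ContinuousOn ψ ψ.source := continuousOn_extChartAt (I := 𝓘(ℝ, E)) (1 : K)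
  have key : ∀ k ∈ ψ.source ∩ ψ ⁻¹' (Φ '' Metric.ball 0 r),
      Φ.symm (ψ k) ∈ Metric.ball (0 : E) r ∧ groupExp E K (Φ.symm (ψ k)) = k := by
    rintro k ⟨hk, x, hx, hxk⟩
    have h1 : Φ.symm (ψ k) = x := by rw [← hxk]; exact Φ.left_inv (hrs hx).1
    rw [h1]
    exact ⟨hx, ψ.injOn (hrs hx).2.2 hk hxk⟩
  refine ⟨r, ψ.source ∩ ψ ⁻¹' (Φ '' Metric.ball 0 r), fun k => Φ.symm (ψ k), hr,
    hψc.isOpen_inter_preimage hsrc hT, fun x hx => ⟨(hrs hx).2.2, x, hx, rfl⟩,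
    fun x hx => Φ.left_inv (hrs hx).1, fun k hk => (key k hk).1, fun k hk => (key k hk).2, ?_⟩
  intro k hk
  obtain ⟨hb, hk2⟩ := key k hk
  obtain ⟨e, he⟩ := (hrs hb).2.1
  have hsm : ContDiffAt ℝ ∞ Φ.symm (ψ k) := by
    refine Φ.contDiffAt_symm (f₀' := e) ?_ ?_ (hη _ (hrs hb).2.2)
    · obtain ⟨_, x, hx, hxk⟩ := hk
      rw [← hxk]
      exact Φ.map_source (hrs hx).1
    · rw [he]
      exact ((hη _ (hrs hb).2.2).differentiableAt (by simp)).hasFDerivAt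
  exact (hsm.contMDiffAt.comp k
    (contMDiffAt_extChartAt' (by simpa [hψ] using! hk.1))).contMDiffWithinAt

/-- The velocity at `0` recovers the direction of a one-parameter group. Identities between
derivatives of automorphisms are reduced in this way to identities in the group. -/
lemma groupExp_line_injective {x y : E} (h : ∀ t : ℝ, groupExp E K (t • x) = groupExp E K (t • y)) :
    x = y := by
  have h1 := (isOneParam_groupExp (K := K) x).2
  rw [funext h] at h1
  have h2 := DFunLike.congr_fun (hasMFDerivAt_unique h1 (isOneParam_groupExp (K := K) y).2) (1 : ℝ)
  exact (one_smul ℝ x).symm.trans (h2.trans (one_smul ℝ y))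

lemma groupExp_lieMap {φ : MulAut K}
    (hφ : ContMDiff 𝓘(ℝ, E) 𝓘(ℝ, E) ∞ (fun k : K => φ k)) (x : E) :
    groupExp E K (lieMap E φ x) = φ (groupExp E K x) := by
  have h : IsOneParam E (lieMap E φ x) (fun t : ℝ => φ (groupExp E K (t • x))) := by
    refine ⟨fun s t => by simp only [groupExp_add_smul, map_mul], ?_⟩
    have h1 : HasMFDerivAt 𝓘(ℝ, E) 𝓘(ℝ, E) (fun k : K => φ k) (groupExp E K ((0 : ℝ) • x))
        (lieMap E φ) := by
      rw [zero_smul, groupExp_zero]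
      exact (hφ.mdifferentiableAt (x := 1) (by simp)).hasMFDerivAt
    have h2 := HasMFDerivAt.comp (f := fun t : ℝ => groupExp E K (t • x)) 0 h1
      (isOneParam_groupExp (K := K) x).2
    refine h2.congr_mfderiv (ContinuousLinearMap.ext_ring ?_)
    exact (congrArg (lieMap E φ) (one_smul ℝ x)).trans (one_smul ℝ (lieMap E φ x)).symm
  simpa using h.groupExp_eq

lemma lieMap_mul {φ ψ : MulAut K}
    (hφ : ContMDiff 𝓘(ℝ, E) 𝓘(ℝ, E) ∞ (fun k : K => φ k))
    (hψ : ContMDiff 𝓘(ℝ, E) 𝓘(ℝ, E) ∞ (fun k : K => ψ k)) (x : E) :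
    lieMap E (φ * ψ) x = lieMap E φ (lieMap E ψ x) := by
  refine groupExp_line_injective (K := K) fun t => ?_
  have h : ContMDiff 𝓘(ℝ, E) 𝓘(ℝ, E) ∞ (fun k : K => (φ * ψ) k) := hφ.comp hψ
  rw [← map_smul, ← map_smul, ← map_smul, groupExp_lieMap hφ, groupExp_lieMap hψ,
    groupExp_lieMap h]
  rfl

lemma lieMap_one (x : E) : lieMap E (1 : MulAut K) x = x := by
  refine groupExp_line_injective (K := K) fun t => ?_
  rw [← map_smul, groupExp_lieMap contMDiff_id]
  rfl

lemma contMDiff_conj (k : K) : ContMDiff 𝓘(ℝ, E) 𝓘(ℝ, E) ∞ (fun g : K => MulAut.conj k g) := by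
  simp only [MulAut.conj_apply]
  exact (contMDiff_const.mul contMDiff_id).mul contMDiff_const

variable (E) in
/-- The adjoint action of `K` on its Lie algebra. -/
def adjoint (k : K) : E →L[ℝ] E := lieMap E (MulAut.conj k)

lemma groupExp_adjoint (k : K) (x : E) :
    groupExp E K (adjoint E k x) = k * groupExp E K x * k⁻¹ := by
  rw [adjoint, groupExp_lieMap (contMDiff_conj k), MulAut.conj_apply]

lemma adjoint_one (x : E) : adjoint E (1 : K) x = x := by
  rw [adjoint, map_one, lieMap_one]

lemma one_add_one_le_smooth : (1 + 1 : WithTop ℕ∞) ≤ ∞ := by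
  rw [one_add_one_eq_two]
  exact (WithTop.coe_le_coe.2 le_top : ((2 : ℕ∞) : WithTop ℕ∞) ≤ ∞)

lemma mlieBracket_eq_lieBracket (V W : (x : E) → TangentSpace 𝓘(ℝ, E) x) (x : E) :
    VectorField.mlieBracket 𝓘(ℝ, E) V W x = VectorField.lieBracket (E := E) ℝ V W x := by
  rw [← VectorField.mlieBracketWithin_univ, VectorField.mlieBracketWithin_eq_lieBracketWithin]
  exact congrFun (VectorField.lieBracketWithin_univ (𝕜 := ℝ) (E := E)) x

/-- The product of `K` in exponential coordinates. -/
lemma contDiffAt_log_mul {r : ℝ} {W : Set K} {lg : K → E} (h : IsLocalLog r W lg) {q : E × E}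
    (hq : groupExp E K q.1 * groupExp E K q.2 ∈ W) :
    ContDiffAt ℝ ∞ (fun q : E × E => lg (groupExp E K q.1 * groupExp E K q.2)) q := by
  rw [← contMDiffAt_iff_contDiffAt]
  have h1 : ContMDiffAt 𝓘(ℝ, E × E) 𝓘(ℝ, E) ∞
      (fun q : E × E => groupExp E K q.1 * groupExp E K q.2) q :=
    ((contMDiff_groupExp E K).contMDiffAt.comp q contDiffAt_fst.contMDiffAt).mul
      ((contMDiff_groupExp E K).contMDiffAt.comp q contDiffAt_snd.contMDiffAt)
  exact (h.smooth.contMDiffAt (h.isOpen.mem_nhds hq)).comp q h1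

/-- In exponential coordinates, left translation by `exp a` is the local product with first variable
`a`. The derivative of `exp` at `0` is the identity, so the left invariant field is the partial
derivative in the second variable. -/
lemma mpullback_groupExp_leftField {r : ℝ} {W : Set K} {lg : K → E} (h : IsLocalLog r W lg)
    {a : E} (ha : a ∈ Metric.ball (0 : E) r) (y : E) :
    VectorField.mpullback 𝓘(ℝ, E) 𝓘(ℝ, E) (groupExp E K) (leftField (K := K) E y) a =
      fderiv ℝ (fun q : E × E => lg (groupExp E K q.1 * groupExp E K q.2)) (a, 0) (0, y) := by
  have hW := h.exp_mem a ha
  have hlog : HasMFDerivAt 𝓘(ℝ, E) 𝓘(ℝ, E) lg (groupExp E K a)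
      (mfderiv 𝓘(ℝ, E) 𝓘(ℝ, E) lg (groupExp E K a)) :=
    ((h.smooth.contMDiffAt (h.isOpen.mem_nhds hW)).mdifferentiableAt (by simp)).hasMFDerivAt
  have hexp : ∀ b, HasMFDerivAt 𝓘(ℝ, E) 𝓘(ℝ, E) (groupExp E K) b
      (mfderiv 𝓘(ℝ, E) 𝓘(ℝ, E) (groupExp E K) b) := fun b =>
    ((contMDiff_groupExp E K).mdifferentiableAt (by simp)).hasMFDerivAt
  have h1 : (mfderiv 𝓘(ℝ, E) 𝓘(ℝ, E) lg (groupExp E K a)).comp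
      (mfderiv 𝓘(ℝ, E) 𝓘(ℝ, E) (groupExp E K) a) = ContinuousLinearMap.id ℝ E := by
    refine hasMFDerivAt_unique (hlog.comp a (hexp a))
      ((hasMFDerivAt_id a).congr_of_eventuallyEq ?_)
    filter_upwards [Metric.isOpen_ball.mem_nhds ha] with b hb using h.log_exp b hb
  have h2 : (mfderiv 𝓘(ℝ, E) 𝓘(ℝ, E) (groupExp E K) a).comp
      (mfderiv 𝓘(ℝ, E) 𝓘(ℝ, E) lg (groupExp E K a)) = ContinuousLinearMap.id ℝ E := by
    have h3 : HasMFDerivAt 𝓘(ℝ, E) 𝓘(ℝ, E) (groupExp E K) (lg (groupExp E K a))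
        (mfderiv 𝓘(ℝ, E) 𝓘(ℝ, E) (groupExp E K) a) := by
      rw [h.log_exp a ha]; exact hexp a
    refine hasMFDerivAt_unique (h3.comp _ hlog)
      ((hasMFDerivAt_id (groupExp E K a)).congr_of_eventuallyEq ?_)
    filter_upwards [h.isOpen.mem_nhds hW] with k hk using h.exp_log k hk
  rw [VectorField.mpullback_apply, ContinuousLinearMap.inverse_eq h2 h1]
  have h4 : HasMFDerivAt 𝓘(ℝ, E) 𝓘(ℝ, E) (fun b : E => groupExp E K a * groupExp E K b) 0
      (mfderiv 𝓘(ℝ, E) 𝓘(ℝ, E) (fun b : K => groupExp E K a * b) 1) := by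
    have h5 : HasMFDerivAt 𝓘(ℝ, E) 𝓘(ℝ, E) (fun b : K => groupExp E K a * b) (groupExp E K 0)
        (mfderiv 𝓘(ℝ, E) 𝓘(ℝ, E) (fun b : K => groupExp E K a * b) 1) := by
      rw [groupExp_zero]
      exact (mdifferentiableAt_mul_left _ _).hasMFDerivAt
    exact h5.comp 0 hasMFDerivAt_groupExp_zero
  have h6 : HasMFDerivAt 𝓘(ℝ, E) 𝓘(ℝ, E) lg (groupExp E K a * groupExp E K 0)
      (mfderiv 𝓘(ℝ, E) 𝓘(ℝ, E) lg (groupExp E K a)) := by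
    rw [groupExp_zero, mul_one]; exact hlog
  have h7 := h6.comp (0 : E) h4
  have h8 : HasFDerivAt (fun q : E × E => lg (groupExp E K q.1 * groupExp E K q.2))
      (fderiv ℝ (fun q : E × E => lg (groupExp E K q.1 * groupExp E K q.2)) (a, 0)) (a, 0) :=
    ((contDiffAt_log_mul h (by simpa [groupExp_zero] using hW)).differentiableAt
      (by simp)).hasFDerivAt
  have h9 : HasFDerivAt (fun b : E => (a, b)) (ContinuousLinearMap.inr ℝ E E) 0 :=
    hasFDerivAt_prodMk_right a 0
  exact DFunLike.congr_fun (hasMFDerivAt_unique h7 (h8.comp (0 : E) h9).hasMFDerivAt) y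

/-- Pullback along `exp` commutes with brackets of vector fields. Near `0` the pulled back fields
are `a ↦ ∂₂G(a, 0) y`, with value `y` at `0`, so their bracket at `0` is the antisymmetrized mixed
second derivative of the local product `G`. -/
lemma bracket_eq_fderiv {r : ℝ} {W : Set K} {lg : K → E} (h : IsLocalLog r W lg) (x y : E) :
    bracket E K x y =
      fderiv ℝ (fderiv ℝ (fun q : E × E => lg (groupExp E K q.1 * groupExp E K q.2))) 0
        (x, 0) (0, y) -
      fderiv ℝ (fderiv ℝ (fun q : E × E => lg (groupExp E K q.1 * groupExp E K q.2))) 0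
        (y, 0) (0, x) := by
  have := lieGroup_of_smooth E K
  set G : E × E → E := fun q => lg (groupExp E K q.1 * groupExp E K q.2) with hG
  have h0 : (0 : E) ∈ Metric.ball (0 : E) r := Metric.mem_ball_self h.pos
  have hfield : ∀ y : E, VectorField.mpullback 𝓘(ℝ, E) 𝓘(ℝ, E) (groupExp E K)
      (leftField (K := K) E y) =ᶠ[𝓝 (0 : E)] fun a : E => fderiv ℝ G (a, 0) (0, y) := by
    intro y
    filter_upwards [Metric.isOpen_ball.mem_nhds h0] with a ha
    exact mpullback_groupExp_leftField h ha y
  have hval : ∀ y : E, fderiv ℝ G ((0 : E), (0 : E)) (0, y) = y := by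
    intro y
    rw [← mpullback_groupExp_leftField h h0 y, VectorField.mpullback_apply,
      hasMFDerivAt_groupExp_zero.mfderiv]
    have h2 : leftField E y (groupExp E K 0) = y := by
      rw [groupExp_zero]; exact leftField_one y
    have h3 : (ContinuousLinearMap.id ℝ E).inverse = ContinuousLinearMap.id ℝ E :=
      ContinuousLinearMap.inverse_id
    exact (DFunLike.congr_fun h3 _).trans h2
  have hd : DifferentiableAt ℝ (fderiv ℝ G) (0 : E × E) :=
    ((contDiffAt_log_mul h (q := 0) (by
      simpa [groupExp_zero] using h.exp_mem 0 h0)).fderiv_right (m := 1)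
        one_add_one_le_smooth).differentiableAt (by simp)
  have hderiv : ∀ x y : E, fderiv ℝ (fun a : E => fderiv ℝ G (a, 0) (0, y)) 0 x =
      fderiv ℝ (fderiv ℝ G) 0 (x, 0) (0, y) := by
    intro x y
    have h9 : HasFDerivAt (fun b : E => (b, (0 : E))) (ContinuousLinearMap.inl ℝ E E) 0 :=
      hasFDerivAt_prodMk_left 0 0
    have h10 : HasFDerivAt (fun a : E => fderiv ℝ G (a, 0))
        ((fderiv ℝ (fderiv ℝ G) 0).comp (ContinuousLinearMap.inl ℝ E E)) 0 :=
      HasFDerivAt.comp (g := fderiv ℝ G) (f := fun b : E => (b, (0 : E))) (0 : E) hd.hasFDerivAt h9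
    have h11 := (h10.clm_apply (hasFDerivAt_const ((0 : E), y) (0 : E))).fderiv
    refine (DFunLike.congr_fun h11 x).trans ?_
    simp
  have h1 : bracket E K x y =
      VectorField.mpullback 𝓘(ℝ, E) 𝓘(ℝ, E) (groupExp E K)
        (VectorField.mlieBracket 𝓘(ℝ, E) (leftField (K := K) E x) (leftField (K := K) E y)) 0 := by
    rw [VectorField.mpullback_apply, hasMFDerivAt_groupExp_zero.mfderiv]
    have h3 : (ContinuousLinearMap.id ℝ E).inverse = ContinuousLinearMap.id ℝ E :=
      ContinuousLinearMap.inverse_id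
    refine Eq.trans ?_ (DFunLike.congr_fun h3 _).symm
    have h4 : ∀ k : K, k = 1 → bracket E K x y =
      VectorField.mlieBracket 𝓘(ℝ, E) (leftField (K := K) E x) (leftField (K := K) E y) k := by
      rintro k rfl
      rfl
    exact h4 _ groupExp_zero
  have hmd : ∀ x : E, MDifferentiableAt 𝓘(ℝ, E) 𝓘(ℝ, E).tangent
      (fun g : K => (⟨g, leftField E x g⟩ : TangentBundle 𝓘(ℝ, E) K)) (groupExp E K 0) := fun x =>
    (contMDiff_leftField x).mdifferentiable (by simp) _
  have : IsManifold 𝓘(ℝ, E) (minSmoothness ℝ 3) K := inferInstance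
  rw [h1, VectorField.mpullback_mlieBracket (n := minSmoothness ℝ 3) (hmd x) (hmd y)
    (((contMDiff_groupExp E K).contMDiffAt).of_le
      (by simpa using (WithTop.coe_le_coe.2 le_top : ((3 : ℕ∞) : WithTop ℕ∞) ≤ ∞)))
      (minSmoothness_monotone (by norm_cast)),
    Filter.EventuallyEq.mlieBracket_vectorField_eq (hfield x) (hfield y)]
  refine (mlieBracket_eq_lieBracket _ _ 0).trans ?_
  rw [VectorField.lieBracket, hval, hval, hderiv, hderiv]

/-- The derivative of the adjoint action is the adjoint representation. -/
theorem hasDerivAt_adjoint (x y : E) :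
    HasDerivAt (fun s : ℝ => adjoint E (groupExp E K (s • x)) y) (bracket E K x y) 0 := by
  obtain ⟨r, W, lg, h⟩ := exists_isLocalLog E K
  have h0 : (0 : E) ∈ Metric.ball (0 : E) r := Metric.mem_ball_self h.pos
  have hbr := bracket_eq_fderiv h x y
  set G : E × E → E := fun q => lg (groupExp E K q.1 * groupExp E K q.2) with hG
  have h0W : (1 : K) ∈ W := by simpa [groupExp_zero] using h.exp_mem 0 h0
  have hG0 : ContDiffAt ℝ ∞ G 0 := contDiffAt_log_mul h (q := 0) (by simpa [groupExp_zero] using h0W)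
  have hd : HasFDerivAt (fderiv ℝ G) (fderiv ℝ (fderiv ℝ G) 0) (0 : E × E) :=
    ((hG0.fderiv_right (m := 1) one_add_one_le_smooth).differentiableAt (by simp)).hasFDerivAt
  have hsymm : fderiv ℝ (fderiv ℝ G) 0 (y, 0) (0, x) = fderiv ℝ (fderiv ℝ G) 0 (0, x) (y, 0) :=
    (hG0.isSymmSndFDerivAt (by
      simpa using (WithTop.coe_le_coe.2 le_top : ((2 : ℕ∞) : WithTop ℕ∞) ≤ ∞))) _ _
  rw [hsymm] at hbr
  generalize fderiv ℝ (fderiv ℝ G) 0 = D at hd hbr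
  -- Differentiating `exp(sx) exp(b) = exp(Ad(exp(sx)) b) exp(sx)` in `b` at `0` gives `Q s
  -- (Ad(exp(sx)) y) = P s`. Since `Q 0 = 1`, the adjoint action is `Q⁻¹ P` near `0`, and its
  -- derivative follows without knowing beforehand that it is smooth in the group element.
  let Q : ℝ → E →L[ℝ] E := fun s => (fderiv ℝ G (0, s • x)).comp (ContinuousLinearMap.inl ℝ E E)
  let P : ℝ → E := fun s => fderiv ℝ G (s • x, 0) (0, y)
  have hx1 : HasDerivAt (fun s : ℝ => (s • x, (0 : E))) (x, 0) 0 := by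
    simpa using ((hasDerivAt_id (0 : ℝ)).smul_const x).prodMk (hasDerivAt_const (0 : ℝ) (0 : E))
  have hx2 : HasDerivAt (fun s : ℝ => ((0 : E), s • x)) (0, x) 0 := by
    simpa using (hasDerivAt_const (0 : ℝ) (0 : E)).prodMk ((hasDerivAt_id (0 : ℝ)).smul_const x)
  have hP : HasDerivAt P (D (x, 0) (0, y)) 0 := by
    have h1 : HasDerivAt (fun s : ℝ => fderiv ℝ G (s • x, 0)) (D (x, 0)) 0 := by
      have h0 := HasFDerivAt.comp_hasDerivAt_of_eq (E := (E × E →L[ℝ] E)) (x := (0 : ℝ))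
        (hl := hd) (hf := hx1) (by rw [zero_smul]; rfl)
      exact h0
    exact (h1.clm_apply (hasDerivAt_const (0 : ℝ) ((0 : E), y))).congr_deriv (by simp)
  have hQ : HasDerivAt Q ((D (0, x)).comp
      (ContinuousLinearMap.inl ℝ E E)) 0 := by
    have h1 : HasDerivAt (fun s : ℝ => fderiv ℝ G (0, s • x)) (D (0, x)) 0 := by
      have h0 := HasFDerivAt.comp_hasDerivAt_of_eq (E := (E × E →L[ℝ] E)) (x := (0 : ℝ))
        (hl := hd) (hf := hx2) (by rw [zero_smul]; rfl)
      exact h0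
    exact (h1.clm_comp (hasDerivAt_const (0 : ℝ) (ContinuousLinearMap.inl ℝ E E))).congr_deriv
      (by simp)
  have hQ0 : Q 0 = 1 := by
    ext v
    have h1 : G ∘ (fun a : E => (a, (0 : E))) =ᶠ[𝓝 (0 : E)] id := by
      filter_upwards [Metric.isOpen_ball.mem_nhds h0] with a ha
      simpa [hG, groupExp_zero] using h.log_exp a ha
    have h2 : HasFDerivAt (G ∘ (fun a : E => (a, (0 : E)))) (Q 0) 0 := by
      have h3 : HasFDerivAt G (fderiv ℝ G (0, (0 : ℝ) • x)) ((0 : E), (0 : E)) := by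
        rw [zero_smul]; exact (hG0.differentiableAt (by simp)).hasFDerivAt
      exact HasFDerivAt.comp (g := G) (f := fun a : E => (a, (0 : E))) (0 : E) h3
        (hasFDerivAt_prodMk_left (0 : E) (0 : E))
    have h4 := h2.unique ((hasFDerivAt_id (0 : E)).congr_of_eventuallyEq h1)
    rw [h4]; rfl
  have hxs : ∀ᶠ s : ℝ in 𝓝 0, s • x ∈ Metric.ball (0 : E) r := by
    have : Continuous fun s : ℝ => s • x := by fun_prop
    exact this.continuousAt.preimage_mem_nhds (by
      rw [zero_smul]; exact Metric.isOpen_ball.mem_nhds h0)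
  have hPQ : ∀ᶠ s in 𝓝 (0 : ℝ), Q s (adjoint E (groupExp E K (s • x)) y) = P s := by
    filter_upwards [hxs] with s hs
    set k := groupExp E K (s • x) with hk
    have h1 : (fun b : E => G (s • x, b)) = fun b => G (adjoint E k b, s • x) := by
      ext b
      simp only [hG]
      rw [groupExp_adjoint, ← hk]
      simp
    have hkW : k ∈ W := h.exp_mem _ hs
    have h2 : HasFDerivAt (fun b : E => G (s • x, b))
        ((fderiv ℝ G (s • x, 0)).comp (ContinuousLinearMap.inr ℝ E E)) 0 := by
      have h3 : HasFDerivAt G (fderiv ℝ G (s • x, 0)) (s • x, (0 : E)) :=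
        ((contDiffAt_log_mul h (by simpa [groupExp_zero] using hkW)).differentiableAt
          (by simp)).hasFDerivAt
      exact h3.comp (0 : E) (hasFDerivAt_prodMk_right _ 0)
    have h4 : HasFDerivAt (fun b : E => G (adjoint E k b, s • x))
        ((Q s).comp (adjoint E k)) 0 := by
      have h3 : HasFDerivAt G (fderiv ℝ G (0, s • x)) (adjoint E k 0, s • x) := by
        rw [map_zero]
        exact ((contDiffAt_log_mul h (by simpa [groupExp_zero] using hkW)).differentiableAt
          (by simp)).hasFDerivAt
      exact h3.comp (0 : E) ((hasFDerivAt_prodMk_left _ (s • x)).comp (0 : E)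
        (adjoint E k).hasFDerivAt)
    rw [h1] at h2
    exact DFunLike.congr_fun (h4.unique h2) y
  have hinv : HasDerivAt (fun s => Ring.inverse (Q s))
      (-((D (0, x)).comp (ContinuousLinearMap.inl ℝ E E))) 0 := by
    have h1 := hasFDerivAt_ringInverse (𝕜 := ℝ) (1 : (E →L[ℝ] E)ˣ)
    have h2 := HasFDerivAt.comp_hasDerivAt_of_eq (E := (E →L[ℝ] E)) (x := (0 : ℝ))
      (hl := h1) (hf := hQ) (by rw [hQ0]; rfl)
    refine h2.congr_deriv ?_
    ext v
    simp
  have hunit : ∀ᶠ s in 𝓝 (0 : ℝ), IsUnit (Q s) :=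
    hQ.continuousAt.preimage_mem_nhds (Units.isOpen.mem_nhds (by rw [hQ0]; exact isUnit_one))
  have hfin := hinv.clm_apply hP
  have heq : (fun s : ℝ => adjoint E (groupExp E K (s • x)) y) =ᶠ[𝓝 0]
      fun s => Ring.inverse (Q s) (P s) := by
    filter_upwards [hPQ, hunit] with s h1 h2
    rw [← h1, ← mul_apply_eq_comp, Ring.inverse_mul_cancel _ h2]
    rfl
  refine (hfin.congr_of_eventuallyEq heq).congr_deriv ?_
  have hP0 : P 0 = y := by
    have := hPQ.self_of_nhds
    rw [hQ0, zero_smul, groupExp_zero, adjoint_one] at this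
    exact this.symm
  rw [hP0, hQ0, Ring.inverse_one, hbr]
  simp
  abel

end Logarithm

/-! ### Semibounded one-parameter groups -/

section Semibounded

open Set Filter Topology MeasureTheory

variable {H : Type*} [NormedAddCommGroup H] [InnerProductSpace ℂ H]

lemma continuous_orbit_of_dense {U : ℝ → H ≃ₗᵢ[ℂ] H} {D : Set H} (hD : Dense D)
    (hc : ∀ v ∈ D, Continuous fun t => U t v) (w : H) : Continuous fun t => U t w := by
  have hcl : IsClosed {w : H | Continuous fun t => U t w} := by
    refine isClosed_of_closure_subset fun w hw => ?_
    refine Metric.continuous_iff.2 fun t ε hε => ?_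
    obtain ⟨v, hv, hvw⟩ := Metric.mem_closure_iff.1 hw (ε / 3) (by positivity)
    obtain ⟨δ, hδ, h⟩ := Metric.continuous_iff.1 hv t (ε / 3) (by positivity)
    refine ⟨δ, hδ, fun s hs => ?_⟩
    have h1 := h s hs
    have h2 : dist (U s w) (U s v) = dist w v := (U s).dist_map w v
    have h3 : dist (U t v) (U t w) = dist w v := by rw [(U t).dist_map, dist_comm]
    calc dist (U s w) (U t w) ≤ dist (U s w) (U s v) + dist (U s v) (U t v) +
          dist (U t v) (U t w) := dist_triangle4 _ _ _ _
      _ < ε := by rw [h2, h3]; linarith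
  exact (hcl.closure_subset_iff.2 hc) (hD w)

variable [CompleteSpace H]

/-- If the generator of a one-parameter group of unitary operators is semibounded on a dense
invariant subspace of its domain, then it is semibounded. -/
theorem semibounded_of_dense_invariant {U : ℝ → H ≃ₗᵢ[ℂ] H}
    (hU : ∀ s t v, U (s + t) v = U s (U t v)) {D : Submodule ℂ H} (hD : Dense (D : Set H))
    (hinv : ∀ t, ∀ v ∈ D, U t v ∈ D)
    (hdiff : ∀ v ∈ D, DifferentiableAt ℝ (fun t => U t v) 0) {c : ℝ}
    (hc : ∀ v ∈ D, c * ‖v‖ ^ 2 ≤ (inner ℂ v (-Complex.I • deriv (fun t => U t v) 0)).re)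
    {w w' : H} (hw : HasDerivAt (fun t => U t w) w' 0) :
    c * ‖w‖ ^ 2 ≤ (inner ℂ w (-Complex.I • w')).re := by
  have hU0 : ∀ v, U 0 v = v := fun v => (U 0).injective (by rw [← hU, add_zero])
  have hderiv : ∀ {v v' : H}, HasDerivAt (fun t => U t v) v' 0 →
      ∀ t, HasDerivAt (fun t => U t v) (U t v') t := by
    intro v v' h t
    have h1 : HasDerivAt (fun s => U (s - t) v) v' t := by
      have h0 : HasDerivAt (fun t => U t v) v' (t - t) := by rwa [sub_self]
      exact h0.comp_sub_const t t
    have h2 := ((U t).toContinuousLinearEquiv.toContinuousLinearMap.restrictScalars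
      ℝ).hasFDerivAt.comp_hasDerivAt t h1
    refine h2.congr_of_eventuallyEq (Eventually.of_forall fun s => ?_)
    change U s v = U t (U (s - t) v)
    rw [← hU, add_sub_cancel]
  have hcont : ∀ w, Continuous fun t => U t w := continuous_orbit_of_dense hD fun v hv =>
    continuous_iff_continuousAt.2 fun t => (hderiv (hdiff v hv).hasDerivAt t).continuousAt
  -- This is the graph of the generator restricted to `D`. The inequality is a closed condition on
  -- the graph, so it suffices that the closure `G` contains every pair `(w, w')` of the full
  -- generator; in other words, `D` is a core.
  let G₀ : Submodule ℂ (H × H) :=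
    { carrier := {q | q.1 ∈ D ∧ HasDerivAt (fun t => U t q.1) q.2 0}
      add_mem' := fun {a b} ha hb => ⟨D.add_mem ha.1 hb.1, by
        simp only [Prod.fst_add, Prod.snd_add, map_add]; exact ha.2.add hb.2⟩
      zero_mem' := ⟨D.zero_mem, by simpa using hasDerivAt_const (0 : ℝ) (0 : H)⟩
      smul_mem' := fun z a ha => ⟨D.smul_mem z ha.1, by
        simp only [Prod.smul_fst, Prod.smul_snd, map_smul]; exact ha.2.const_smul z⟩ }
  let G := G₀.topologicalClosure
  have hGc : IsClosed (G : Set (H × H)) := G₀.isClosed_topologicalClosure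
  have hGbd : ∀ q ∈ G, c * ‖q.1‖ ^ 2 ≤ (inner ℂ q.1 (-Complex.I • q.2)).re := by
    have hcl : IsClosed {q : H × H | c * ‖q.1‖ ^ 2 ≤ (inner ℂ q.1 (-Complex.I • q.2)).re} :=
      isClosed_le (by fun_prop) (Complex.continuous_re.comp (by fun_prop))
    refine fun q hq => hcl.closure_subset_iff.2 (fun q hq => ?_) hq
    have := hc q.1 hq.1
    rwa [hq.2.deriv] at this
  -- The continuous curve `(U t v, U t v')` runs in `G`, so its integral lies in the closed subspace
  -- `G`, even though the integral of `U t v` need not lie in `D`. The second component is evaluated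
  -- by the fundamental theorem of calculus, after which `v'` disappears and `v` may vary over all
  -- of `H` by density.
  have hGint : ∀ v ∈ D, ∀ ε : ℝ, ((∫ t in (0 : ℝ)..ε, U t v), U ε v - v) ∈ G := by
    intro v hv ε
    set v' := deriv (fun t => U t v) 0
    have hv' : HasDerivAt (fun t => U t v) v' 0 := (hdiff v hv).hasDerivAt
    have hmem : ∀ t, (U t v, U t v') ∈ G := fun t => G₀.le_topologicalClosure ⟨hinv t v hv, by
      have h0 : HasDerivAt (fun s => U s v) (U t v') (0 + t) := by
        rw [zero_add]; exact hderiv hv' t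
      have := h0.comp_add_const 0 t
      simpa [hU] using this⟩
    have : CompleteSpace G := hGc.completeSpace_coe
    let g : ℝ → G := fun t => ⟨(U t v, U t v'), hmem t⟩
    have hg : Continuous g := ((hcont v).prodMk (hcont v')).subtype_mk _
    have h1 : (G.subtypeL.restrictScalars ℝ) (∫ t in (0 : ℝ)..ε, g t) =
        ∫ t in (0 : ℝ)..ε, (U t v, U t v') :=
      ((G.subtypeL.restrictScalars ℝ).intervalIntegral_comp_comm
        (hg.intervalIntegrable 0 ε)).symm
    have hi : IntervalIntegrable (fun t => (U t v, U t v')) volume 0 ε :=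
      ((hcont v).prodMk (hcont v')).intervalIntegrable 0 ε
    have h2 := (ContinuousLinearMap.fst ℝ H H).intervalIntegral_comp_comm hi
    have h3 := (ContinuousLinearMap.snd ℝ H H).intervalIntegral_comp_comm hi
    have h4 : (∫ t in (0 : ℝ)..ε, U t v') = U ε v - v := by
      rw [intervalIntegral.integral_eq_sub_of_hasDerivAt (fun t _ => hderiv hv' t)
        ((hcont v').intervalIntegrable 0 ε), hU0]
    have h5 : (∫ t in (0 : ℝ)..ε, (U t v, U t v')) = ((∫ t in (0 : ℝ)..ε, U t v), U ε v - v) := by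
      refine Prod.ext ?_ ?_
      · exact h2.symm
      · exact h3.symm.trans h4
    rw [← h5, ← h1]
    exact (∫ t in (0 : ℝ)..ε, g t).2
  have hGall : ∀ v, ∀ ε : ℝ, ((∫ t in (0 : ℝ)..ε, U t v), U ε v - v) ∈ G := by
    intro v ε
    have hL : Continuous fun v : H => ∫ t in (0 : ℝ)..ε, U t v := by
      refine (LipschitzWith.of_dist_le_mul (K := ⟨|ε|, abs_nonneg ε⟩) fun a b => ?_).continuous
      rw [dist_eq_norm, ← intervalIntegral.integral_sub ((hcont a).intervalIntegrable 0 ε)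
        ((hcont b).intervalIntegrable 0 ε)]
      refine (intervalIntegral.norm_integral_le_of_norm_le_const (C := dist a b)
        fun t _ => ?_).trans (le_of_eq ?_)
      · rw [← dist_eq_norm, (U t).dist_map]
      · rw [sub_zero, mul_comm]; rfl
    have hcl : IsClosed {v : H | ((∫ t in (0 : ℝ)..ε, U t v), U ε v - v) ∈ G} :=
      hGc.preimage (hL.prodMk ((U ε).continuous.sub continuous_id))
    exact hcl.closure_subset_iff.2 (fun v hv => hGint v hv ε) (hD v)
  -- Averages of the orbit over `[0, ε]` regularize `w`; as `ε → 0` the averages and their images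
  -- under the generator converge to `w` and `w'`.
  have hlim : Tendsto (fun ε : ℝ => ε⁻¹ • ((∫ t in (0 : ℝ)..ε, U t w), U ε w - w))
      (𝓝[≠] 0) (𝓝 (w, w')) := by
    have h1 : HasDerivAt (fun ε : ℝ => ∫ t in (0 : ℝ)..ε, U t w) w 0 := by
      have := ((hcont w).integral_hasStrictDerivAt 0 0).hasDerivAt
      rwa [hU0] at this
    have h2 := hasDerivAt_iff_tendsto_slope_zero.1 h1
    have h3 := hasDerivAt_iff_tendsto_slope_zero.1 hw
    simp only [zero_add, intervalIntegral.integral_same, sub_zero, hU0] at h2 h3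
    exact h2.prodMk_nhds h3
  refine hGbd (w, w') (hGc.mem_of_tendsto hlim (Eventually.of_forall fun ε => ?_))
  have := G.smul_mem ((ε⁻¹ : ℝ) : ℂ) (hGall w ε)
  rwa [Complex.coe_smul] at this

end Semibounded

/-! ### The topology of the twisted loop algebra -/

section LoopTopology

open Set Filter Topology

variable {E : Type*} [NormedAddCommGroup E] [InnerProductSpace ℝ E]
  {K : Type*} [TopologicalSpace K] [ChartedSpace E K] [Group K] {φ : MulAut K}

lemma TwistedLoopAlgebra.contDiff (ξ : TwistedLoopAlgebra E φ) : ContDiff ℝ ∞ ξ.1 := ξ.2.1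

lemma contDiffAt_nat {f : ℝ → E} (hf : ContDiff ℝ ∞ f) (n : ℕ) (t : ℝ) : ContDiffAt ℝ n f t :=
  hf.contDiffAt.of_le (by exact_mod_cast le_top)

@[ext] lemma TwistedLoopAlgebra.ext {ξ η : TwistedLoopAlgebra E φ} (h : ∀ t, ξ.1 t = η.1 t) :
    ξ = η := Subtype.ext (funext h)

@[simp] lemma TwistedLoopAlgebra.coe_add (ξ η : TwistedLoopAlgebra E φ) :
    (ξ + η).1 = ξ.1 + η.1 := rfl
@[simp] lemma TwistedLoopAlgebra.coe_sub (ξ η : TwistedLoopAlgebra E φ) :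
    (ξ - η).1 = ξ.1 - η.1 := rfl
@[simp] lemma TwistedLoopAlgebra.coe_smul (c : ℝ) (ξ : TwistedLoopAlgebra E φ) :
    (c • ξ).1 = c • ξ.1 := rfl

variable (E φ) in
/-- The `n`-th derivative as a linear map. -/
def derivHom (n : ℕ) : TwistedLoopAlgebra E φ →ₗ[ℝ] C(ℝ, E) where
  toFun := TwistedLoopAlgebra.deriv E n
  map_add' ξ η := by
    ext t
    exact iteratedDeriv_fun_add (contDiffAt_nat ξ.contDiff n t) (contDiffAt_nat η.contDiff n t)
  map_smul' c ξ := by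
    ext t
    exact iteratedDeriv_const_smul (contDiffAt_nat ξ.contDiff n t) c

instance : IsTopologicalAddGroup (TwistedLoopAlgebra E φ) :=
  topologicalAddGroup_iInf fun n => topologicalAddGroup_induced (derivHom E φ n)

instance : ContinuousSMul ℝ (TwistedLoopAlgebra E φ) :=
  continuousSMul_iInf fun n => continuousSMul_induced (derivHom E φ n)

lemma tendsto_loop {ι : Type*} {l : Filter ι} {f : ι → TwistedLoopAlgebra E φ}
    {ξ : TwistedLoopAlgebra E φ}
    (h : ∀ n : ℕ, ∀ C : Set ℝ, IsCompact C → ∀ ε > 0, ∀ᶠ i in l, ∀ t ∈ C,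
      ‖iteratedDeriv n (f i).1 t - iteratedDeriv n ξ.1 t‖ < ε) :
    Tendsto f l (𝓝 ξ) := by
  rw [nhds_iInf, tendsto_iInf]
  intro n
  rw [nhds_induced, tendsto_comap_iff, ContinuousMap.tendsto_iff_tendstoLocallyUniformly,
    tendstoLocallyUniformly_iff_forall_isCompact]
  intro C hC
  rw [Metric.tendstoUniformlyOn_iff]
  intro ε hε
  filter_upwards [h n C hC ε hε] with i hi t ht
  rw [dist_comm, dist_eq_norm]
  exact hi t ht

/-- Translation of a twisted loop in the Lie algebra. -/
def shift (r : ℝ) (ξ : TwistedLoopAlgebra E φ) : TwistedLoopAlgebra E φ :=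
  ⟨fun t => ξ.1 (t + r), ξ.2.1.comp (contDiff_id.add contDiff_const), fun t => by
    rw [← ξ.2.2 (t + r)]
    exact congrArg ξ.1 (by ring)⟩

/-- The derivative of a twisted loop in the Lie algebra. -/
def dloop (ξ : TwistedLoopAlgebra E φ) : TwistedLoopAlgebra E φ :=
  ⟨deriv ξ.1, by
    have := ξ.2.1
    rw [show (∞ : WithTop ℕ∞) = ∞ + 1 from rfl, contDiff_succ_iff_deriv] at this
    exact this.2.2, fun t => by
    have h1 : HasDerivAt ξ.1 (deriv ξ.1 (t + 2 * Real.pi / orderOf φ))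
        (t + 2 * Real.pi / orderOf φ) :=
      (ξ.2.1.differentiable (by simp) _).hasDerivAt
    have h2 := h1.comp_add_const t _
    rw [funext ξ.2.2] at h2
    have h3 : HasDerivAt ξ.1 (deriv ξ.1 t) t := (ξ.2.1.differentiable (by simp) _).hasDerivAt
    exact h2.unique ((lieMap E φ⁻¹).hasFDerivAt.comp_hasDerivAt t h3)⟩

lemma iteratedDeriv_shift (n : ℕ) (r : ℝ) (ξ : TwistedLoopAlgebra E φ) (t : ℝ) :
    iteratedDeriv n (shift r ξ).1 t = iteratedDeriv n ξ.1 (t + r) := by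
  have := iteratedDeriv_comp_add_const n ξ.1 r
  exact congrFun this t

/-- For each `n` the mean value inequality bounds the error in the `n`-th derivative by the
oscillation of the next derivative over distances at most `|r|`. This oscillation is uniformly small
on compact sets. -/
lemma tendsto_shift_quotient (ξ : TwistedLoopAlgebra E φ) :
    Tendsto (fun r : ℝ => r⁻¹ • (shift r ξ - ξ)) (𝓝[≠] 0) (𝓝 (dloop ξ)) := by
  refine tendsto_loop fun n C hC ε hε => ?_
  have hc : Continuous (iteratedDeriv (n + 1) ξ.1) :=
    ξ.contDiff.continuous_iteratedDeriv _ (by exact_mod_cast le_top)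
  have hd : ∀ t, HasDerivAt (iteratedDeriv n ξ.1) (iteratedDeriv (n + 1) ξ.1 t) t := by
    intro t
    rw [iteratedDeriv_succ]
    exact ((ξ.contDiff.differentiable_iteratedDeriv n (by exact_mod_cast WithTop.coe_lt_top _)) t).hasDerivAt
  have h1 : ∀ᶠ s : ℝ in 𝓝 0, ∀ t ∈ C,
      ‖iteratedDeriv (n + 1) ξ.1 (t + s) - iteratedDeriv (n + 1) ξ.1 t‖ < ε / 2 := by
    refine hC.eventually_forall_of_forall_eventually fun t _ => ?_
    have hc2 : Continuous fun q : ℝ × ℝ =>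
        ‖iteratedDeriv (n + 1) ξ.1 (q.2 + q.1) - iteratedDeriv (n + 1) ξ.1 q.2‖ := by fun_prop
    exact hc2.continuousAt.eventually_lt continuousAt_const (by simpa using hε)
  obtain ⟨δ, hδ, hball⟩ := Metric.eventually_nhds_iff.1 h1
  filter_upwards [self_mem_nhdsWithin, mem_nhdsWithin_of_mem_nhds (Metric.ball_mem_nhds 0 hδ)]
    with r hr hrδ t ht
  have h2 := (convex_uIcc t (t + r)).norm_image_sub_le_of_norm_hasDerivWithin_le
    (f := fun s => iteratedDeriv n ξ.1 s - (s - t) • iteratedDeriv (n + 1) ξ.1 t)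
    (f' := fun s => iteratedDeriv (n + 1) ξ.1 s - (1 : ℝ) • iteratedDeriv (n + 1) ξ.1 t) (C := ε / 2)
    (x := t) (y := t + r)
    (fun s _ => ((hd s).sub (((hasDerivAt_id s).sub_const t).smul_const _)).hasDerivWithinAt)
    (fun s hs => by
      have hs' : |s - t| ≤ |r| := by
        have := Set.abs_sub_left_of_mem_uIcc hs
        simpa using this
      have := hball (y := s - t) (by
        rw [Real.dist_eq, sub_zero]
        exact hs'.trans_lt (by simpa using hrδ)) t ht
      rw [add_sub_cancel] at this
      rw [one_smul]
      exact this.le) left_mem_uIcc right_mem_uIcc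
  have h3 : iteratedDeriv n (r⁻¹ • (shift r ξ - ξ)).1 t =
      r⁻¹ • (iteratedDeriv n ξ.1 (t + r) - iteratedDeriv n ξ.1 t) := by
    have h4 := DFunLike.congr_fun ((derivHom E φ n).map_smul r⁻¹ (shift r ξ - ξ)) t
    have h5 := DFunLike.congr_fun ((derivHom E φ n).map_sub (shift r ξ) ξ) t
    have h6 := iteratedDeriv_shift n r ξ t
    change iteratedDeriv n (r⁻¹ • (shift r ξ - ξ)).1 t =
      r⁻¹ • iteratedDeriv n (shift r ξ - ξ).1 t at h4
    change iteratedDeriv n (shift r ξ - ξ).1 t =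
      iteratedDeriv n (shift r ξ).1 t - iteratedDeriv n ξ.1 t at h5
    rw [h4, h5, h6]
  have h7 : iteratedDeriv n (dloop ξ).1 t = iteratedDeriv (n + 1) ξ.1 t := by
    rw [iteratedDeriv_succ']; rfl
  have hr0 : r ≠ 0 := hr
  have h8 : r⁻¹ • (iteratedDeriv n ξ.1 (t + r) - iteratedDeriv n ξ.1 t) -
      iteratedDeriv (n + 1) ξ.1 t = r⁻¹ • (iteratedDeriv n ξ.1 (t + r) - (t + r - t) •
        iteratedDeriv (n + 1) ξ.1 t - (iteratedDeriv n ξ.1 t - (t - t) •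
        iteratedDeriv (n + 1) ξ.1 t)) := by
    rw [add_sub_cancel_left, sub_self, zero_smul, sub_zero, sub_right_comm, smul_sub r⁻¹ _ (r • _),
      inv_smul_smul₀ hr0]
  rw [h3, h7, h8, norm_smul, norm_inv]
  have hr1 : 0 < ‖r‖ := norm_pos_iff.2 hr0
  calc ‖r‖⁻¹ * _ ≤ ‖r‖⁻¹ * (ε / 2 * ‖t + r - t‖) := by gcongr
    _ = ε / 2 := by rw [add_sub_cancel_left]; field_simp
    _ < ε := by linarith

end LoopTopology

/-! ### The exponential function of the twisted loop group. -/

section LoopExp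

open Set Filter Topology

variable {E : Type*} [NormedAddCommGroup E] [InnerProductSpace ℝ E] [CompleteSpace E]
  {K : Type*} [TopologicalSpace K] [ChartedSpace E K] [Group K] [LieGroup 𝓘(ℝ, E) ∞ K]
  {φ : MulAut K}

lemma loopExp_mem (hφ : IsLieAut E φ) (ξ : TwistedLoopAlgebra E φ) :
    (fun t => groupExp E K (ξ.1 t)) ∈ twistedLoopGroup E φ :=
  ⟨(contMDiff_groupExp E K).comp ξ.2.1.contMDiff, fun t =>
    (congrArg (groupExp E K) (ξ.2.2 t)).trans (groupExp_lieMap hφ.smooth_inv _)⟩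

lemma loopExp_apply (hφ : IsLieAut E φ) (ξ : TwistedLoopAlgebra E φ) (t : ℝ) :
    (loopExp E φ ξ).1 t = groupExp E K (ξ.1 t) := by
  rw [loopExp, dif_pos (loopExp_mem hφ ξ)]

lemma loop_ext {f g : twistedLoopGroup E φ} (h : ∀ t, f.1 t = g.1 t) : f = g :=
  Subtype.ext (funext h)

lemma loopExp_zero (hφ : IsLieAut E φ) : loopExp E φ (0 : TwistedLoopAlgebra E φ) = 1 :=
  loop_ext fun t => by
    rw [loopExp_apply hφ]
    exact groupExp_zero

lemma loopExp_add_smul (hφ : IsLieAut E φ) (s t : ℝ) (ξ : TwistedLoopAlgebra E φ) :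
    loopExp E φ ((s + t) • ξ) = loopExp E φ (s • ξ) * loopExp E φ (t • ξ) :=
  loop_ext fun u => by
    rw [Subgroup.coe_mul, Pi.mul_apply, loopExp_apply hφ, loopExp_apply hφ, loopExp_apply hφ]
    exact groupExp_add_smul s t (ξ.1 u)

end LoopExp

/-! ### The first derivative of a smooth map in the sense of Bastiani -/

section Bastiani

open Set Filter Topology

variable {X F : Type*} [AddCommGroup X] [Module ℝ X] [TopologicalSpace X]
  [IsTopologicalAddGroup X] [ContinuousSMul ℝ X] [NormedAddCommGroup F] [NormedSpace ℝ F]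

/-- By joint continuity of the first derivative, the first order remainder is uniform in the base
point near `0` and the direction near `h`. This permits directions that vary with the parameter,
such as the difference quotients of a translated loop. -/
lemma BastianiSmoothOn.eventually_norm_sub_le {f : X → F} {U : Set X}
    (hU : IsOpen U) {D : (k : ℕ) → X → (Fin k → X) → F}
    (h0 : ∀ x ∈ U, ∀ h, D 0 x h = f x)
    (hc : ContinuousOn (fun p : X × (Fin 1 → X) => D 1 p.1 p.2) (U ×ˢ Set.univ))
    (hd : ∀ x ∈ U, ∀ (h : Fin 0 → X) (y : X),
      HasDerivAt (fun t : ℝ => D 0 (x + t • y) h) (D 1 x (Fin.cons y h)) 0)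
    (hz : 0 ∈ U) (h : X) {ε : ℝ} (hε : 0 < ε) :
    ∀ᶠ q : (X × X) × ℝ in (𝓝 0 ×ˢ 𝓝 h) ×ˢ 𝓝 0,
      ‖f (q.1.1 + q.2 • q.1.2) - f q.1.1 - q.2 • D 1 0 (fun _ => h)‖ ≤ ε * |q.2| := by
  have hcont : ContinuousAt (fun q : (X × X) × ℝ => (q.1.1 + q.2 • q.1.2, q.1.2)) ((0, h), 0) := by
    fun_prop
  have hc' : ContinuousAt (fun p : X × X => D 1 p.1 (fun _ => p.2)) (0, h) := by
    have h1 : ContinuousAt (fun p : X × (Fin 1 → X) => D 1 p.1 p.2) (0, fun _ => h) :=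
      hc.continuousAt ((hU.prod isOpen_univ).mem_nhds ⟨hz, mem_univ _⟩)
    have h2 : ContinuousAt (fun p : X × X => (p.1, (fun _ => p.2 : Fin 1 → X))) (0, h) := by
      fun_prop
    exact ContinuousAt.comp (f := fun p : X × X => (p.1, (fun _ => p.2 : Fin 1 → X))) h1 h2
  have hnear : ∀ᶠ p : X × X in 𝓝 (0, h), p.1 ∈ U ∧
      ‖D 1 p.1 (fun _ => p.2) - D 1 0 (fun _ => h)‖ < ε := by
    refine (continuousAt_fst.eventually (hU.mem_nhds hz)).and ?_
    have := Metric.tendsto_nhds.1 hc' ε hε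
    simpa only [dist_eq_norm] using this
  have hev : ∀ᶠ q : (X × X) × ℝ in 𝓝 ((0, h), 0), q.1.1 + q.2 • q.1.2 ∈ U ∧
      ‖D 1 (q.1.1 + q.2 • q.1.2) (fun _ => q.1.2) - D 1 0 (fun _ => h)‖ < ε := by
    refine hcont.eventually (p := fun p : X × X => p.1 ∈ U ∧
      ‖D 1 p.1 (fun _ => p.2) - D 1 0 (fun _ => h)‖ < ε) ?_
    simpa using hnear
  rw [nhds_prod_eq, nhds_prod_eq] at hev
  obtain ⟨P, hP, Q, hQ, hPQ⟩ := eventually_prod_iff.1 hev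
  obtain ⟨δ, hδ, hball⟩ := Metric.eventually_nhds_iff.1 hQ
  refine eventually_prod_iff.2 ⟨P, hP, fun r => |r| < δ, ?_, ?_⟩
  · exact Metric.eventually_nhds_iff.2 ⟨δ, hδ, fun r hr => by simpa using hr⟩
  rintro ⟨x, y⟩ hxy r hr
  have key : ∀ s, |s| < δ → x + s • y ∈ U ∧
      ‖D 1 (x + s • y) (fun _ => y) - D 1 0 (fun _ => h)‖ < ε := fun s hs =>
    hPQ hxy (hball (by simpa using hs))
  have hder : ∀ s, |s| < δ → HasDerivAt (fun s : ℝ => f (x + s • y)) (D 1 (x + s • y) fun _ => y) s := by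
    intro s hs
    have h1 := hd _ (key s hs).1 Fin.elim0 y
    have h2 : (Fin.cons y Fin.elim0 : Fin 1 → X) = fun _ => y := by
      ext i; rw [Fin.fin_one_eq_zero i]; rfl
    rw [h2] at h1
    have h3 : HasDerivAt (fun u : ℝ => D 0 (x + s • y + (u - s) • y) Fin.elim0)
        (D 1 (x + s • y) fun _ => y) s :=
      HasDerivAt.comp_sub_const (f := fun u : ℝ => D 0 (x + s • y + u • y) Fin.elim0) s s
        (by simpa using h1)
    refine h3.congr_of_eventuallyEq ?_
    have h4 : ∀ᶠ u : ℝ in 𝓝 s, |u| < δ :=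
      continuous_abs.continuousAt.eventually_lt continuousAt_const hs
    filter_upwards [h4] with u hu
    have h5 : x + s • y + (u - s) • y = x + u • y := by rw [sub_smul]; abel
    rw [h5, h0 _ (key u hu).1]
  have h2 := (convex_uIcc 0 r).norm_image_sub_le_of_norm_hasDerivWithin_le
    (f := fun s => f (x + s • y) - s • D 1 0 (fun _ => h))
    (f' := fun s => (D 1 (x + s • y) fun _ => y) - (1 : ℝ) • D 1 0 (fun _ => h)) (C := ε)
    (x := 0) (y := r)
    (fun s hs => ((hder s (by
      have := Set.abs_sub_left_of_mem_uIcc hs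
      simp only [sub_zero] at this
      exact this.trans_lt hr)).sub ((hasDerivAt_id s).smul_const _)).hasDerivWithinAt)
    (fun s hs => by
      have := Set.abs_sub_left_of_mem_uIcc hs
      simp only [sub_zero] at this
      rw [one_smul]
      exact (key s (this.trans_lt hr)).2.le) left_mem_uIcc right_mem_uIcc
  simp only [zero_smul, add_zero, sub_zero, Real.norm_eq_abs] at h2
  rwa [sub_right_comm] at h2

/-- Additivity comes from splitting an increment along `h + k` into one along `h` from `0` and one
along `k` from the moving base point `r • h`. Together with continuity it gives real linearity. -/
lemma BastianiSmoothOn.exists_derivative {f : X → F} {U : Set X} (hf : BastianiSmoothOn f U)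
    (hz : 0 ∈ U) : ∃ A : X →L[ℝ] F, ∀ (q : ℝ → X) (h : X), Tendsto q (𝓝[≠] 0) (𝓝 h) →
      HasDerivAt (fun r : ℝ => f (r • q r)) (A h) 0 := by
  obtain ⟨hU, D, h0, hc, hd⟩ := hf
  have key := fun (h : X) {ε : ℝ} (hε : 0 < ε) =>
    BastianiSmoothOn.eventually_norm_sub_le (f := f) hU h0 (hc 1) (hd 0) hz h hε
  have key2 : ∀ (x q : ℝ → X) (h : X), Tendsto x (𝓝[≠] 0) (𝓝 0) → Tendsto q (𝓝[≠] 0) (𝓝 h) →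
      Tendsto (fun r : ℝ => r⁻¹ • (f (x r + r • q r) - f (x r))) (𝓝[≠] 0)
        (𝓝 (D 1 0 (fun _ => h))) := by
    intro x q h hx hq
    rw [Metric.tendsto_nhds]
    intro ε hε
    have h1 : Tendsto (fun r : ℝ => ((x r, q r), r)) (𝓝[≠] 0) ((𝓝 0 ×ˢ 𝓝 h) ×ˢ 𝓝 0) :=
      (hx.prodMk hq).prodMk (tendsto_id.mono_right nhdsWithin_le_nhds)
    filter_upwards [h1.eventually (key h (half_pos hε)), self_mem_nhdsWithin] with r hr hr0
    have hr0' : r ≠ 0 := hr0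
    have h2 : 0 < |r| := abs_pos.2 hr0'
    have h3 : r⁻¹ • (f (x r + r • q r) - f (x r)) - D 1 0 (fun _ => h) =
        r⁻¹ • (f (x r + r • q r) - f (x r) - r • D 1 0 (fun _ => h)) := by
      rw [smul_sub r⁻¹ _ (r • _), inv_smul_smul₀ hr0']
    rw [dist_eq_norm, h3, norm_smul, norm_inv, Real.norm_eq_abs]
    calc |r|⁻¹ * _ ≤ |r|⁻¹ * (ε / 2 * |r|) := by gcongr
      _ = ε / 2 := by field_simp
      _ < ε := by linarith
  have hzero : Tendsto (fun _ : ℝ => (0 : X)) (𝓝[≠] (0 : ℝ)) (𝓝 0) := tendsto_const_nhds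
  have hder : ∀ (q : ℝ → X) (h : X), Tendsto q (𝓝[≠] 0) (𝓝 h) →
      HasDerivAt (fun r : ℝ => f (r • q r)) (D 1 0 fun _ => h) 0 := by
    intro q h hq
    rw [hasDerivAt_iff_tendsto_slope_zero]
    simpa using key2 _ q h hzero hq
  have hadd : ∀ h k : X, (D 1 0 fun _ => h + k) = (D 1 0 fun _ => h) + D 1 0 fun _ => k := by
    intro h k
    have h1 := key2 _ (fun _ => h) h hzero tendsto_const_nhds
    have hx : Tendsto (fun r : ℝ => r • h) (𝓝[≠] 0) (𝓝 0) := by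
      have : Continuous fun r : ℝ => r • h := by fun_prop
      have h2 := this.tendsto 0
      rw [zero_smul] at h2
      exact h2.mono_left nhdsWithin_le_nhds
    have h2 := key2 _ (fun _ => k) k hx tendsto_const_nhds
    have h3 := key2 _ (fun _ => h + k) (h + k) hzero tendsto_const_nhds
    refine tendsto_nhds_unique h3 ((h1.add h2).congr fun r => ?_)
    rw [← smul_add]
    simp only [zero_add]
    rw [smul_add r h k, add_comm, sub_add_sub_cancel]
  have hcA : Continuous fun h : X => D 1 0 fun _ => h := by
    rw [continuous_iff_continuousAt]
    intro h
    have h1 : ContinuousAt (fun p : X × (Fin 1 → X) => D 1 p.1 p.2) (0, fun _ => h) :=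
      (hc 1).continuousAt ((hU.prod isOpen_univ).mem_nhds ⟨hz, mem_univ _⟩)
    have h2 : ContinuousAt (fun h : X => ((0 : X), (fun _ => h : Fin 1 → X))) h := by
      fun_prop
    exact ContinuousAt.comp (f := fun h : X => ((0 : X), (fun _ => h : Fin 1 → X))) h1 h2
  exact ⟨(AddMonoidHom.mk' (fun h : X => D 1 0 fun _ => h) hadd).toRealLinearMap hcA, hder⟩

lemma BastianiSmoothOn.inter_add {f g : X → F} {U V : Set X} (hf : BastianiSmoothOn f U)
    (hg : BastianiSmoothOn g V) : BastianiSmoothOn (fun x => f x + g x) (U ∩ V) := by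
  obtain ⟨hU, D, h0, hc, hd⟩ := hf
  obtain ⟨hV, D', h0', hc', hd'⟩ := hg
  refine ⟨hU.inter hV, fun k x h => D k x h + D' k x h, fun x hx h => ?_, fun k => ?_, ?_⟩
  · simp only [h0 x hx.1 h, h0' x hx.2 h]
  · exact ((hc k).mono (prod_mono_left inter_subset_left)).add
      ((hc' k).mono (prod_mono_left inter_subset_right))
  · exact fun k x hx h y => (hd k x hx.1 h y).add (hd' k x hx.2 h y)

lemma BastianiSmoothOn.clm_apply {G : Type*} [NormedAddCommGroup G] [NormedSpace ℝ G]
    {f : X → F} {U : Set X} (hf : BastianiSmoothOn f U) (T : F →L[ℝ] G) :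
    BastianiSmoothOn (fun x => T (f x)) U := by
  obtain ⟨hU, D, h0, hc, hd⟩ := hf
  refine ⟨hU, fun k x h => T (D k x h), fun x hx h => ?_, fun k => ?_, ?_⟩
  · simp only [h0 x hx h]
  · exact T.continuous.comp_continuousOn (hc k)
  · exact fun k x hx h y => T.hasFDerivAt.comp_hasDerivAt 0 (hd k x hx h y)

end Bastiani

/-! ### The derived representation -/

section Representation

open Set Filter Topology

variable {E : Type*} [NormedAddCommGroup E] [InnerProductSpace ℝ E] [CompleteSpace E]
  {K : Type*} [TopologicalSpace K] [ChartedSpace E K] [Group K] [LieGroup 𝓘(ℝ, E) ∞ K]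
  {φ : MulAut K} {H : Type*} [NormedAddCommGroup H] [InnerProductSpace ℂ H]
  (π : LoopSemidirect E φ →* (H ≃ₗᵢ[ℂ] H))

/-- The complex subspace of smooth vectors. -/
def smoothSubmodule : Submodule ℂ H where
  carrier := smoothVectors E φ π
  add_mem' := by
    intro v w hv hw g
    obtain ⟨U, hU, hfU⟩ := hv g
    obtain ⟨V, hV, hfV⟩ := hw g
    refine ⟨U ∩ V, ⟨hU, hV⟩, ?_⟩
    simpa only [map_add] using hfU.inter_add hfV
  zero_mem' := fun g => ⟨univ, mem_univ _, isOpen_univ, fun _ _ _ => 0, by simp,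
    fun _ => continuousOn_const, fun _ _ _ _ _ => hasDerivAt_const _ _⟩
  smul_mem' := by
    intro c v hv g
    obtain ⟨U, hU, hfU⟩ := hv g
    refine ⟨U, hU, ?_⟩
    simp only [map_smul]
    exact hfU.clm_apply ((c • ContinuousLinearMap.id ℂ H).restrictScalars ℝ)

/-- Right multiplication by `(1, r)` does not touch the loop component, so it carries the chart at
`g` to the chart at `g (1, r)`. -/
lemma mem_smoothSubmodule_inr {v : H} (hv : v ∈ smoothSubmodule π) (r : Multiplicative ℝ) :
    π (SemidirectProduct.inr r) v ∈ smoothSubmodule π := by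
  intro g
  obtain ⟨U, hU, hfU⟩ := hv (g * SemidirectProduct.inr r)
  refine ⟨U, hU, ?_⟩
  have : ∀ p, chartInv E φ (g * SemidirectProduct.inr r) p =
      chartInv E φ g p * SemidirectProduct.inr r := fun p => by
    refine SemidirectProduct.ext ?_ ?_
    · simp [chartInv]
    · simp [chartInv, mul_right_comm]
  simpa only [this, map_mul, LinearIsometryEquiv.coe_mul, Function.comp_apply] using hfU

lemma exists_dRep {v : H} (hv : v ∈ smoothSubmodule π) :
    ∃ A : TwistedLoopAlgebra E φ × ℝ →L[ℝ] H,
      ∀ (q : ℝ → TwistedLoopAlgebra E φ × ℝ) h, Tendsto q (𝓝[≠] 0) (𝓝 h) →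
        HasDerivAt (fun r : ℝ => π (chartInv E φ 1 (r • q r)) v) (A h) 0 := by
  obtain ⟨U, hU, hfU⟩ := hv 1
  exact hfU.exists_derivative hU

/-- The derived representation, applied to a smooth vector. -/
def dRep (v : smoothSubmodule π) : TwistedLoopAlgebra E φ × ℝ →L[ℝ] H :=
  (exists_dRep π v.2).choose

lemma dRep_spec (v : smoothSubmodule π) {q : ℝ → TwistedLoopAlgebra E φ × ℝ} {h}
    (hq : Tendsto q (𝓝[≠] 0) (𝓝 h)) :
    HasDerivAt (fun r : ℝ => π (chartInv E φ 1 (r • q r)) v.1) (dRep π v h) 0 :=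
  (exists_dRep π v.2).choose_spec q h hq

lemma dRep_const (v : smoothSubmodule π) (h : TwistedLoopAlgebra E φ × ℝ) :
    HasDerivAt (fun r : ℝ => π (chartInv E φ 1 (r • h)) v.1) (dRep π v h) 0 :=
  dRep_spec π v tendsto_const_nhds

lemma dRep_add (v w : smoothSubmodule π) (h : TwistedLoopAlgebra E φ × ℝ) :
    dRep π (v + w) h = dRep π v h + dRep π w h := by
  refine (dRep_const π (v + w) h).unique ?_
  simp only [Submodule.coe_add, map_add]
  exact (dRep_const π v h).add (dRep_const π w h)

lemma dRep_smul (c : ℂ) (v : smoothSubmodule π) (h : TwistedLoopAlgebra E φ × ℝ) :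
    dRep π (c • v) h = c • dRep π v h := by
  refine (dRep_const π (c • v) h).unique ?_
  simp only [Submodule.coe_smul, map_smul]
  exact (dRep_const π v h).const_smul c

lemma chartInv_one (ζ : TwistedLoopAlgebra E φ) (r : ℝ) :
    chartInv E φ 1 (ζ, r) = SemidirectProduct.inl (loopExp E φ ζ) *
      SemidirectProduct.inr (Multiplicative.ofAdd r) := by
  refine SemidirectProduct.ext ?_ ?_ <;> simp [chartInv]

lemma inl_loopExp (ζ : TwistedLoopAlgebra E φ) :
    SemidirectProduct.inl (loopExp E φ ζ) = chartInv E φ 1 (ζ, 0) := by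
  refine SemidirectProduct.ext ?_ ?_ <;> simp [chartInv]

lemma chartInv_one_zero (hφ : IsLieAut E φ) : chartInv E φ (1 : LoopSemidirect E φ) 0 = 1 := by
  have := inl_loopExp (0 : TwistedLoopAlgebra E φ)
  rw [loopExp_zero hφ, map_one] at this
  exact this.symm

lemma re_inner_dRep (hφ : IsLieAut E φ) (v : smoothSubmodule π) (h : TwistedLoopAlgebra E φ × ℝ) :
    (inner ℂ v.1 (dRep π v h)).re = 0 := by
  have h1 := (dRep_const π v h).inner ℂ (dRep_const π v h)
  simp only [inner_self_eq_norm_sq_to_K, LinearIsometryEquiv.norm_map] at h1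
  have h2 := h1.unique (hasDerivAt_const (0 : ℝ) _)
  rw [zero_smul, chartInv_one_zero hφ, map_one, LinearIsometryEquiv.coe_one, id] at h2
  have h3 := congrArg Complex.re h2
  rw [← inner_conj_symm (dRep π v h), Complex.add_re, Complex.conj_re, Complex.zero_re] at h3
  linarith

/-- The kernel of the derived representation on the twisted loop algebra. -/
def dKer : Submodule ℝ (TwistedLoopAlgebra E φ) :=
  ⨅ v : smoothSubmodule π, LinearMap.ker
    ((dRep π v).comp (ContinuousLinearMap.inl ℝ (TwistedLoopAlgebra E φ) ℝ)).toLinearMap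

lemma mem_dKer {ζ : TwistedLoopAlgebra E φ} : ζ ∈ dKer π ↔ ∀ v, dRep π v (ζ, 0) = 0 := by
  simp [dKer, Submodule.mem_iInf]

lemma isClosed_dKer : IsClosed (dKer π : Set (TwistedLoopAlgebra E φ)) := by
  rw [dKer, Submodule.coe_iInf]
  exact isClosed_iInter fun v => ContinuousLinearMap.isClosed_ker _

/-- Along `r ↦ exp(rζ)` the orbit of a smooth vector has derivative `π(exp(tζ)) dπ(ζ)v = 0` at every
`t`, so it is constant. Density of smooth vectors does the rest. -/
lemma map_loopExp_eq_one (hφ : IsLieAut E φ) (hd : Dense (smoothVectors E φ π))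
    {ζ : TwistedLoopAlgebra E φ} (hζ : ζ ∈ dKer π) :
    π (SemidirectProduct.inl (loopExp E φ ζ)) = 1 := by
  have key : ∀ v : smoothSubmodule π, ∀ t : ℝ,
      HasDerivAt (fun r : ℝ => π (SemidirectProduct.inl (loopExp E φ (r • ζ))) v.1) 0 t := by
    intro v t
    have h1 := dRep_const π v (ζ, 0)
    rw [(mem_dKer π).1 hζ v] at h1
    have h2 := ((π (SemidirectProduct.inl (loopExp E φ (t • ζ)))).toContinuousLinearEquiv
      |>.toContinuousLinearMap.restrictScalars ℝ).hasFDerivAt.comp_hasDerivAt 0 h1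
    rw [map_zero] at h2
    rw [← sub_self t] at h2
    have h3 := HasDerivAt.comp_sub_const t t h2
    refine h3.congr_of_eventuallyEq (Eventually.of_forall fun r => ?_)
    have h4 : loopExp E φ (r • ζ) = loopExp E φ (t • ζ) * loopExp E φ ((r - t) • ζ) := by
      rw [← loopExp_add_smul hφ, add_sub_cancel]
    simp only [h4, map_mul, LinearIsometryEquiv.coe_mul, Function.comp_apply, inl_loopExp]
    simp
  have h2 : ∀ v ∈ smoothVectors E φ π, π (SemidirectProduct.inl (loopExp E φ ζ)) v = v := by
    intro v hv
    have := is_const_of_deriv_eq_zero (fun t => (key ⟨v, hv⟩ t).differentiableAt)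
      (fun t => (key ⟨v, hv⟩ t).deriv) 1 0
    simpa [loopExp_zero hφ] using this
  refine LinearIsometryEquiv.ext fun w => ?_
  exact congrFun (Continuous.ext_on hd (LinearIsometryEquiv.continuous _) continuous_id h2) w

lemma mem_dKer_of_map_loopExp {ζ : TwistedLoopAlgebra E φ}
    (h : ∀ t : ℝ, π (SemidirectProduct.inl (loopExp E φ (t • ζ))) = 1) : ζ ∈ dKer π := by
  rw [mem_dKer]
  intro v
  have h1 := dRep_const π v (ζ, 0)
  have h2 : ∀ r : ℝ, chartInv E φ 1 (r • (ζ, (0 : ℝ))) =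
      SemidirectProduct.inl (loopExp E φ (r • ζ)) := fun r => by
    rw [inl_loopExp, Prod.smul_mk, smul_zero]
  simp only [h2, h] at h1
  exact h1.unique (hasDerivAt_const _ _)

lemma inr_mul_inl (r : ℝ) (f : twistedLoopGroup E φ) :
    (SemidirectProduct.inr (Multiplicative.ofAdd r) * SemidirectProduct.inl f :
      LoopSemidirect E φ) = SemidirectProduct.inl (translate E φ r f) *
        SemidirectProduct.inr (Multiplicative.ofAdd r) := by
  refine SemidirectProduct.ext ?_ ?_
  · rw [SemidirectProduct.mul_left, SemidirectProduct.mul_left]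
    simp only [SemidirectProduct.left_inr, SemidirectProduct.left_inl, one_mul,
      SemidirectProduct.right_inr, SemidirectProduct.right_inl, map_one, mul_one]
    rfl
  · simp

/-- On a common line the exponentials commute, so translating `exp(sξ)` by `r` gives `exp(sξ)
exp(s(ξ(· + r) - ξ))`. Moving `π(1, r)` past `π(exp(sξ))` leaves the chart point `(s(ξ(· + r) - ξ),
r)`, whose direction tends to `(sξ', 1)`. This is the relation between `D` and `D + sξ'`, applied to
a vector that need not be known to be smooth. -/
lemma hasDerivAt_translate (hφ : IsLieAut E φ) {ξ : TwistedLoopAlgebra E φ}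
    (hξ : ∀ᶠ r : ℝ in 𝓝 0, ∀ t, ∃ (x : E) (a b : ℝ), ξ.1 t = a • x ∧ ξ.1 (t + r) = b • x)
    (v : smoothSubmodule π) (s : ℝ) :
    HasDerivAt (fun r : ℝ => π (SemidirectProduct.inr (Multiplicative.ofAdd r))
      (π (SemidirectProduct.inl (loopExp E φ (s • ξ))) v.1))
      (π (SemidirectProduct.inl (loopExp E φ (s • ξ))) (dRep π v (s • dloop ξ, 1))) 0 := by
  have hq : Tendsto (fun r : ℝ => (s • r⁻¹ • (shift r ξ - ξ), (1 : ℝ))) (𝓝[≠] 0)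
      (𝓝 (s • dloop ξ, 1)) :=
    ((tendsto_shift_quotient ξ).const_smul s).prodMk_nhds tendsto_const_nhds
  have h1 := ((π (SemidirectProduct.inl (loopExp E φ (s • ξ)))).toContinuousLinearEquiv
      |>.toContinuousLinearMap.restrictScalars ℝ).hasFDerivAt.comp_hasDerivAt 0 (dRep_spec π v hq)
  refine h1.congr_of_eventuallyEq ?_
  filter_upwards [hξ] with r hr
  have h2 : r • (s • r⁻¹ • (shift r ξ - ξ), (1 : ℝ)) = (s • (shift r ξ - ξ), r) := by
    rw [Prod.smul_mk, smul_eq_mul, mul_one, smul_comm r s]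
    rcases eq_or_ne r 0 with rfl | hr0
    · have : shift 0 ξ = ξ := TwistedLoopAlgebra.ext fun t => by simp [shift]
      rw [this, sub_self, smul_zero, smul_zero]
    · rw [smul_inv_smul₀ hr0]
  have h3 : translate E φ r (loopExp E φ (s • ξ)) =
      loopExp E φ (s • ξ) * loopExp E φ (s • (shift r ξ - ξ)) := by
    refine loop_ext fun t => ?_
    rw [Subgroup.coe_mul, Pi.mul_apply, loopExp_apply hφ, loopExp_apply hφ]
    change (loopExp E φ (s • ξ)).1 (t + r) = groupExp E K (s • ξ.1 t) *
      groupExp E K (s • (ξ.1 (t + r) - ξ.1 t))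
    rw [loopExp_apply hφ]
    change groupExp E K (s • ξ.1 (t + r)) = _
    obtain ⟨x, a, b, ha, hb⟩ := hr t
    rw [ha, hb, ← sub_smul, smul_smul, smul_smul, smul_smul, ← groupExp_add_smul]
    congr 2
    ring
  have h4 := congrArg (fun g => π g v.1) (inr_mul_inl r (loopExp E φ (s • ξ)))
  rw [h3, map_mul SemidirectProduct.inl, mul_assoc, ← chartInv_one, ← h2] at h4
  simp only [map_mul, LinearIsometryEquiv.coe_mul, Function.comp_apply] at h4
  exact h4

/-- Here the spectral condition enters. After the unitary `π(exp(sξ))` is cancelled, the bound reads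
`c ‖v‖² ≤ s m + const` for all real `s`, with `m` the imaginary part of `⟨v, dπ(ξ')v⟩`. Both signs
of `s` are allowed, so `m = 0`; the real part vanishes by unitarity. -/
lemma dloop_mem_dKer [CompleteSpace H] (hφ : IsLieAut E φ) (hd : Dense (smoothVectors E φ π))
    (hb : BoundedBelow E φ π) {ξ : TwistedLoopAlgebra E φ}
    (hξ : ∀ᶠ r : ℝ in 𝓝 0, ∀ t, ∃ (x : E) (a b : ℝ), ξ.1 t = a • x ∧ ξ.1 (t + r) = b • x) :
    dloop ξ ∈ dKer π := by
  obtain ⟨c, hc⟩ := hb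
  have hinr : ∀ v : smoothSubmodule π, HasDerivAt (fun t : ℝ =>
      π (SemidirectProduct.inr (Multiplicative.ofAdd t)) v.1) (dRep π v (0, 1)) 0 := by
    intro v
    refine (dRep_const π v (0, 1)).congr_of_eventuallyEq (Eventually.of_forall fun r => ?_)
    simp only [Prod.smul_mk, smul_zero, smul_eq_mul, mul_one]
    rw [chartInv_one, loopExp_zero hφ, map_one, one_mul]
  have hsemi : ∀ (v : smoothSubmodule π) (s : ℝ),
      c * ‖v.1‖ ^ 2 ≤ (inner ℂ v.1 (-Complex.I • dRep π v (s • dloop ξ, 1))).re := by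
    intro v s
    have := semibounded_of_dense_invariant
      (U := fun t => π (SemidirectProduct.inr (Multiplicative.ofAdd t)))
      (fun s t v => by simp [ofAdd_add]) (D := smoothSubmodule π) hd
      (fun t v hv => mem_smoothSubmodule_inr π hv _)
      (fun v hv => (hinr ⟨v, hv⟩).differentiableAt) (c := c) (fun v hv => hc v hv)
      (hasDerivAt_translate π hφ hξ v s)
    rwa [LinearIsometryEquiv.norm_map, ← map_smul, LinearIsometryEquiv.inner_map_map] at this
  have hzero : ∀ v : smoothSubmodule π, inner ℂ v.1 (dRep π v (dloop ξ, 0)) = 0 := by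
    intro v
    have h1 : ∀ s : ℝ, c * ‖v.1‖ ^ 2 ≤ s * (inner ℂ v.1 (dRep π v (dloop ξ, 0))).im +
        (inner ℂ v.1 (dRep π v (0, 1))).im := by
      intro s
      have h2 : ((s • dloop ξ, 1) : TwistedLoopAlgebra E φ × ℝ) =
          s • (dloop ξ, 0) + (0, 1) := by simp
      have h3 := hsemi v s
      rw [h2, map_add, map_smul, inner_smul_right, inner_add_right,
        ← Complex.coe_smul, inner_smul_right] at h3
      simpa using h3
    refine Complex.ext (re_inner_dRep π hφ v _) ?_
    by_contra hne
    set m := (inner ℂ v.1 (dRep π v (dloop ξ, 0))).im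
    -- This `s` makes the right side of the bound equal to `c * ‖v‖ ^ 2 - 1`.
    have h2 := h1 ((c * ‖v.1‖ ^ 2 - (inner ℂ v.1 (dRep π v (0, 1))).im - 1) / m)
    rw [div_mul_cancel₀ _ hne] at h2
    linarith
  rw [mem_dKer]
  intro v
  have horth : ∀ w ∈ smoothVectors E φ π, inner ℂ w (dRep π v (dloop ξ, 0)) = 0 := by
    intro w hw
    set w' : smoothSubmodule π := ⟨w, hw⟩
    have h1 := hzero (v + w')
    have h2 := hzero (v + Complex.I • w')
    rw [dRep_add, Submodule.coe_add, inner_add_left, inner_add_right, inner_add_right,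
      hzero v, hzero w'] at h1
    rw [dRep_add, Submodule.coe_add, inner_add_left, inner_add_right, inner_add_right,
      hzero v, hzero (Complex.I • w'), dRep_smul, Submodule.coe_smul, inner_smul_left,
      inner_smul_right, Complex.conj_I] at h2
    -- Complex polarization: the quadratic form is also zero at `v + w` and at `v + i w`, and the
    -- combination of the two identities isolates the matrix coefficient.
    have h3 : (2 * Complex.I) * inner ℂ w (dRep π v (dloop ξ, 0)) = 0 := by
      linear_combination Complex.I * h1 - h2
    exact (mul_eq_zero.1 h3).resolve_left (by simp)
  have h5 : ∀ w : H, inner ℂ w (dRep π v (dloop ξ, 0)) = (0 : ℂ) :=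
    fun w => congrFun (Continuous.ext_on hd (by fun_prop) continuous_const horth) w
  exact inner_self_eq_zero.1 (h5 _)

end Representation

/-! ### Twisted periodic extension -/

section TwistBy

open Set Filter Topology

variable {X : Type*} {A : ℤ → X → X} {p a : ℝ} {u : ℝ → X}

/-- The extension of `u` from `[a, a + p)` to `ℝ` which is twisted by the `ℤ`-action `A`. -/
def twistBy (A : ℤ → X → X) (p a : ℝ) (u : ℝ → X) (t : ℝ) : X :=
  A (-⌊(t - a) / p⌋) (u (t - ⌊(t - a) / p⌋ * p))

lemma floor_cell (hp : 0 < p) {k : ℤ} {t : ℝ} (h1 : a + k * p ≤ t) (h2 : t < a + (k + 1) * p) :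
    ⌊(t - a) / p⌋ = k := by
  rw [Int.floor_eq_iff, le_div_iff₀ hp, div_lt_iff₀ hp]
  constructor <;> linarith

lemma twistBy_of_cell (hp : 0 < p) {k : ℤ} {t : ℝ} (h1 : a + k * p ≤ t)
    (h2 : t < a + (k + 1) * p) : twistBy A p a u t = A (-k) (u (t - k * p)) := by
  rw [twistBy, floor_cell hp h1 h2]

lemma exists_cell (hp : 0 < p) (a t : ℝ) : ∃ k : ℤ, a + k * p ≤ t ∧ t < a + (k + 1) * p := by
  refine ⟨⌊(t - a) / p⌋, ?_, ?_⟩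
  · have := Int.floor_le ((t - a) / p)
    rw [le_div_iff₀ hp] at this
    linarith
  · have := Int.lt_floor_add_one ((t - a) / p)
    rw [div_lt_iff₀ hp] at this
    linarith

lemma twistBy_eq_self (hp : 0 < p) (hA : ∀ x, A 0 x = x) {t : ℝ} (ht : t ∈ Ico a (a + p)) :
    twistBy A p a u t = u t := by
  rw [twistBy_of_cell hp (k := 0) (by simpa using ht.1) (by simpa using ht.2), neg_zero, hA]
  simp

lemma twistBy_add_period (hp : 0 < p) (hA : ∀ m n x, A (m + n) x = A m (A n x)) (t : ℝ) :
    twistBy A p a u (t + p) = A (-1) (twistBy A p a u t) := by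
  obtain ⟨k, h1, h2⟩ := exists_cell hp a t
  rw [twistBy_of_cell hp h1 h2, twistBy_of_cell hp (k := k + 1) (by push_cast; linarith)
    (by push_cast; linarith), ← hA]
  congr 1
  · ring_nf
  · congr 1
    push_cast
    ring

lemma twisted_add_mul (hA : ∀ m n x, A (m + n) x = A m (A n x)) (hA0 : ∀ x, A 0 x = x)
    {f : ℝ → X} (hf : ∀ t, f (t + p) = A (-1) (f t)) (k : ℤ) :
    ∀ t, f (t + k * p) = A (-k) (f t) := by
  induction k with
  | zero => intro t; simp [hA0]
  | succ n ih =>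
    intro t
    have : t + ((n + 1 : ℤ) : ℝ) * p = t + ((n : ℤ) : ℝ) * p + p := by push_cast; ring
    rw [this, hf, ih, ← hA]
    congr 1
    ring
  | pred n ih =>
    intro t
    have h1 := hf (t + ((-n - 1 : ℤ) : ℝ) * p)
    have : t + ((-n - 1 : ℤ) : ℝ) * p + p = t + ((-n : ℤ) : ℝ) * p := by push_cast; ring
    rw [this, ih] at h1
    have h2 := congrArg (A 1) h1
    rw [← hA, ← hA, add_neg_cancel, hA0] at h2
    rw [← h2]
    congr 1
    ring

lemma twistBy_eq (hp : 0 < p) (hA : ∀ m n x, A (m + n) x = A m (A n x)) (hA0 : ∀ x, A 0 x = x)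
    {f : ℝ → X} (hf : ∀ t, f (t + p) = A (-1) (f t)) (hu : ∀ t ∈ Ico a (a + p), u t = f t) :
    twistBy A p a u = f := by
  funext t
  obtain ⟨k, h1, h2⟩ := exists_cell hp a t
  rw [twistBy_of_cell hp h1 h2, hu _ ⟨by linarith, by linarith⟩, ← twisted_add_mul hA hA0 hf]
  simp

/-- Around the seam between cells `k - 1` and `k`, the two shifted copies of `u` are defined on both
sides, and the unused one has the neutral value `e`. Adding or multiplying the copies describes the
extension by one formula across the seam, which gives smoothness. -/
lemma twistBy_local (hp : 0 < p) {e : X} (hu : ∀ t ∉ Ioo a (a + p), u t = e) (k : ℤ) {t : ℝ}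
    (h1 : a + (k - 1) * p < t) (h2 : t < a + (k + 1) * p) :
    (twistBy A p a u t = A (-(k - 1)) (u (t - (k - 1) * p)) ∧ u (t - k * p) = e) ∨
    (twistBy A p a u t = A (-k) (u (t - k * p)) ∧ u (t - (k - 1) * p) = e) := by
  rcases lt_or_ge t (a + k * p) with h | h
  · refine Or.inl ⟨?_, hu _ fun hh => ?_⟩
    · rw [twistBy_of_cell hp (k := k - 1) (by push_cast; linarith) (by push_cast; linarith)]
      push_cast
      rfl
    · linarith [hh.1]
  · refine Or.inr ⟨twistBy_of_cell hp h h2, hu _ fun hh => ?_⟩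
    linarith [hh.2]

lemma eventually_local_cell (hp : 0 < p) (a t : ℝ) :
    ∃ k : ℤ, ∀ᶠ s in 𝓝 t, a + (k - 1) * p < s ∧ s < a + (k + 1) * p := by
  obtain ⟨k, h1, h2⟩ := exists_cell hp a t
  exact ⟨k, (lt_mem_nhds (by linarith)).and (gt_mem_nhds h2)⟩

end TwistBy

/-! ### Powers of the automorphism and the twisting period. -/

section Powers

open Set Filter Topology

variable {E : Type*} [NormedAddCommGroup E] [InnerProductSpace ℝ E] [CompleteSpace E]
  {K : Type*} [TopologicalSpace K] [ChartedSpace E K] [Group K] [LieGroup 𝓘(ℝ, E) ∞ K]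
  {φ ψ : MulAut K}

lemma IsLieAut.one : IsLieAut E (1 : MulAut K) where
  smooth := contMDiff_id
  smooth_inv := by rw [inv_one]; exact contMDiff_id
  isometry x y := by rw [lieMap_one, lieMap_one]

lemma IsLieAut.mul (hφ : IsLieAut E φ) (hψ : IsLieAut E ψ) : IsLieAut E (φ * ψ) where
  smooth := hφ.smooth.comp hψ.smooth
  smooth_inv := by
    rw [mul_inv_rev]
    exact hψ.smooth_inv.comp hφ.smooth_inv
  isometry x y := by
    rw [lieMap_mul hφ.smooth hψ.smooth, lieMap_mul hφ.smooth hψ.smooth, hφ.isometry, hψ.isometry]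

lemma IsLieAut.inv (hφ : IsLieAut E φ) : IsLieAut E φ⁻¹ where
  smooth := hφ.smooth_inv
  smooth_inv := by rw [inv_inv]; exact hφ.smooth
  isometry x y := by
    rw [← hφ.isometry, ← lieMap_mul hφ.smooth hφ.smooth_inv, ← lieMap_mul hφ.smooth hφ.smooth_inv,
      mul_inv_cancel, lieMap_one, lieMap_one]

lemma IsLieAut.zpow (hφ : IsLieAut E φ) (k : ℤ) : IsLieAut E (φ ^ k) := by
  induction k with
  | zero => exact IsLieAut.one
  | succ n ih => rw [zpow_add_one]; exact ih.mul hφ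
  | pred n ih => rw [zpow_sub_one]; exact ih.mul hφ.inv

lemma lieMap_zpow_add (hφ : IsLieAut E φ) (m n : ℤ) (x : E) :
    lieMap E (φ ^ (m + n)) x = lieMap E (φ ^ m) (lieMap E (φ ^ n) x) := by
  rw [zpow_add, lieMap_mul (hφ.zpow m).smooth (hφ.zpow n).smooth]

lemma lieMap_zpow_zero (x : E) : lieMap E (φ ^ (0 : ℤ)) x = x := lieMap_one x

lemma norm_lieMap_zpow (hφ : IsLieAut E φ) (k : ℤ) (x : E) : ‖lieMap E (φ ^ k) x‖ = ‖x‖ := by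
  rw [← sq_eq_sq₀ (norm_nonneg _) (norm_nonneg _), ← real_inner_self_eq_norm_sq,
    ← real_inner_self_eq_norm_sq, (hφ.zpow k).isometry]

/-- The twisting period. -/
def period (φ : MulAut K) : ℝ := 2 * Real.pi / orderOf φ

omit [TopologicalSpace K] [ChartedSpace E K] [LieGroup 𝓘(ℝ, E) ∞ K] in
lemma period_pos (h : IsOfFinOrder φ) : 0 < period φ :=
  div_pos Real.two_pi_pos (by exact_mod_cast h.orderOf_pos)

end Powers

/-! ### Twisting functions with values in the Lie algebra -/

section TwistAlgebra

open Set Filter Topology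

variable {E : Type*} [NormedAddCommGroup E] [InnerProductSpace ℝ E] [CompleteSpace E]
  {K : Type*} [TopologicalSpace K] [ChartedSpace E K] [Group K] [LieGroup 𝓘(ℝ, E) ∞ K]
  {φ : MulAut K} {a p : ℝ} {u v : ℝ → E}

/-- Smooth functions which vanish outside of `(a, a + p)`. -/
def IsCellFun {F : Type*} [NormedAddCommGroup F] [NormedSpace ℝ F] (p a : ℝ) (u : ℝ → F) : Prop :=
  ContDiff ℝ ∞ u ∧ ∀ t ∉ Ioo a (a + p), u t = 0

section CellFun

variable {F : Type*} [NormedAddCommGroup F] [NormedSpace ℝ F] {u v : ℝ → F}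

lemma IsCellFun.deriv (hu : IsCellFun p a u) : IsCellFun p a (deriv u) := by
  refine ⟨?_, fun t ht => ?_⟩
  · have := hu.1
    rw [show (∞ : WithTop ℕ∞) = ∞ + 1 from rfl, contDiff_succ_iff_deriv] at this
    exact this.2.2
  · have hd := (hu.1.differentiable (by simp) t).hasDerivAt
    rw [mem_Ioo, not_and_or, not_lt, not_lt] at ht
    rcases ht with ht | ht
    · have h1 : HasDerivWithinAt u 0 (Iic t) t :=
        (hasDerivWithinAt_const t (Iic t) (0 : F)).congr
          (fun s hs => hu.2 s fun h => by linarith [h.1, mem_Iic.1 hs])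
          (hu.2 t fun h => by linarith [h.1])
      exact (uniqueDiffWithinAt_Iic t).eq_deriv _ hd.hasDerivWithinAt h1
    · have h1 : HasDerivWithinAt u 0 (Ici t) t :=
        (hasDerivWithinAt_const t (Ici t) (0 : F)).congr
          (fun s hs => hu.2 s fun h => by linarith [h.2, mem_Ici.1 hs])
          (hu.2 t fun h => by linarith [h.2])
      exact (uniqueDiffWithinAt_Ici t).eq_deriv _ hd.hasDerivWithinAt h1

lemma IsCellFun.add (hu : IsCellFun p a u) (hv : IsCellFun p a v) :
    IsCellFun p a (fun t => u t + v t) :=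
  ⟨hu.1.add hv.1, fun t ht => by beta_reduce; rw [hu.2 t ht, hv.2 t ht, add_zero]⟩

lemma IsCellFun.smul {h : ℝ → ℝ} (hh : IsCellFun p a h) (hu : ContDiff ℝ ∞ u) :
    IsCellFun p a (fun t => h t • u t) :=
  ⟨hh.1.smul hu, fun t ht => by beta_reduce; rw [hh.2 t ht, zero_smul]⟩

lemma IsCellFun.smul_const {h : ℝ → ℝ} (hh : IsCellFun p a h) (x : F) :
    IsCellFun p a (fun t => h t • x) := hh.smul contDiff_const

lemma IsCellFun.const_smul (hu : IsCellFun p a u) (c : ℝ) : IsCellFun p a (fun t => c • u t) :=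
  ⟨contDiff_const.smul hu.1, fun t ht => by beta_reduce; rw [hu.2 t ht, smul_zero]⟩

lemma IsCellFun.sub (hu : IsCellFun p a u) (hv : IsCellFun p a v) :
    IsCellFun p a (fun t => u t - v t) :=
  ⟨hu.1.sub hv.1, fun t ht => by beta_reduce; rw [hu.2 t ht, hv.2 t ht, sub_zero]⟩

end CellFun

variable (φ) in
/-- The twisted extension of a vector valued function. -/
def twist (a : ℝ) (u : ℝ → E) : ℝ → E :=
  twistBy (fun k => lieMap E (φ ^ k)) (period φ) a u

variable (hφ : IsLieAut E φ) (hfin : IsOfFinOrder φ)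

include hfin in
lemma twist_local (hu : ∀ t ∉ Ioo a (a + period φ), u t = 0) (k : ℤ) {t : ℝ}
    (h1 : a + (k - 1) * period φ < t) (h2 : t < a + (k + 1) * period φ) :
    twist φ a u t = lieMap E (φ ^ (-(k - 1))) (u (t - (k - 1) * period φ)) +
      lieMap E (φ ^ (-k)) (u (t - k * period φ)) := by
  rcases twistBy_local (A := fun k => lieMap E (φ ^ k)) (period_pos hfin) hu k h1 h2 with h | h
  · rw [twist, h.1, h.2, map_zero, add_zero]
  · rw [twist, h.1, h.2, map_zero, zero_add]

include hfin in
lemma contDiff_twist (hu : IsCellFun (period φ) a u) : ContDiff ℝ ∞ (twist φ a u) := by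
  rw [contDiff_iff_contDiffAt]
  intro t
  obtain ⟨k, hk⟩ := eventually_local_cell (period_pos hfin) a t
  have : ContDiff ℝ ∞ (fun t => lieMap E (φ ^ (-(k - 1))) (u (t - (k - 1) * period φ)) +
      lieMap E (φ ^ (-k)) (u (t - k * period φ))) :=
    ((lieMap E (φ ^ (-(k - 1)))).contDiff.comp (hu.1.comp (contDiff_id.sub contDiff_const))).add
      ((lieMap E (φ ^ (-k))).contDiff.comp (hu.1.comp (contDiff_id.sub contDiff_const)))
  refine this.contDiffAt.congr_of_eventuallyEq ?_
  filter_upwards [hk] with s hs using twist_local hfin hu.2 k hs.1 hs.2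

include hfin in
lemma deriv_twist (hu : IsCellFun (period φ) a u) :
    deriv (twist φ a u) = twist φ a (deriv u) := by
  funext t
  obtain ⟨k, hk⟩ := eventually_local_cell (period_pos hfin) a t
  have hd : ∀ s, HasDerivAt u (deriv u s) s := fun s =>
    (hu.1.differentiable (by simp) s).hasDerivAt
  have h1 : ∀ c : ℝ, ∀ j : ℤ, HasDerivAt (fun t => lieMap E (φ ^ j) (u (t - c)))
      (lieMap E (φ ^ j) (deriv u (t - c))) t := fun c j =>
    (lieMap E (φ ^ j)).hasFDerivAt.comp_hasDerivAt t ((hd (t - c)).comp_sub_const t c)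
  have h2 := ((h1 ((k - 1) * period φ) (-(k - 1))).add (h1 (k * period φ) (-k)))
  rw [twist_local hfin hu.deriv.2 k hk.self_of_nhds.1 hk.self_of_nhds.2, ← h2.deriv]
  refine Filter.EventuallyEq.deriv_eq ?_
  filter_upwards [hk] with s hs using twist_local hfin hu.2 k hs.1 hs.2

include hfin in
lemma iteratedDeriv_twist (n : ℕ) : ∀ {u : ℝ → E}, IsCellFun (period φ) a u →
    iteratedDeriv n (twist φ a u) = twist φ a (iteratedDeriv n u) := by
  induction n with
  | zero => intro u _; simp [iteratedDeriv_zero]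
  | succ n ih =>
    intro u hu
    rw [iteratedDeriv_succ', deriv_twist hfin hu, ih hu.deriv, iteratedDeriv_succ']

include hφ hfin in
lemma twist_mem (hu : IsCellFun (period φ) a u) : twist φ a u ∈ twistedLoopSubmodule E φ :=
  ⟨contDiff_twist hfin hu, fun t => by
    have := twistBy_add_period (A := fun k => lieMap E (φ ^ k)) (a := a) (u := u)
      (period_pos hfin) (lieMap_zpow_add hφ) t
    rw [zpow_neg_one] at this
    exact this⟩

open Classical in
variable (φ) in
/-- The twisted loop which extends a given function from `[a, a + 2π/N)`. -/
def loopOf (a : ℝ) (u : ℝ → E) : TwistedLoopAlgebra E φ :=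
  if h : twist φ a u ∈ twistedLoopSubmodule E φ then
    (id ⟨twist φ a u, h⟩ : TwistedLoopAlgebra E φ) else 0

include hφ hfin in
lemma loopOf_coe (hu : IsCellFun (period φ) a u) : (loopOf φ a u).1 = twist φ a u := by
  rw [loopOf, dif_pos (twist_mem hφ hfin hu)]
  rfl

include hφ hfin in
lemma loopOf_cell (a t : ℝ) : ∃ k : ℤ,
    t - k * period φ ∈ Ico a (a + period φ) ∧ ∀ v, IsCellFun (period φ) a v →
      (loopOf φ a v).1 t = lieMap E (φ ^ (-k)) (v (t - k * period φ)) := by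
  obtain ⟨k, h1, h2⟩ := exists_cell (period_pos hfin) a t
  refine ⟨k, ⟨by linarith, by linarith⟩, fun v hv => ?_⟩
  rw [loopOf_coe hφ hfin hv, twist, twistBy_of_cell (period_pos hfin) h1 h2]

include hφ hfin in
lemma loopOf_add (hu : IsCellFun (period φ) a u) (hv : IsCellFun (period φ) a v) :
    loopOf φ a (fun t => u t + v t) = loopOf φ a u + loopOf φ a v := by
  ext t
  rw [TwistedLoopAlgebra.coe_add, Pi.add_apply, loopOf_coe hφ hfin hu, loopOf_coe hφ hfin hv,
    loopOf_coe hφ hfin (hu.add hv)]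
  exact map_add _ _ _

include hφ hfin in
lemma loopOf_sub (hu : IsCellFun (period φ) a u) (hv : IsCellFun (period φ) a v) :
    loopOf φ a (fun t => u t - v t) = loopOf φ a u - loopOf φ a v := by
  ext t
  rw [TwistedLoopAlgebra.coe_sub, Pi.sub_apply, loopOf_coe hφ hfin hu, loopOf_coe hφ hfin hv,
    loopOf_coe hφ hfin (hu.sub hv)]
  exact map_sub _ _ _

include hφ hfin in
lemma loopOf_const_smul (hu : IsCellFun (period φ) a u) (c : ℝ) :
    loopOf φ a (fun t => c • u t) = c • loopOf φ a u := by
  ext t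
  rw [TwistedLoopAlgebra.coe_smul, Pi.smul_apply, loopOf_coe hφ hfin hu,
    loopOf_coe hφ hfin (hu.const_smul c)]
  exact map_smul _ _ _

include hφ hfin in
lemma dloop_loopOf (hu : IsCellFun (period φ) a u) :
    dloop (loopOf φ a u) = loopOf φ a (deriv u) := by
  ext t
  change deriv (loopOf φ a u).1 t = _
  rw [loopOf_coe hφ hfin hu, loopOf_coe hφ hfin hu.deriv, deriv_twist hfin hu]

include hφ hfin in
lemma loopOf_eq (ξ : TwistedLoopAlgebra E φ) (hu : IsCellFun (period φ) a u)
    (h : ∀ t ∈ Ico a (a + period φ), u t = ξ.1 t) : loopOf φ a u = ξ := by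
  ext t
  rw [loopOf_coe hφ hfin hu]
  refine congrFun (twistBy_eq (A := fun k => lieMap E (φ ^ k)) (period_pos hfin)
    (lieMap_zpow_add hφ) lieMap_zpow_zero (fun t => ?_) h) t
  rw [zpow_neg_one]
  exact ξ.2.2 t

include hφ hfin in
lemma tendsto_loopOf {ι : Type*} {l : Filter ι} {w : ι → ℝ → E}
    (hw : ∀ i, IsCellFun (period φ) a (w i)) (hu : IsCellFun (period φ) a u)
    (h : ∀ n : ℕ, ∀ ε > 0, ∀ᶠ i in l, ∀ t ∈ Icc a (a + period φ),
      ‖iteratedDeriv n (w i) t - iteratedDeriv n u t‖ < ε) :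
    Tendsto (fun i => loopOf φ a (w i)) l (𝓝 (loopOf φ a u)) := by
  refine tendsto_loop fun n C _ ε hε => ?_
  filter_upwards [h n ε hε] with i hi t _
  rw [loopOf_coe hφ hfin hu, loopOf_coe hφ hfin (hw i), iteratedDeriv_twist hfin n hu,
    iteratedDeriv_twist hfin n (hw i)]
  obtain ⟨k, h1, h2⟩ := exists_cell (period_pos hfin) a t
  rw [twist, twist, twistBy_of_cell (period_pos hfin) h1 h2,
    twistBy_of_cell (period_pos hfin) h1 h2, ← map_sub, norm_lieMap_zpow hφ]
  exact hi _ ⟨by linarith, by linarith⟩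

include hφ hfin in
lemma loopExp_conj {w w' : ℝ → E} (hu : IsCellFun (period φ) a u) (hw : IsCellFun (period φ) a w)
    (hw' : IsCellFun (period φ) a w') (h : ∀ t, groupExp E K (u t) * groupExp E K (w t) *
      (groupExp E K (u t))⁻¹ = groupExp E K (w' t)) :
    loopExp E φ (loopOf φ a u) * loopExp E φ (loopOf φ a w) * (loopExp E φ (loopOf φ a u))⁻¹ =
      loopExp E φ (loopOf φ a w') := by
  refine loop_ext fun t => ?_
  obtain ⟨k, -, hk⟩ := loopOf_cell hφ hfin a t
  rw [Subgroup.coe_mul, Subgroup.coe_mul, Subgroup.coe_inv, Pi.mul_apply, Pi.mul_apply,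
    Pi.inv_apply, loopExp_apply hφ, loopExp_apply hφ, loopExp_apply hφ, hk u hu, hk w hw,
    hk w' hw', groupExp_lieMap (hφ.zpow _).smooth, groupExp_lieMap (hφ.zpow _).smooth,
    groupExp_lieMap (hφ.zpow _).smooth, ← h, map_mul, map_mul, map_inv]

end TwistAlgebra

/-! ### Approximation and cut-off functions -/

section Auxiliary

open Set Filter Topology

lemma exists_bump {l r ε : ℝ} (hlr : l < r) (hε : 0 < ε) : ∃ b : ℝ → ℝ, ContDiff ℝ ∞ b ∧
    (∀ t ∈ Icc l r, b t = 1) ∧ ∀ t ∉ Ioo (l - ε) (r + ε), b t = 0 := by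
  let b : ContDiffBump ((l + r) / 2) := ⟨(r - l) / 2, (r - l) / 2 + ε, by linarith, by linarith⟩
  refine ⟨b, b.contDiff, fun t ht => b.one_of_mem_closedBall ?_, fun t ht => b.zero_of_le_dist ?_⟩
  · rw [Metric.mem_closedBall, Real.dist_eq, abs_le]
    change -((r - l) / 2) ≤ _ ∧ _ ≤ (r - l) / 2
    constructor <;> linarith [ht.1, ht.2]
  · rw [Real.dist_eq]
    change (r - l) / 2 + ε ≤ _
    by_contra h
    rw [not_le, abs_lt] at h
    exact ht ⟨by linarith [h.1], by linarith [h.2]⟩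

lemma iteratedDeriv_clm {F G : Type*} [NormedAddCommGroup F] [NormedSpace ℝ F]
    [NormedAddCommGroup G] [NormedSpace ℝ G] (T : F →L[ℝ] G) (n : ℕ) :
    ∀ {u : ℝ → F}, ContDiff ℝ ∞ u →
      iteratedDeriv n (fun t => T (u t)) = fun t => T (iteratedDeriv n u t) := by
  induction n with
  | zero => intro u _; simp [iteratedDeriv_zero]
  | succ n ih =>
    intro u hu
    have h1 : deriv (fun t => T (u t)) = fun t => T (deriv u t) := funext fun t =>
      (T.hasFDerivAt.comp_hasDerivAt t (hu.differentiable (by simp) t).hasDerivAt).deriv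
    rw [show (∞ : WithTop ℕ∞) = ∞ + 1 from rfl, contDiff_succ_iff_deriv] at hu
    rw [iteratedDeriv_succ', h1, ih hu.2.2, iteratedDeriv_succ']

lemma eventually_uniform_of_contracting {F ι : Type*} [NormedAddCommGroup F] [NormedSpace ℝ F]
    {l : Filter ι} {T : ι → F →L[ℝ] F} (hT : ∀ i x, ‖T i x‖ ≤ ‖x‖)
    (hlim : ∀ x, ∀ᶠ i in l, T i x = x) {C : Set F} (hC : IsCompact C) {ε : ℝ} (hε : 0 < ε) :
    ∀ᶠ i in l, ∀ x ∈ C, ‖T i x - x‖ < ε := by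
  refine hC.induction_on (p := fun S => ∀ᶠ i in l, ∀ x ∈ S, ‖T i x - x‖ < ε) (by simp)
    (fun s t hst ht => ht.mono fun i hi x hx => hi x (hst hx))
    (fun s t hs ht => (hs.and ht).mono fun i hi x hx => hx.elim (hi.1 x) (hi.2 x)) fun x _ => ?_
  refine ⟨Metric.ball x (ε / 2), mem_nhdsWithin_of_mem_nhds (Metric.ball_mem_nhds x (half_pos hε)),
    (hlim x).mono fun i hi y hy => ?_⟩
  rw [Metric.mem_ball, dist_eq_norm] at hy
  have h1 : T i y - y = T i (y - x) - (y - x) := by rw [map_sub, hi]; abel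
  rw [h1]
  exact (norm_sub_le _ _).trans_lt (by linarith [hT i (y - x)])

lemma contDiff_primitive {F : Type*} [NormedAddCommGroup F] [NormedSpace ℝ F]
    [CompleteSpace F] {f : ℝ → F} (hf : ContDiff ℝ ∞ f) (a : ℝ) :
    (∀ t, HasDerivAt (fun t => ∫ s in a..t, f s) (f t) t) ∧
      ContDiff ℝ ∞ (fun t => ∫ s in a..t, f s) := by
  have h1 : ∀ t, HasDerivAt (fun t => ∫ s in a..t, f s) (f t) t := fun t =>
    intervalIntegral.integral_hasDerivAt_right (hf.continuous.intervalIntegrable _ _)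
      hf.continuous.aestronglyMeasurable.stronglyMeasurableAtFilter hf.continuous.continuousAt
  refine ⟨h1, ?_⟩
  rw [show (∞ : WithTop ℕ∞) = ∞ + 1 from rfl, contDiff_succ_iff_deriv]
  refine ⟨fun t => (h1 t).differentiableAt, by simp, ?_⟩
  rw [funext fun t => (h1 t).deriv]
  exact hf

end Auxiliary

/-! ### The derived representation vanishes on the twisted loop algebra. -/

section Kernel

open Set Filter Topology

variable {E : Type*} [NormedAddCommGroup E] [InnerProductSpace ℝ E] [CompleteSpace E]
  {K : Type*} [TopologicalSpace K] [ChartedSpace E K] [Group K] [LieGroup 𝓘(ℝ, E) ∞ K]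
  {φ : MulAut K} {H : Type*} [NormedAddCommGroup H] [InnerProductSpace ℂ H]
  {π : LoopSemidirect E φ →* (H ≃ₗᵢ[ℂ] H)} {a δ : ℝ} {h : ℝ → ℝ}
  (hφ : IsLieAut E φ) (hfin : IsOfFinOrder φ) (hd : Dense (smoothVectors E φ π))
  (hb : BoundedBelow E φ π)

include hφ hfin in
-- Let `|r| < δ`. If the loop does not vanish at `t`, then `t` is at distance at least `δ` from the
-- ends of its cell, so `t + r` lies in the same cell. Both values are then multiples of `L(φ)⁻ᵏ x`.
lemma eventually_common_line (hδ : 0 < δ) {f : ℝ → ℝ} (hf : ContDiff ℝ ∞ f)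
    (hf0 : ∀ t ∉ Icc (a + δ) (a + period φ - δ), f t = 0) (x : E) :
    ∀ᶠ r : ℝ in 𝓝 0, ∀ t, ∃ (z : E) (c d : ℝ), (loopOf φ a fun t => f t • x).1 t = c • z ∧
      (loopOf φ a fun t => f t • x).1 (t + r) = d • z := by
  have hcell : IsCellFun (period φ) a f :=
    ⟨hf, fun t ht => hf0 t fun h => ht ⟨by linarith [h.1], by linarith [h.2]⟩⟩
  filter_upwards [Metric.ball_mem_nhds (0 : ℝ) hδ] with r hr t
  rw [Metric.mem_ball, Real.dist_eq, sub_zero, abs_lt] at hr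
  rw [loopOf_coe hφ hfin (hcell.smul_const x)]
  obtain ⟨k, h1, h2⟩ := exists_cell (period_pos hfin) a t
  have hval := twistBy_of_cell (A := fun k => lieMap E (φ ^ k)) (u := fun t => f t • x)
    (period_pos hfin) h1 h2
  by_cases hz : f (t - k * period φ) = 0
  · refine ⟨twist φ a (fun t => f t • x) (t + r), 0, 1, ?_, (one_smul _ _).symm⟩
    rw [twist, hval, hz, zero_smul, map_zero, zero_smul]
  · have hmem : t - k * period φ ∈ Icc (a + δ) (a + period φ - δ) := by
      by_contra hh
      exact hz (hf0 _ hh)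
    have hval2 := twistBy_of_cell (A := fun k => lieMap E (φ ^ k)) (u := fun t => f t • x)
      (period_pos hfin) (k := k) (t := t + r) (a := a) (by linarith [hmem.1]) (by linarith [hmem.2])
    exact ⟨lieMap E (φ ^ (-k)) x, _, _, hval.trans (map_smul _ _ _), hval2.trans (map_smul _ _ _)⟩

include hφ hfin hd in
-- The kernel of `π` is normal. Passing from `dKer` to the group by exponentials and back makes an
-- adjoint action on the loop algebra unnecessary.
lemma loopOf_mem_dKer_of_conj {u w w' : ℝ → E} (hu : IsCellFun (period φ) a u)
    (hw : IsCellFun (period φ) a w) (hw' : IsCellFun (period φ) a w')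
    (h : ∀ (c : ℝ) t, groupExp E K (u t) * groupExp E K (c • w t) * (groupExp E K (u t))⁻¹ =
      groupExp E K (c • w' t)) (hmem : loopOf φ a w ∈ dKer π) : loopOf φ a w' ∈ dKer π := by
  refine mem_dKer_of_map_loopExp π fun c => ?_
  rw [← loopOf_const_smul hφ hfin hw', ← loopExp_conj hφ hfin hu (hw.const_smul c)
    (hw'.const_smul c) (h c), loopOf_const_smul hφ hfin hw, map_mul, map_mul, map_inv, map_mul,
    map_mul, map_inv, map_loopExp_eq_one π hφ hd ((dKer π).smul_mem c hmem), mul_one,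
    mul_inv_cancel]

include hφ hfin hd hb in
-- The primitive `F` of `h` need not vanish at the right end of the cell, so it is cut off by `χ`,
-- and the derivative of `χ F x` is `h x` plus the error `χ' F x`. The error lives within `δ / 2` of
-- the ends, while `g` equals `1` on the support of `h` and `0` on that of the error. Conjugation by
-- `exp(g y)` therefore turns `h x` into `h Ad(exp y) x` and leaves the error unchanged, so the
-- error cancels in the difference.
lemma loopOf_adjoint_sub_mem [CompleteSpace H] (hδ : 0 < δ) (hδ' : 2 * δ < period φ)
    (hh : ContDiff ℝ ∞ h) (h0 : ∀ t ∉ Icc (a + δ) (a + period φ - δ), h t = 0) (x y : E) :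
    loopOf φ a (fun t => h t • (adjoint E (groupExp E K y) x - x)) ∈ dKer π := by
  obtain ⟨χ, hχ, hχ1, hχ0⟩ := exists_bump (l := a + δ / 2) (r := a + period φ - δ / 2)
    (ε := δ / 4) (by linarith) (by linarith)
  obtain ⟨g, hg, hg1, hg0⟩ := exists_bump (l := a + δ) (r := a + period φ - δ)
    (ε := δ / 2) (by linarith) (by linarith)
  obtain ⟨hF, hFs⟩ := contDiff_primitive hh a
  set F : ℝ → ℝ := fun t => ∫ s in a..t, h s with hFdef
  have hhc : IsCellFun (period φ) a h :=
    ⟨hh, fun t ht => h0 t fun h => ht ⟨by linarith [h.1], by linarith [h.2]⟩⟩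
  have hχc : IsCellFun (period φ) a χ :=
    ⟨hχ, fun t ht => hχ0 t fun h => ht ⟨by linarith [h.1], by linarith [h.2]⟩⟩
  have hgc : IsCellFun (period φ) a g :=
    ⟨hg, fun t ht => hg0 t fun h => ht ⟨by linarith [h.1], by linarith [h.2]⟩⟩
  have hwc : IsCellFun (period φ) a (fun t => deriv χ t * F t) := hχc.deriv.smul hFs
  have hw0 : ∀ t ∈ Ioo (a + δ / 2) (a + period φ - δ / 2), deriv χ t * F t = 0 := by
    intro t ht
    have : χ =ᶠ[𝓝 t] fun _ => 1 := by
      filter_upwards [Ioo_mem_nhds ht.1 ht.2] with s hs using hχ1 s ⟨hs.1.le, hs.2.le⟩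
    rw [this.deriv_eq, deriv_const, zero_mul]
  have hχh : ∀ t, χ t * h t = h t := by
    intro t
    by_cases ht : t ∈ Icc (a + δ) (a + period φ - δ)
    · rw [hχ1 t ⟨by linarith [ht.1], by linarith [ht.2]⟩, one_mul]
    · rw [h0 t ht, mul_zero]
  have hfc : IsCellFun (period φ) a (fun t => χ t * F t) := hχc.smul hFs
  have hfd : deriv (fun t => (χ t * F t) • x) = fun t => (h t + deriv χ t * F t) • x := by
    funext t
    have h1 := (((hχ.differentiable (by simp) t).hasDerivAt.mul (hF t)).smul_const x).deriv
    rw [hχh, add_comm] at h1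
    exact h1
  have hmem : loopOf φ a (fun t => (h t + deriv χ t * F t) • x) ∈ dKer π := by
    rw [← hfd, ← dloop_loopOf hφ hfin (hfc.smul_const x)]
    refine dloop_mem_dKer π hφ hd hb (eventually_common_line hφ hfin (δ := δ / 4) (by linarith)
      hfc.1 (fun t ht => ?_) x)
    beta_reduce
    rw [hχ0 t fun hh => ht ⟨by linarith [hh.1], by linarith [hh.2]⟩, zero_mul]
  have hmem' := loopOf_mem_dKer_of_conj hφ hfin hd (hgc.smul_const y)
    ((hhc.add hwc).smul_const x)
    ((hhc.smul_const (adjoint E (groupExp E K y) x)).add (hwc.smul_const x)) (fun c t => by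
      by_cases hht : h t = 0
      · by_cases hgt : t ∈ Ioo (a + δ / 2) (a + period φ - δ / 2)
        · rw [hht, hw0 t hgt]
          simp [groupExp_zero]
        · rw [hg0 t fun hh => hgt ⟨by linarith [hh.1], by linarith [hh.2]⟩, hht]
          simp [groupExp_zero]
      · have ht : t ∈ Icc (a + δ) (a + period φ - δ) := by
          by_contra hh
          exact hht (h0 t hh)
        rw [hg1 t ht, hw0 t ⟨by linarith [ht.1], by linarith [ht.2]⟩, one_smul, ← groupExp_adjoint,
          zero_smul, add_zero, add_zero, map_smul, map_smul]) hmem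
  have hsub := (dKer π).sub_mem hmem' hmem
  rw [← loopOf_sub hφ hfin ((hhc.smul_const _).add (hwc.smul_const x))
    ((hhc.add hwc).smul_const x)] at hsub
  convert hsub using 2
  funext t
  rw [smul_sub, add_smul]
  abel

variable (π) in
/-- The vectors `x` for which the loop extending `h x` belongs to the kernel. -/
def dKerVectors (hφ : IsLieAut E φ) (hfin : IsOfFinOrder φ) (hh : IsCellFun (period φ) a h) :
    Submodule ℝ E where
  carrier := {x | loopOf φ a (fun t => h t • x) ∈ dKer π}
  add_mem' := by
    intro x y hx hy
    have := (dKer π).add_mem hx hy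
    rw [← loopOf_add hφ hfin (hh.smul_const x) (hh.smul_const y)] at this
    simpa only [mem_ofPred_eq, smul_add] using this
  zero_mem' := by
    have : loopOf φ a (fun t => h t • (0 : E)) = 0 :=
      loopOf_eq hφ hfin 0 (hh.smul_const 0) fun t _ => smul_zero _
    rw [mem_ofPred_eq, this]
    exact zero_mem _
  smul_mem' := by
    intro c x hx
    have := (dKer π).smul_mem c hx
    rw [← loopOf_const_smul hφ hfin (hh.smul_const x)] at this
    simpa only [mem_ofPred_eq, smul_comm c] using this

lemma isClosed_dKerVectors (hh : IsCellFun (period φ) a h) :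
    IsClosed (dKerVectors π hφ hfin hh : Set E) := by
  refine (isClosed_dKer π).preimage (f := fun x : E => loopOf φ a (fun t => h t • x)) ?_
  rw [continuous_iff_continuousAt]
  intro x
  refine tendsto_loopOf hφ hfin (fun y => hh.smul_const y) (hh.smul_const x) fun n ε hε => ?_
  have hc : Continuous (iteratedDeriv n h) :=
    hh.1.continuous_iteratedDeriv n (by exact_mod_cast le_top)
  obtain ⟨M, hM⟩ := isCompact_Icc.exists_bound_of_continuousOn (s := Icc a (a + period φ))
    hc.continuousOn
  have hit : ∀ y : E, iteratedDeriv n (fun t => h t • y) = fun t => iteratedDeriv n h t • y :=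
    fun y => iteratedDeriv_clm ((ContinuousLinearMap.id ℝ ℝ).smulRight y) n hh.1
  have hpos : 0 < |M| + 1 := by positivity
  filter_upwards [Metric.ball_mem_nhds x (div_pos hε hpos)] with y hy t ht
  rw [Metric.mem_ball, dist_eq_norm, lt_div_iff₀ hpos] at hy
  rw [hit, hit, ← smul_sub, norm_smul]
  calc ‖iteratedDeriv n h t‖ * ‖y - x‖ ≤ (|M| + 1) * ‖y - x‖ := by
        gcongr
        exact (hM t ht).trans ((le_abs_self M).trans (by linarith))
    _ < ε := by linarith

include hφ hfin hd hb in
-- The admissible vectors form a closed subspace that contains `Ad(exp(sx)) y - y`, hence also the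
-- derivative `[x, y]` at `s = 0`. Since it contains all brackets, it is an ideal, and it is nonzero
-- because some bracket is.
lemma loopOf_smul_mem [CompleteSpace H] (hsimple : IsSimpleHilbertLie E K)
    (hna : ∃ x y : E, bracket E K x y ≠ 0) (hδ : 0 < δ) (hδ' : 2 * δ < period φ)
    (hh : ContDiff ℝ ∞ h) (h0 : ∀ t ∉ Icc (a + δ) (a + period φ - δ), h t = 0) (x : E) :
    loopOf φ a (fun t => h t • x) ∈ dKer π := by
  have hhc : IsCellFun (period φ) a h :=
    ⟨hh, fun t ht => h0 t fun h => ht ⟨by linarith [h.1], by linarith [h.2]⟩⟩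
  have hbr : ∀ x y, bracket E K x y ∈ dKerVectors π hφ hfin hhc := by
    intro x y
    have h1 := (hasDerivAt_iff_tendsto_slope_zero.1 (hasDerivAt_adjoint (K := K) x y))
    refine (isClosed_dKerVectors hφ hfin hhc).mem_of_tendsto h1 (Eventually.of_forall fun s => ?_)
    refine Submodule.smul_mem _ _ ?_
    rw [zero_add, zero_smul, groupExp_zero, adjoint_one]
    exact loopOf_adjoint_sub_mem hφ hfin hd hb hδ hδ' hh h0 y (s • x)
  rcases hsimple _ (isClosed_dKerVectors hφ hfin hhc) (fun x y _ => hbr x y) with h1 | h1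
  · obtain ⟨x', y', hxy⟩ := hna
    have := hbr x' y'
    rw [h1] at this
    exact absurd this hxy
  · have : x ∈ dKerVectors π hφ hfin hhc := h1 ▸ Submodule.mem_top
    exact this

include hφ hfin hd hb in
-- Projecting `u` orthogonally onto the span of a finite set gives a finite sum of scalar functions
-- times fixed vectors. These contractions fix any given vector once the finite set contains it, so
-- they converge uniformly on the compact range of each derivative of `u` over a period, which is
-- convergence of loops.
lemma loopOf_mem [CompleteSpace H] (hsimple : IsSimpleHilbertLie E K)
    (hna : ∃ x y : E, bracket E K x y ≠ 0) (hδ : 0 < δ) (hδ' : 2 * δ < period φ) {u : ℝ → E}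
    (hu : ContDiff ℝ ∞ u) (h0 : ∀ t ∉ Icc (a + δ) (a + period φ - δ), u t = 0) :
    loopOf φ a u ∈ dKer π := by
  classical
  have huc : IsCellFun (period φ) a u :=
    ⟨hu, fun t ht => h0 t fun h => ht ⟨by linarith [h.1], by linarith [h.2]⟩⟩
  let T : Finset E → E →L[ℝ] E := fun s => (Submodule.span ℝ (s : Set E)).starProjection
  have hTc : ∀ s, IsCellFun (period φ) a (fun t => T s (u t)) := fun s =>
    ⟨(T s).contDiff.comp hu, fun t ht => by beta_reduce; rw [huc.2 t ht, map_zero]⟩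
  have hmem : ∀ s, loopOf φ a (fun t => T s (u t)) ∈ dKer π := by
    intro s
    set S := Submodule.span ℝ (s : Set E)
    let b := stdOrthonormalBasis ℝ S
    have hsum : ∀ J : Finset (Fin (Module.finrank ℝ S)),
        IsCellFun (period φ) a (fun t => ∑ i ∈ J, inner ℝ (b i : E) (u t) • (b i : E)) ∧
        loopOf φ a (fun t => ∑ i ∈ J, inner ℝ (b i : E) (u t) • (b i : E)) ∈ dKer π := by
      intro J
      induction J using Finset.induction_on with
      | empty =>
        have h1 : IsCellFun (period φ) a (fun _ : ℝ => (0 : E)) := ⟨contDiff_const, fun _ _ => rfl⟩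
        simp only [Finset.sum_empty]
        refine ⟨h1, ?_⟩
        rw [loopOf_eq hφ hfin 0 h1 fun _ _ => rfl]
        exact zero_mem _
      | insert i J hi ih =>
        simp only [Finset.sum_insert hi]
        have h1 : ContDiff ℝ ∞ (fun t => inner ℝ (b i : E) (u t)) := contDiff_const.inner ℝ hu
        have h2 : ∀ t ∉ Icc (a + δ) (a + period φ - δ), inner ℝ (b i : E) (u t) = 0 :=
          fun t ht => by rw [h0 t ht, inner_zero_right]
        have h3 : IsCellFun (period φ) a (fun t => inner ℝ (b i : E) (u t)) :=
          ⟨h1, fun t ht => by beta_reduce; rw [huc.2 t ht, inner_zero_right]⟩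
        refine ⟨(h3.smul_const _).add ih.1, ?_⟩
        rw [loopOf_add hφ hfin (h3.smul_const _) ih.1]
        exact (dKer π).add_mem (loopOf_smul_mem hφ hfin hd hb hsimple hna hδ hδ' h1 h2 _) ih.2
    have h1 : (fun t => T s (u t)) =
        fun t => ∑ i, inner ℝ (b i : E) (u t) • (b i : E) := by
      funext t
      change S.starProjection (u t) = _
      rw [b.starProjection_eq_sum_rankOne]
      simp
    rw [h1]
    exact (hsum Finset.univ).2
  refine (isClosed_dKer π).mem_of_tendsto (b := atTop) (tendsto_loopOf hφ hfin hTc huc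
    fun n ε hε => ?_) (Eventually.of_forall hmem)
  have hc : Continuous (iteratedDeriv n u) :=
    hu.continuous_iteratedDeriv n (by exact_mod_cast le_top)
  have h1 := eventually_uniform_of_contracting (l := atTop) (T := T)
    (fun s x => Submodule.norm_starProjection_apply_le _ _) (fun x => ?_)
    ((isCompact_Icc (a := a) (b := a + period φ)).image hc) hε
  · filter_upwards [h1] with s hs t ht
    rw [iteratedDeriv_clm (T s) n hu]
    exact hs _ (mem_image_of_mem _ ht)
  · filter_upwards [eventually_ge_atTop {x}] with s hs
    exact Submodule.starProjection_eq_self_iff.2 (Submodule.subset_span (hs (by simp)))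

include hφ hfin hd hb in
-- Two cells offset by half a period suffice. The first bump removes `ξ` on the middle half of `[0,
-- p)`. The remainder `ζ` vanishes on `[p/4, 3p/4]`, hence also on the translate of this interval by
-- `p`, so within the cell `[p/2, 3p/2)` it is supported in `[3p/4, 5p/4]`, where the second bump
-- equals `1`.
lemma mem_dKer_of_nonabelian [CompleteSpace H] (hsimple : IsSimpleHilbertLie E K)
    (hna : ∃ x y : E, bracket E K x y ≠ 0) (ξ : TwistedLoopAlgebra E φ) : ξ ∈ dKer π := by
  set p := period φ with hp
  have hpos : 0 < p := period_pos hfin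
  have key : ∀ (ζ : TwistedLoopAlgebra E φ) (a : ℝ) {b : ℝ → ℝ}, ContDiff ℝ ∞ b →
      (∀ t ∉ Ioo (a + p / 4 - p / 8) (a + 3 * p / 4 + p / 8), b t = 0) →
      IsCellFun p a (fun t => b t • ζ.1 t) ∧ loopOf φ a (fun t => b t • ζ.1 t) ∈ dKer π := by
    intro ζ a b hb1 hb0
    have h1 : ∀ t ∉ Icc (a + p / 8) (a + p - p / 8), b t • ζ.1 t = 0 := fun t ht => by
      rw [hb0 t fun hh => ht ⟨by linarith [hh.1], by linarith [hh.2]⟩, zero_smul]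
    refine ⟨⟨hb1.smul ζ.contDiff, fun t ht => h1 t fun hh =>
      ht ⟨by linarith [hh.1], by linarith [hh.2]⟩⟩, ?_⟩
    exact loopOf_mem hφ hfin hd hb hsimple hna (δ := p / 8) (by linarith)
      (by linarith) (hb1.smul ζ.contDiff) h1
  obtain ⟨b, hbs, hb1, hb0⟩ := exists_bump (l := 0 + p / 4) (r := 0 + 3 * p / 4) (ε := p / 8)
    (by linarith) (by linarith)
  obtain ⟨c, hcs, hc1, hc0⟩ := exists_bump (l := p / 2 + p / 4) (r := p / 2 + 3 * p / 4)
    (ε := p / 8) (by linarith) (by linarith)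
  obtain ⟨hb2, hb3⟩ := key ξ 0 hbs hb0
  set ζ := ξ - loopOf φ 0 (fun t => b t • ξ.1 t) with hζ
  obtain ⟨hc2, hc3⟩ := key ζ (p / 2) hcs hc0
  have hζ0 : ∀ t ∈ Icc (p / 4) (3 * p / 4), ζ.1 t = 0 := by
    intro t ht
    rw [hζ, TwistedLoopAlgebra.coe_sub, Pi.sub_apply, loopOf_coe hφ hfin hb2, twist,
      twistBy_eq_self hpos lieMap_zpow_zero ⟨by linarith [ht.1], by linarith [ht.2]⟩,
      hb1 t ⟨by linarith [ht.1], by linarith [ht.2]⟩, one_smul, sub_self]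
  have h2 : loopOf φ (p / 2) (fun t => c t • ζ.1 t) = ζ := by
    refine loopOf_eq hφ hfin ζ hc2 fun t ht => ?_
    rcases le_or_gt t (3 * p / 4) with h | h
    · rw [hζ0 t ⟨by linarith [ht.1], h⟩, smul_zero]
    rcases le_or_gt t (5 * p / 4) with h' | h'
    · rw [hc1 t ⟨by linarith, by linarith⟩, one_smul]
    · have h3 : ζ.1 t = 0 := by
        have h4 := ζ.2.2 (t - p)
        rw [hζ0 (t - p) ⟨by linarith, by linarith [ht.2]⟩, map_zero] at h4
        rw [← h4]
        exact congrArg ζ.1 (sub_add_cancel t p).symm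
      rw [h3, smul_zero]
  rw [h2] at hc3
  have := (dKer π).add_mem hc3 hb3
  rwa [hζ, sub_add_cancel] at this

include hφ hfin hd hb in
-- Every line is now a closed ideal, so the algebra has dimension at most one. In dimension one the
-- isometry `L(φ)` is `1` or `-1`, and `1` would make the whole algebra the center of the fixed
-- points. Twisted loops are then antiperiodic functions with values on one line, and each has an
-- antiperiodic primitive.
lemma mem_dKer_of_abelian [CompleteSpace H] (hsimple : IsSimpleHilbertLie E K)
    (hz : FixedCenterTrivial E φ) (hab : ∀ x y : E, bracket E K x y = 0)
    (ξ : TwistedLoopAlgebra E φ) : ξ ∈ dKer π := by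
  by_cases hE : ∀ x : E, x = 0
  · have : ξ = 0 := TwistedLoopAlgebra.ext fun t => hE _
    rw [this]
    exact zero_mem _
  push Not at hE
  obtain ⟨x, hx⟩ := hE
  have hspan : ∀ y : E, ∃ c : ℝ, c • x = y := by
    intro y
    rcases hsimple (Submodule.span ℝ {x}) (Submodule.closed_of_finiteDimensional _)
      (fun u v _ => by rw [hab]; exact zero_mem _) with h1 | h1
    · exact absurd (Submodule.span_singleton_eq_bot.1 h1) hx
    · exact Submodule.mem_span_singleton.1 (h1 ▸ Submodule.mem_top)
  obtain ⟨c, hc⟩ := hspan (lieMap E φ x)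
  have hc1 : c = -1 := by
    have h1 := norm_lieMap_zpow hφ 1 x
    rw [zpow_one, ← hc, norm_smul] at h1
    have h2 : |c| = 1 := (mul_eq_right₀ (norm_ne_zero_iff.2 hx)).1 h1
    rcases eq_or_eq_neg_of_abs_eq h2 with h3 | h3
    · rw [h3, one_smul] at hc
      exact absurd (hz x hc.symm fun y _ => hab x y) hx
    · exact h3
  have hneg : ∀ y, lieMap E φ⁻¹ y = -y := by
    intro y
    obtain ⟨d, rfl⟩ := hspan y
    have h1 : lieMap E φ⁻¹ (lieMap E φ x) = x := by
      rw [← lieMap_mul hφ.smooth_inv hφ.smooth, inv_mul_cancel, lieMap_one]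
    rw [← hc, hc1, neg_smul, one_smul, map_neg] at h1
    rw [map_smul, ← neg_eq_iff_eq_neg.2 h1.symm, smul_neg]
  set p := period φ with hp
  obtain ⟨hF, hFs⟩ := contDiff_primitive ξ.contDiff 0
  have hper : ∀ t, ξ.1 (t + p) = -ξ.1 t := fun t => (ξ.2.2 t).trans (hneg _)
  have hi : ∀ c d, IntervalIntegrable ξ.1 MeasureTheory.volume c d := fun c d =>
    ξ.contDiff.continuous.intervalIntegrable c d
  -- Subtracting half of the integral over a period is what makes the primitive antiperiodic.
  let η : TwistedLoopAlgebra E φ := id (⟨fun t => (∫ s in (0 : ℝ)..t, ξ.1 s) -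
    (1 / 2 : ℝ) • ∫ s in (0 : ℝ)..p, ξ.1 s, hFs.sub contDiff_const, fun t => by
      have h1 : (∫ s in (0 : ℝ)..t + p, ξ.1 s) =
          (∫ s in (0 : ℝ)..p, ξ.1 s) - ∫ s in (0 : ℝ)..t, ξ.1 s := by
        rw [← intervalIntegral.integral_add_adjacent_intervals (hi 0 p) (hi p (t + p))]
        have h2 := intervalIntegral.integral_comp_add_right (a := 0) (b := t) ξ.1 p
        rw [zero_add] at h2
        rw [← h2]
        simp only [hper, intervalIntegral.integral_neg]
        abel
      rw [hneg]
      change (∫ s in (0 : ℝ)..t + p, ξ.1 s) - _ = _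
      rw [h1]
      module⟩ : twistedLoopSubmodule E φ)
  have h1 : dloop η = ξ := TwistedLoopAlgebra.ext fun t => ((hF t).sub_const _).deriv
  rw [← h1]
  refine dloop_mem_dKer π hφ hd hb (Eventually.of_forall fun r t => ?_)
  obtain ⟨c1, h1⟩ := hspan (η.1 t)
  obtain ⟨c2, h2⟩ := hspan (η.1 (t + r))
  exact ⟨x, c1, c2, h1.symm, h2.symm⟩

include hφ hfin hd hb in
theorem map_loopExp [CompleteSpace H] (hsimple : IsSimpleHilbertLie E K)
    (hz : FixedCenterTrivial E φ) (ξ : TwistedLoopAlgebra E φ) :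
    π (SemidirectProduct.inl (loopExp E φ ξ)) = 1 := by
  refine map_loopExp_eq_one π hφ hd ?_
  by_cases hna : ∃ x y : E, bracket E K x y ≠ 0
  · exact mem_dKer_of_nonabelian hφ hfin hd hb hsimple hna ξ
  · push Not at hna
    exact mem_dKer_of_abelian hφ hfin hd hb hsimple hz hna ξ

end Kernel

/-! ### The twisted loop group is generated by exponentials -/

section Generation

open Set Filter Topology

variable {E : Type*} [NormedAddCommGroup E] [InnerProductSpace ℝ E] [CompleteSpace E]
  {K : Type*} [TopologicalSpace K] [ChartedSpace E K] [Group K] [LieGroup 𝓘(ℝ, E) ∞ K]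
  {φ : MulAut K} {r : ℝ} {W : Set K} {lg : K → E}

/-- `L(φ)` is isometric, so it preserves the ball on which `exp` is inverted. Hence `W` is
`φ`-invariant and the logarithm is equivariant, and the pointwise logarithm of a twisted loop in `W`
is again twisted. -/
lemma IsLocalLog.lieAut_mem (h : IsLocalLog r W lg) (hφ : IsLieAut E φ) (j : ℤ) {k : K}
    (hk : k ∈ W) : (φ ^ j) k ∈ W ∧ lg ((φ ^ j) k) = lieMap E (φ ^ j) (lg k) := by
  have h1 : lieMap E (φ ^ j) (lg k) ∈ Metric.ball (0 : E) r := by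
    have := h.log_mem k hk
    rw [mem_ball_zero_iff] at this ⊢
    rwa [norm_lieMap_zpow hφ]
  have h2 : (φ ^ j) k = groupExp E K (lieMap E (φ ^ j) (lg k)) := by
    rw [groupExp_lieMap (hφ.zpow j).smooth, h.exp_log k hk]
  rw [h2]
  exact ⟨h.exp_mem _ h1, h.log_exp _ h1⟩

lemma zpow_add_apply (m n : ℤ) (x : K) : (φ ^ (m + n)) x = (φ ^ m) ((φ ^ n) x) := by
  rw [zpow_add]; rfl

lemma twistedLoop_add_mul (f : twistedLoopGroup E φ) (k : ℤ) (t : ℝ) :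
    f.1 (t + k * period φ) = (φ ^ (-k)) (f.1 t) :=
  twisted_add_mul (A := fun k x => (φ ^ k) x) zpow_add_apply (fun _ => rfl)
    (fun t => by rw [zpow_neg_one]; exact f.2.2 t) k t

lemma IsLocalLog.mem_of_forall_mem (h : IsLocalLog r W lg) (hφ : IsLieAut E φ)
    {M : Subgroup (twistedLoopGroup E φ)} (hM : ∀ ξ, loopExp E φ ξ ∈ M)
    {f : twistedLoopGroup E φ} (hf : ∀ t, f.1 t ∈ W) : f ∈ M := by
  let ξ : TwistedLoopAlgebra E φ := id (⟨fun t => lg (f.1 t), by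
      have h1 : ContMDiff 𝓘(ℝ, ℝ) 𝓘(ℝ, E) ∞ (fun t => lg (f.1 t)) :=
        fun t => (h.smooth.contMDiffAt (h.isOpen.mem_nhds (hf t))).comp t (f.2.1 t)
      exact h1.contDiff, fun t => by
      have h1 := (h.lieAut_mem hφ (-1) (hf t)).2
      rw [zpow_neg_one] at h1
      beta_reduce
      rw [f.2.2, h1]⟩ : twistedLoopSubmodule E φ)
  have : loopExp E φ ξ = f := loop_ext fun t => by
    rw [loopExp_apply hφ]
    exact h.exp_log _ (hf t)
  rw [← this]
  exact hM ξ

lemma IsLocalLog.mem_of_close (h : IsLocalLog r W lg) (hφ : IsLieAut E φ) (hfin : IsOfFinOrder φ)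
    {M : Subgroup (twistedLoopGroup E φ)} (hM : ∀ ξ, loopExp E φ ξ ∈ M)
    {m f : twistedLoopGroup E φ} (hm : m ∈ M)
    (hf : ∀ t ∈ Ico 0 (period φ), (m.1 t)⁻¹ * f.1 t ∈ W) : f ∈ M := by
  have h1 : m⁻¹ * f ∈ M := by
    refine h.mem_of_forall_mem hφ hM fun t => ?_
    obtain ⟨k, h1, h2⟩ := exists_cell (period_pos hfin) 0 t
    have h3 := twistedLoop_add_mul (m⁻¹ * f) k (t - k * period φ)
    rw [sub_add_cancel] at h3
    rw [h3]
    exact (h.lieAut_mem hφ _ (hf _ ⟨by linarith, by linarith⟩)).1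
  simpa using M.mul_mem hm h1

lemma exists_loop (hφ : IsLieAut E φ) (hfin : IsOfFinOrder φ) {g : ℝ → K}
    (hg : ContMDiff 𝓘(ℝ, ℝ) 𝓘(ℝ, E) ∞ g) (hg1 : ∀ t ∉ Ioo 0 (period φ), g t = 1) :
    ∃ f : twistedLoopGroup E φ, ∀ t ∈ Ico 0 (period φ), f.1 t = g t := by
  have hp := period_pos hfin
  let A : ℤ → K → K := fun k x => (φ ^ k) x
  have hA1 : ∀ k, A k 1 = 1 := fun k => map_one _
  refine ⟨⟨twistBy A (period φ) 0 g, ?_, fun t => ?_⟩, fun t ht =>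
    twistBy_eq_self (A := A) hp (fun _ => rfl) (by rwa [zero_add])⟩
  · intro t
    obtain ⟨k, hk⟩ := eventually_local_cell hp 0 t
    have hs : ∀ (j : ℤ) (c : ℝ), ContMDiff 𝓘(ℝ, ℝ) 𝓘(ℝ, E) ∞ (fun t => A j (g (t - c))) :=
      fun j c => (hφ.zpow j).smooth.comp (hg.comp (contDiff_id.sub contDiff_const).contMDiff)
    refine ((hs (-(k - 1)) ((k - 1) * period φ)).mul (hs (-k) (k * period φ))
      |>.contMDiffAt).congr_of_eventuallyEq ?_
    filter_upwards [hk] with s hs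
    rcases twistBy_local (A := A) hp (e := 1) (by simpa using hg1) k hs.1 hs.2 with h | h
    · rw [h.1, Pi.mul_apply, h.2, hA1, mul_one]
    · rw [h.1, Pi.mul_apply, h.2, hA1, one_mul]
  · have := twistBy_add_period (A := A) (a := 0) (u := g) hp zpow_add_apply t
    refine this.trans ?_
    change (φ ^ (-1 : ℤ)) _ = _
    rw [zpow_neg_one]

/-- Smooth interpolation of finitely many nearby points of the group. -/
lemma exists_interpolation {ρ : ℝ} (c : ℕ → K) (n : ℕ) (h0 : c 0 = 1)
    (hc : ∀ i < n, ∃ x ∈ Metric.ball (0 : E) ρ, (c i)⁻¹ * c (i + 1) = groupExp E K x) :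
    ∃ G : ℝ → K, ContMDiff 𝓘(ℝ, ℝ) 𝓘(ℝ, E) ∞ G ∧ (∀ t ≤ 0, G t = 1) ∧
      (∀ t ≥ (n : ℝ), G t = c n) ∧
      ∀ i < n, ∀ t ∈ Icc (i : ℝ) (i + 1), ∃ x ∈ Metric.ball (0 : E) ρ,
        G t = c i * groupExp E K x := by
  induction n with
  | zero => exact ⟨fun _ => 1, contMDiff_const, fun _ _ => rfl, fun _ _ => h0.symm, by simp⟩
  | succ n ih =>
    obtain ⟨G, hG, hG0, hG1, hG2⟩ := ih fun i hi => hc i (hi.trans n.lt_succ_self)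
    obtain ⟨x, hx, hxe⟩ := hc n n.lt_succ_self
    -- The new factor moves from `c n` to `c (n + 1)` during `[n, n + 1]` and is constant outside,
    -- so products of such factors are smooth.
    have hθ : ContDiff ℝ ∞ (fun t : ℝ => Real.smoothTransition (t - n) • x) :=
      (Real.smoothTransition.contDiff.comp (contDiff_id.sub contDiff_const)).smul contDiff_const
    refine ⟨fun t => G t * groupExp E K (Real.smoothTransition (t - n) • x),
      hG.mul ((contMDiff_groupExp E K).comp hθ.contMDiff), fun t ht => ?_, fun t ht => ?_,
      fun i hi t ht => ?_⟩
    · have : t - n ≤ 0 := by linarith [(Nat.cast_nonneg n : (0 : ℝ) ≤ n)]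
      beta_reduce
      rw [hG0 t ht, Real.smoothTransition.zero_of_nonpos this, zero_smul, groupExp_zero, mul_one]
    · push_cast at ht
      beta_reduce
      rw [hG1 t (by linarith), Real.smoothTransition.one_of_one_le (by linarith), one_smul, ← hxe,
        mul_inv_cancel_left]
    · rcases Nat.lt_succ_iff_lt_or_eq.1 hi with hi | rfl
      · obtain ⟨y, hy, hye⟩ := hG2 i hi t ht
        have h1 : ((i : ℝ) + 1) ≤ n := by exact_mod_cast hi
        refine ⟨y, hy, ?_⟩
        beta_reduce
        rw [Real.smoothTransition.zero_of_nonpos (by linarith [ht.2]), zero_smul, groupExp_zero,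
          mul_one, hye]
      · refine ⟨_, ?_, congrArg (· * _) (hG1 t ht.1)⟩
        rw [mem_ball_zero_iff] at hx ⊢
        rw [norm_smul, Real.norm_of_nonneg (Real.smoothTransition.nonneg _)]
        exact (mul_le_of_le_one_left (norm_nonneg x) (Real.smoothTransition.le_one _)).trans_lt hx

/-- Three factors are needed to compare neighbouring interpolations: `(c exp x)⁻¹ (d exp z)` is
`exp(-x) (c⁻¹ d) exp z`, with `c⁻¹ d` again a small exponential. -/
lemma IsLocalLog.exists_radius (h : IsLocalLog r W lg) : ∃ ρ > 0, ∃ V ∈ 𝓝 (1 : K),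
    (∀ k ∈ V, ∃ x ∈ Metric.ball (0 : E) ρ, k = groupExp E K x) ∧
    ∀ x ∈ Metric.ball (0 : E) ρ, ∀ y ∈ Metric.ball (0 : E) ρ, ∀ z ∈ Metric.ball (0 : E) ρ,
      groupExp E K x * groupExp E K y * groupExp E K z ∈ W := by
  have : IsTopologicalGroup K := isTopologicalGroup_of_smooth E K
  have h0 : (0 : E) ∈ Metric.ball (0 : E) r := Metric.mem_ball_self h.pos
  have h1W : (1 : K) ∈ W := by simpa [groupExp_zero] using h.exp_mem 0 h0
  have hexp := (contMDiff_groupExp E K).continuous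
  have hc : Continuous fun q : (E × E) × E =>
      groupExp E K q.1.1 * groupExp E K q.1.2 * groupExp E K q.2 := by fun_prop
  have hev : ∀ᶠ q : (E × E) × E in 𝓝 0,
      groupExp E K q.1.1 * groupExp E K q.1.2 * groupExp E K q.2 ∈ W :=
    hc.continuousAt.eventually (h.isOpen.mem_nhds (by simpa [groupExp_zero] using h1W))
  obtain ⟨ρ, hρ, hball⟩ := Metric.eventually_nhds_iff_ball.1 hev
  have hlg : ContinuousAt lg 1 := h.smooth.continuousOn.continuousAt (h.isOpen.mem_nhds h1W)
  have hlg1 : lg 1 = 0 := by simpa [groupExp_zero] using h.log_exp 0 h0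
  refine ⟨ρ, hρ, W ∩ lg ⁻¹' Metric.ball 0 ρ, Filter.inter_mem (h.isOpen.mem_nhds h1W)
    (hlg (by rw [hlg1]; exact Metric.ball_mem_nhds 0 hρ)),
    fun k hk => ⟨lg k, hk.2, (h.exp_log k hk.1).symm⟩, fun x hx y hy z hz => ?_⟩
  refine hball ((x, y), z) ?_
  simp only [mem_ball_zero_iff] at hx hy hz ⊢
  simp only [Prod.norm_def, max_lt_iff]
  exact ⟨⟨hx, hy⟩, hz⟩

lemma exists_uniform_of_continuous [IsTopologicalGroup K] {F : unitInterval × unitInterval → K}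
    (hF : Continuous F) {V : Set K} (hV : V ∈ 𝓝 (1 : K)) :
    ∃ δ > 0, ∀ q q', dist q q' < δ → (F q)⁻¹ * F q' ∈ V := by
  have h1 : {q : (unitInterval × unitInterval) × (unitInterval × unitInterval) |
      (F q.1)⁻¹ * F q.2 ∈ V} ∈ uniformity (unitInterval × unitInterval) := by
    rw [← nhdsSet_diagonal_eq_uniformity, mem_nhdsSet_iff_forall]
    rintro ⟨q, q'⟩ h
    obtain rfl : q = q' := h
    have hc : Continuous fun q : (unitInterval × unitInterval) × (unitInterval × unitInterval) =>
      (F q.1)⁻¹ * F q.2 := by fun_prop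
    exact hc.continuousAt (by simpa using hV)
  obtain ⟨δ, hδ, h2⟩ := Metric.mem_uniformity_dist.1 h1
  exact ⟨δ, hδ, fun q q' h => h2 h⟩

/-- Over one period `f` is a closed path at `1`, hence homotopic to the constant path with fixed
endpoints. The homotopy is only continuous, so it is sampled on a fine grid and each row is
interpolated to a smooth twisted loop `g j`. Row `0` stays in `W`, consecutive rows differ by values
in `W`, and the last row is equally close to `f`. Each step therefore multiplies by one exponential
loop. -/
lemma mem_of_map_zero [SimplyConnectedSpace K] (hφ : IsLieAut E φ) (hfin : IsOfFinOrder φ)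
    {M : Subgroup (twistedLoopGroup E φ)} (hM : ∀ ξ, loopExp E φ ξ ∈ M)
    {f : twistedLoopGroup E φ} (hf : f.1 0 = 1) : f ∈ M := by
  have : IsTopologicalGroup K := isTopologicalGroup_of_smooth E K
  obtain ⟨r, W, lg, h⟩ := exists_isLocalLog E K
  obtain ⟨ρ, hρ, V, hV, hVe, hW⟩ := h.exists_radius
  have hW' : ∀ x ∈ Metric.ball (0 : E) ρ, ∀ k ∈ V, ∀ z ∈ Metric.ball (0 : E) ρ, ∀ c d : K,
      c⁻¹ * d = k → (c * groupExp E K x)⁻¹ * (d * groupExp E K z) ∈ W := by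
    intro x hx k hk z hz c d hcd
    obtain ⟨y, hy, rfl⟩ := hVe k hk
    have := hW (-x) (by simpa using hx) y hy z hz
    rw [groupExp_neg, ← hcd] at this
    convert this using 1
    group
  have hp := period_pos hfin
  set p := period φ with hpdef
  have hfp : f.1 p = 1 := by
    have := twistedLoop_add_mul f 1 0
    rw [hf, map_one] at this
    rw [← this]
    simp [hpdef]
  let γ : Path (1 : K) 1 :=
    { toFun := fun t => f.1 (p * t)
      continuous_toFun := f.2.1.continuous.comp (by fun_prop)
      source' := by simp [hf]
      target' := by simp [hfp] }
  obtain ⟨Φ⟩ := SimplyConnectedSpace.paths_homotopic (Path.refl (1 : K)) γ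
  obtain ⟨δ, hδ, huni⟩ := exists_uniform_of_continuous (F := fun q => Φ q) Φ.continuous hV
  let F : ℝ → ℝ → K := fun s t =>
    Φ (projIcc 0 1 zero_le_one s, projIcc 0 1 zero_le_one t)
  have hFu : ∀ s s' t t' : ℝ, |s - s'| < δ → |t - t'| < δ → (F s t)⁻¹ * F s' t' ∈ V := by
    intro s s' t t' hs ht
    refine huni _ _ ?_
    rw [Prod.dist_eq, max_lt_iff]
    exact ⟨(abs_projIcc_sub_projIcc zero_le_one).trans_lt hs,
      (abs_projIcc_sub_projIcc zero_le_one).trans_lt ht⟩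
  have hF0 : ∀ t, F 0 t = 1 := fun t => by simp [F, projIcc_left]
  have hF1 : ∀ t ∈ Icc (0 : ℝ) 1, F 1 t = f.1 (p * t) := fun t ht => by
    simp [F, projIcc_right, projIcc_of_mem _ ht, γ]
  have hFl : ∀ s, F s 0 = 1 := fun s => by simp [F, projIcc_left]
  have hFr : ∀ s, F s 1 = 1 := fun s => by simp [F, projIcc_right]
  obtain ⟨n, hn⟩ := exists_nat_one_div_lt hδ
  set N : ℕ := n + 1 with hN
  have hN0 : (0 : ℝ) < N := by positivity
  have hNδ : 1 / (N : ℝ) < δ := by rw [hN]; push_cast; exact hn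
  have hstep : ∀ j : ℕ, |(j : ℝ) / N - ((j + 1 : ℕ) : ℝ) / N| < δ := by
    intro j
    have : (j : ℝ) / N - ((j + 1 : ℕ) : ℝ) / N = -(1 / N) := by push_cast; ring
    rwa [this, abs_neg, abs_of_pos (by positivity)]
  -- The left edge of the homotopy is `1`, as the interpolation requires. Together with the right
  -- edge, also `1`, it makes each row trivial outside `(0, p)`, so the row can be extended by
  -- twisting.
  have hinterp := fun j : ℕ => exists_interpolation (E := E) (ρ := ρ)
    (fun i : ℕ => F (j / N) (i / N)) N (by simp [hFl])
    (fun i _ => hVe _ (hFu _ _ _ _ (by simpa using hδ) (hstep i)))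
  choose G hGs hG0 hG1 hG2 using hinterp
  have hloop : ∀ j : ℕ, ∃ g : twistedLoopGroup E φ, ∀ t ∈ Ico 0 p, g.1 t = G j (N * (t / p)) := by
    intro j
    refine exists_loop hφ hfin (g := fun t => G j (N * (t / p)))
      ((hGs j).comp (contDiff_const.mul (contDiff_id.div_const p)).contMDiff) fun t ht => ?_
    rw [mem_Ioo, not_and_or, not_lt, not_lt] at ht
    rcases ht with ht | ht
    · exact hG0 j _ (mul_nonpos_of_nonneg_of_nonpos hN0.le (div_nonpos_of_nonpos_of_nonneg ht hp.le))
    · have h1 : (1 : ℝ) ≤ t / p := (one_le_div hp).2 ht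
      rw [hG1 j _ (le_mul_of_one_le_right hN0.le h1), div_self hN0.ne', hFr]
  choose g hg using hloop
  have hcell : ∀ t ∈ Ico 0 p, ∃ i < N, N * (t / p) ∈ Icc (i : ℝ) (i + 1) := by
    intro t ht
    have h1 : 0 ≤ N * (t / p) := mul_nonneg hN0.le (div_nonneg ht.1 hp.le)
    refine ⟨⌊N * (t / p)⌋₊, ?_, Nat.floor_le h1, (Nat.lt_floor_add_one _).le⟩
    rw [Nat.floor_lt h1]
    exact mul_lt_of_lt_one_right hN0 ((div_lt_one hp).2 ht.2)
  have hgM : ∀ j, g j ∈ M := by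
    intro j
    induction j with
    | zero =>
      refine h.mem_of_close hφ hfin hM M.one_mem fun t ht => ?_
      obtain ⟨i, hi, hti⟩ := hcell t ht
      obtain ⟨x, hx, hxe⟩ := hG2 0 i hi _ hti
      rw [hg 0 t ht, hxe]
      have := hW x hx 0 (Metric.mem_ball_self hρ) 0 (Metric.mem_ball_self hρ)
      simpa [groupExp_zero, hF0] using this
    | succ j ih =>
      refine h.mem_of_close hφ hfin hM ih fun t ht => ?_
      obtain ⟨i, hi, hti⟩ := hcell t ht
      obtain ⟨x, hx, hxe⟩ := hG2 j i hi _ hti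
      obtain ⟨y, hy, hye⟩ := hG2 (j + 1) i hi _ hti
      rw [hg j t ht, hg (j + 1) t ht, hxe, hye]
      exact hW' x hx _ (hFu _ _ _ _ (hstep j) (by simpa using hδ)) y hy _ _ rfl
  refine h.mem_of_close hφ hfin hM (hgM N) fun t ht => ?_
  obtain ⟨i, hi, hti⟩ := hcell t ht
  obtain ⟨x, hx, hxe⟩ := hG2 N i hi _ hti
  have h1 : f.1 t = F 1 (t / p) * groupExp E K 0 := by
    rw [groupExp_zero, mul_one, hF1 _ ⟨div_nonneg ht.1 hp.le, ((div_lt_one hp).2 ht.2).le⟩,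
      mul_div_cancel₀ _ hp.ne']
  rw [hg N t ht, hxe, h1]
  refine hW' x hx _ (hFu _ _ _ _ ?_ ?_) 0 (Metric.mem_ball_self hρ) _ _ rfl
  · rw [div_self hN0.ne', sub_self, abs_zero]
    exact hδ
  · have h2 : (i : ℝ) / N ≤ t / p := by rw [div_le_iff₀ hN0]; linarith [hti.1]
    have h3 : t / p ≤ i / N + 1 / N := by rw [← add_div, le_div_iff₀ hN0]; linarith [hti.2]
    rw [abs_lt]
    constructor <;> linarith

/-- Evaluation at `0` maps `M` onto a subgroup containing every `exp x`: take the loop `b x` with a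
bump `b` equal to `1` near `0`. The cell starts at half a period before `0`, so that `0` is an
interior point and the twist imposes no condition there. The image is an open subgroup of a
connected group. -/
lemma exists_mem_map_zero [SimplyConnectedSpace K] (hφ : IsLieAut E φ) (hfin : IsOfFinOrder φ)
    {M : Subgroup (twistedLoopGroup E φ)} (hM : ∀ ξ, loopExp E φ ξ ∈ M) (k : K) :
    ∃ m ∈ M, m.1 0 = k := by
  have : IsTopologicalGroup K := isTopologicalGroup_of_smooth E K
  obtain ⟨r, W, lg, h⟩ := exists_isLocalLog E K
  have hp := period_pos hfin
  let ev : twistedLoopGroup E φ →* K :=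
    (Pi.evalMonoidHom (fun _ : ℝ => K) 0).comp (twistedLoopGroup E φ).subtype
  obtain ⟨b, hb, hb1, hb0⟩ := exists_bump (l := -(period φ / 8)) (r := period φ / 8)
    (ε := period φ / 8) (by linarith) (by linarith)
  have hbc : IsCellFun (period φ) (-(period φ / 2)) b :=
    ⟨hb, fun t ht => hb0 t fun h => ht ⟨by linarith [h.1], by linarith [h.2]⟩⟩
  have hexp : ∀ x : E, groupExp E K x ∈ M.map ev := by
    intro x
    refine ⟨_, hM (loopOf φ (-(period φ / 2)) fun t => b t • x), ?_⟩
    change (loopExp E φ _).1 0 = _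
    rw [loopExp_apply hφ, loopOf_coe hφ hfin (hbc.smul_const x), twist,
      twistBy_eq_self hp lieMap_zpow_zero ⟨by linarith, by linarith⟩,
      hb1 0 ⟨by linarith, by linarith⟩, one_smul]
  have hopen : IsOpen (M.map ev : Set K) := by
    refine Subgroup.isOpen_of_mem_nhds _ (g := 1) (Filter.mem_of_superset
      (h.isOpen.mem_nhds ?_) fun k hk => ?_)
    · simpa [groupExp_zero] using h.exp_mem 0 (Metric.mem_ball_self h.pos)
    · rw [← h.exp_log k hk]
      exact hexp _
  have huniv : (M.map ev : Set K) = univ :=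
    IsClopen.eq_univ ⟨Subgroup.isClosed_of_isOpen _ hopen, hopen⟩ ⟨1, one_mem (M.map ev)⟩
  obtain ⟨m, hm, hmk⟩ : k ∈ (M.map ev : Set K) := huniv ▸ mem_univ k
  exact ⟨m, hm, hmk⟩

theorem subgroup_eq_top [SimplyConnectedSpace K] (hφ : IsLieAut E φ) (hfin : IsOfFinOrder φ)
    {M : Subgroup (twistedLoopGroup E φ)} (hM : ∀ ξ, loopExp E φ ξ ∈ M) : M = ⊤ := by
  refine (Subgroup.eq_top_iff' M).2 fun f => ?_
  obtain ⟨m, hm, hmf⟩ := exists_mem_map_zero hφ hfin hM (f.1 0)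
  have h1 : f * m⁻¹ ∈ M := by
    refine mem_of_map_zero hφ hfin hM ?_
    rw [Subgroup.coe_mul, Subgroup.coe_inv, Pi.mul_apply, Pi.inv_apply, hmf, mul_inv_cancel]
  simpa using M.mul_mem h1 hm

end Generation

end HilbertLoop

end

theorem mainTheorem11
    {E : Type*} [NormedAddCommGroup E] [InnerProductSpace ℝ E] [CompleteSpace E]
    {K : Type*} [TopologicalSpace K] [ChartedSpace E K] [Group K] [LieGroup 𝓘(ℝ, E) ∞ K]
    [SimplyConnectedSpace K]
    (hK : HilbertLoop.IsHilbertLie E K) (hsimple : HilbertLoop.IsSimpleHilbertLie E K)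
    (φ : MulAut K) (hφ : HilbertLoop.IsLieAut E φ) (hfin : IsOfFinOrder φ)
    (hz : HilbertLoop.FixedCenterTrivial E φ)
    {H : Type*} [NormedAddCommGroup H] [InnerProductSpace ℂ H] [CompleteSpace H]
    (π : HilbertLoop.LoopSemidirect E φ →* (H ≃ₗᵢ[ℂ] H))
    (hsmooth : Dense (HilbertLoop.smoothVectors E φ π))
    (hbdd : HilbertLoop.BoundedBelow E φ π) :
    ∀ f : HilbertLoop.twistedLoopGroup E φ, π (SemidirectProduct.inl f) = 1 := by
  have h : ((MonoidHom.ker π).comap SemidirectProduct.inl) = ⊤ :=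
    HilbertLoop.subgroup_eq_top hφ hfin fun ξ =>
      HilbertLoop.map_loopExp hφ hfin hsmooth hbdd hsimple hz ξ
  intro f
  have hf : f ∈ (MonoidHom.ker π).comap SemidirectProduct.inl := h ▸ Subgroup.mem_top f
  exact hf
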